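/- Let $(\mathcal M,\mathbf g)$ be an oriented smooth $4$-dimensional Lorentzian manifold of signature $(-,+,+,+)$ with volume form $\in$ and Levi-Civita connection $\mathbf D$, satisfying the Einstein vacuum equations $\mathbf{Ric}(\mathbf g)=0$, and let $\mathbf T$ be a smooth Killing vector field on $\mathcal M$ (for instance the stationary Killing field of a stationary vacuum spacetime). Put $$F_{\alpha\beta}=\mathbf D_\alpha \mathbf T_\beta,\qquad \mathcal F_{\alpha\beta}=F_{\alpha\beta}+\tfrac i2\in_{\alpha\beta}{}^{\mu\nu}F_{\mu\nu},\qquad \mathcal F^2=\mathcal F_{\alpha\beta}\mathcal F^{\alpha\beta},\qquad \mathcal R_{\alpha\beta\mu\nu}=\mathbf R_{\alpha\beta\mu\nu}+\tfrac i2\in_{\alpha\beta}{}^{\rho\lambda}\mathbf R_{\rho\lambda\mu\nu},$$ where $\mathbf R$ is the Riemann curvature tensor, with the sign for which $\mathbf D_\mu\mathbf D_\alpha\mathbf T_\beta=\mathbf R_{\lambda\mu\alpha\beta}\mathbf T^\lambda$. Let $\sigma:\mathcal M\to\mathbb C$ be an Ernst potential of $\mathbf T$, i.e. a smooth function with $\mathbf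 D_\mu\sigma=2\mathbf T^\alpha\mathcal F_{\alpha\mu}$ (any choice of the additive constant is allowed). On the open set $U=\{\sigma\neq1\}$ define the Mars–Simon tensor $$\mathcal S_{\alpha\beta\mu\nu}=\mathcal R_{\alpha\beta\mu\nu}+6(1-\sigma)^{-1}\Big(\mathcal F_{\alpha\beta}\mathcal F_{\mu\nu}-\tfrac13\mathcal F^2\,\mathcal I_{\alpha\beta\mu\nu}\Big),\qquad \mathcal I_{\alpha\beta\mu\nu}=\tfrac14\big(\mathbf g_{\alpha\mu}\mathbf g_{\beta\nu}-\mathbf g_{\alpha\nu}\mathbf g_{\beta\mu}+i\in_{\alpha\beta\mu\nu}\big).$$ Then $\mathcal S$ satisfies on $U$ a covariant wave equation $$\square\,\mathcal S=\mathcal M(\mathbf D\mathcal S,\mathcal S),\qquad \square=\mathbf g^{\mu\nu}\mathbf D_\mu\mathbf D_\nu,$$ where $\mathcal M(\mathbf D\mathcal S,\mathcal S)=A(\mathbf D\mathcal S)+B(\mathcal S)$ and $A$, $B$ are smooth tensor fields on $U$ acting as complex-linear maps, at each point, from complex covariant $5$-tensors, respectively $4$-tensors, to complex covariant $4$-tensors.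 -/

import Mathlib

open scoped Manifold ContDiff

-- so that `ℝ⁴` is charted by itself through Mathlib's `chartedSpaceSelf`
attribute [-instance] TopCat.of.chartedSpace

/-- The model space `ℝ⁴`. -/
abbrev E4 : Type := EuclideanSpace ℝ (Fin 4)

namespace Spacetime

noncomputable section

section Coordinates

/-! ### Coordinates

Below, `e` is a chart of the manifold `M`. All component functions are functions on `M`, which are
only meaningful on the domain `e.source` of the chart. -/

variable {M : Type*} [TopologicalSpace M] [ChartedSpace E4 M]

/-- The coordinate vector field `∂/∂xⁱ` of the chart `e`, at the point `p`. -/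
def frame (e : OpenPartialHomeomorph M E4) (p : M) (i : Fin 4) : TangentSpace (𝓡 4) p :=
  (mfderiv (𝓡 4) (𝓡 4) e p).inverse (EuclideanSpace.single i (1 : ℝ))

/-- The coordinate one-form `dxⁱ` of the chart `e`, at the point `p`. -/
def coframe (e : OpenPartialHomeomorph M E4) (p : M) (i : Fin 4) :
    TangentSpace (𝓡 4) p →ₗ[ℝ] ℝ :=
  (EuclideanSpace.proj (𝕜 := ℝ) i).toLinearMap ∘ₗ (mfderiv (𝓡 4) (𝓡 4) e p).toLinearMap

/-- The partial derivative `∂f/∂xⁱ` in the chart `e`, as a function on the manifold. -/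
def pd {V : Type*} [NormedAddCommGroup V] [NormedSpace ℝ V]
    (e : OpenPartialHomeomorph M E4) (i : Fin 4) (f : M → V) (p : M) : V :=
  fderiv ℝ (f ∘ e.symm) (e p) (EuclideanSpace.single i (1 : ℝ))

/-- The components, in some chart, of a field of covariant `k`-tensors with values in `V`. -/
abbrev CompField (M : Type*) (k : ℕ) (V : Type*) : Type _ := M → (Fin k → Fin 4) → V

/-- Complex valued covariant `k`-tensors at the point `p`. -/
abbrev CTensor (k : ℕ) (p : M) : Type _ :=
  MultilinearMap ℝ (fun _ : Fin k ↦ TangentSpace (𝓡 4) p) ℂ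

/-- The tensor `∑ c_{i₁ … i_k} dx^{i₁} ⊗ ⋯ ⊗ dx^{i_k}` at the point `p` whose components in the
chart `e` are `c`. -/
def toTensor (e : OpenPartialHomeomorph M E4) (p : M) {k : ℕ} (c : (Fin k → Fin 4) → ℂ) :
    CTensor k p :=
  ∑ I : Fin k → Fin 4, c I • (MultilinearMap.mkPiAlgebra ℝ (Fin k) ℂ).compLinearMap
    (fun j ↦ Complex.ofRealCLM.toLinearMap ∘ₗ coframe e p (I j))

theorem toTensor_apply (e : OpenPartialHomeomorph M E4) (p : M) {k : ℕ}
    (c : (Fin k → Fin 4) → ℂ) (v : Fin k → TangentSpace (𝓡 4) p) :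
    toTensor e p c v = ∑ I : Fin k → Fin 4, c I * ∏ j, (coframe e p (I j) (v j) : ℂ) := by
  simp [toTensor]

/-- `Φ` is a smooth field, over `U`, of complex linear maps from covariant `k`-tensors to covariant
`l`-tensors: its matrix coefficients in every chart of the smooth atlas are smooth. -/
def IsSmoothTensorMap [IsManifold (𝓡 4) ∞ M] (U : Set M) {k l : ℕ}
    (Φ : ∀ p : M, CTensor k p →ₗ[ℂ] CTensor l p) : Prop :=
  ∀ e ∈ IsManifold.maximalAtlas (𝓡 4) ∞ M, ∀ (I : Fin l → Fin 4) (J : Fin k → Fin 4),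
    ContMDiffOn (𝓡 4) 𝓘(ℝ, ℂ) ∞
      (fun p ↦ Φ p (toTensor e p (Pi.single J 1)) (fun a ↦ frame e p (I a))) (e.source ∩ U)

end Coordinates

end

end Spacetime

open Spacetime

/-- A smooth Lorentzian metric, of signature `(-,+,+,+)`, on a smooth `4`-manifold. -/
structure LorentzMetric (M : Type*) [TopologicalSpace M] [ChartedSpace E4 M]
    [IsManifold (𝓡 4) ∞ M] where
  /-- The scalar product on each tangent space. -/
  inner (p : M) : TangentSpace (𝓡 4) p →L[ℝ] TangentSpace (𝓡 4) p →L[ℝ] ℝ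
  symm (p : M) (v w : TangentSpace (𝓡 4) p) : inner p v w = inner p w v
  /-- Every tangent space has an orthonormal basis whose first vector is timelike. -/
  lorentzian (p : M) : ∃ b : Module.Basis (Fin 4) ℝ (TangentSpace (𝓡 4) p),
    ∀ i j, inner p (b i) (b j) = if i = j then (if i = 0 then -1 else 1) else 0
  /-- The components of the metric in every chart of the smooth atlas are smooth. -/
  contMDiffOn : ∀ e ∈ IsManifold.maximalAtlas (𝓡 4) ∞ M, ∀ i j,
    ContMDiffOn (𝓡 4) 𝓘(ℝ, ℝ) ∞ (fun p ↦ inner p (frame e p i) (frame e p j)) e.source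

namespace LorentzMetric

noncomputable section

variable {M : Type*} [TopologicalSpace M] [ChartedSpace E4 M] [IsManifold (𝓡 4) ∞ M]
  (g : LorentzMetric M)

/-- The components `g_{ij}` of the metric in the chart `e`. -/
def lo (e : OpenPartialHomeomorph M E4) (p : M) (i j : Fin 4) : ℝ :=
  g.inner p (frame e p i) (frame e p j)

/-- The components `g^{ij}` of the inverse metric in the chart `e`. -/
def up (e : OpenPartialHomeomorph M E4) (p : M) (i j : Fin 4) : ℝ :=
  (Matrix.of (g.lo e p))⁻¹ i j

/-- The Christoffel symbols
`Γ^k_{ij} = ½ g^{kl} (∂_i g_{jl} + ∂_j g_{il} - ∂_l g_{ij})`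
of the Levi-Civita connection in the chart `e`. -/
def christoffel (e : OpenPartialHomeomorph M E4) (p : M) (k i j : Fin 4) : ℝ :=
  (1 / 2) * ∑ l, g.up e p k l *
    (pd e i (fun q ↦ g.lo e q j l) p + pd e j (fun q ↦ g.lo e q i l) p
      - pd e l (fun q ↦ g.lo e q i j) p)

/-- The covariant derivative, with the derivative index first:
`(DX)_{m i₁ … i_k} = ∂_m X_{i₁ … i_k} - ∑_a Γ^n_{m i_a} X_{i₁ … n … i_k}`. -/
def covD {V : Type*} [NormedAddCommGroup V] [NormedSpace ℝ V]
    (e : OpenPartialHomeomorph M E4) {k : ℕ} (X : CompField M k V) : CompField M (k + 1) V :=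
  fun p I ↦ pd e (I 0) (fun q ↦ X q (Fin.tail I)) p
    - ∑ a : Fin k, ∑ n : Fin 4,
        g.christoffel e p n (I 0) (Fin.tail I a) • X p (Function.update (Fin.tail I) a n)

/-- The covariant wave operator `□X = g^{mn} D_m D_n X`. -/
def box {V : Type*} [NormedAddCommGroup V] [NormedSpace ℝ V]
    (e : OpenPartialHomeomorph M E4) {k : ℕ} (X : CompField M k V) : CompField M k V :=
  fun p I ↦ ∑ m, ∑ n, g.up e p m n • g.covD e (g.covD e X) p (Fin.cons m (Fin.cons n I))

/-- The components `R^a_{bcd} = ∂_c Γ^a_{db} - ∂_d Γ^a_{cb} + Γ^a_{cn} Γ^n_{db} - Γ^a_{dn} Γ^n_{cb}`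
of the Riemann tensor. -/
def riemannUp (e : OpenPartialHomeomorph M E4) (p : M) (a b c d : Fin 4) : ℝ :=
  pd e c (fun q ↦ g.christoffel e q a d b) p - pd e d (fun q ↦ g.christoffel e q a c b) p
    + ∑ n, (g.christoffel e p a c n * g.christoffel e p n d b
      - g.christoffel e p a d n * g.christoffel e p n c b)

/-- The components `R_{abcd}` of the Riemann tensor. -/
def riemann (e : OpenPartialHomeomorph M E4) (p : M) (a b c d : Fin 4) : ℝ :=
  ∑ n, g.lo e p a n * g.riemannUp e p n b c d

/-- The components `Ric_{bd} = R^a_{bad}` of the Ricci tensor. -/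
def ricci (e : OpenPartialHomeomorph M E4) (p : M) (b d : Fin 4) : ℝ :=
  ∑ a, g.riemannUp e p a b a d

/-- The Einstein vacuum equations `Ric(g) = 0`. -/
def IsVacuum : Prop :=
  ∀ e ∈ IsManifold.maximalAtlas (𝓡 4) ∞ M, ∀ p ∈ e.source, ∀ i j, g.ricci e p i j = 0

/-- A volume form of the metric, that is, an orientation of the manifold: a smooth `4`-form which
takes the values `±1` on orthonormal bases. -/
structure VolumeForm where
  /-- The `4`-form. -/
  form (p : M) : AlternatingMap ℝ (TangentSpace (𝓡 4) p) ℝ (Fin 4)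
  normalized (p : M) (b : Module.Basis (Fin 4) ℝ (TangentSpace (𝓡 4) p)) :
    (∀ i j, g.inner p (b i) (b j) = if i = j then (if i = 0 then -1 else 1) else 0) →
      form p b = 1 ∨ form p b = -1
  contMDiffOn : ∀ e ∈ IsManifold.maximalAtlas (𝓡 4) ∞ M,
    ContMDiffOn (𝓡 4) 𝓘(ℝ, ℝ) ∞ (fun p ↦ form p (frame e p)) e.source

variable {g} in
/-- The components `∈_{abcd}` of the volume form in the chart `e`. -/
def VolumeForm.comp (ε : g.VolumeForm) (e : OpenPartialHomeomorph M E4) (p : M)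
    (a b c d : Fin 4) : ℝ :=
  ε.form p ![frame e p a, frame e p b, frame e p c, frame e p d]

variable (T : ∀ p : M, TangentSpace (𝓡 4) p)

/-- The components `T_i = g_{ij} T^j` of the one-form dual to the vector field `T`. -/
def flat (e : OpenPartialHomeomorph M E4) : CompField M 1 ℝ :=
  fun p I ↦ g.inner p (frame e p (I 0)) (T p)

/-- The components `F_{ab} = D_a T_b`. -/
def F (e : OpenPartialHomeomorph M E4) (p : M) (a b : Fin 4) : ℝ :=
  g.covD e (g.flat T e) p ![a, b]

/-- `T` is a smooth Killing vector field: `D_a T_b + D_b T_a = 0`. -/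
def IsKilling : Prop :=
  ContMDiff (𝓡 4) (𝓡 4).tangent ∞ (fun p ↦ (⟨p, T p⟩ : TangentBundle (𝓡 4) M)) ∧
  ∀ e ∈ IsManifold.maximalAtlas (𝓡 4) ∞ M, ∀ p ∈ e.source, ∀ a b,
    g.F T e p a b + g.F T e p b a = 0

variable (ε : g.VolumeForm)

/-- The mixed components `∈_{ab}^{mn}` of the volume form. -/
def epsMixed (e : OpenPartialHomeomorph M E4) (p : M) (a b m n : Fin 4) : ℝ :=
  ∑ r, ∑ s, ε.comp e p a b r s * g.up e p r m * g.up e p s n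

/-- The self-dual form `𝓕_{ab} = F_{ab} + i ⋆F_{ab}`, where `⋆F_{ab} = ½ ∈_{ab}^{mn} F_{mn}`. -/
def FF (e : OpenPartialHomeomorph M E4) (p : M) (a b : Fin 4) : ℂ :=
  (g.F T e p a b : ℂ) +
    Complex.I * ((1 / 2 * ∑ m, ∑ n, g.epsMixed ε e p a b m n * g.F T e p m n : ℝ) : ℂ)

/-- The self-dual curvature `𝓡_{abcd} = R_{abcd} + i ⋆R_{abcd}`, where
`⋆R_{abcd} = ½ ∈_{ab}^{mn} R_{mncd}`. -/
def RR (e : OpenPartialHomeomorph M E4) (p : M) (a b c d : Fin 4) : ℂ :=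
  (g.riemann e p a b c d : ℂ) +
    Complex.I * ((1 / 2 * ∑ m, ∑ n, g.epsMixed ε e p a b m n * g.riemann e p m n c d : ℝ) : ℂ)

/-- The scalar `𝓕² = 𝓕_{ab} 𝓕^{ab}`. -/
def FFsq (e : OpenPartialHomeomorph M E4) (p : M) : ℂ :=
  ∑ a, ∑ b, ∑ m, ∑ n, (g.up e p a m * g.up e p b n : ℝ) * (g.FF T ε e p a b * g.FF T ε e p m n)

/-- `𝓘_{abmn} = (g_{am} g_{bn} - g_{an} g_{bm} + i ∈_{abmn}) / 4`. -/
def II (e : OpenPartialHomeomorph M E4) (p : M) (a b m n : Fin 4) : ℂ :=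
  ((g.lo e p a m * g.lo e p b n - g.lo e p a n * g.lo e p b m : ℝ)
    + Complex.I * (ε.comp e p a b m n : ℂ)) / 4

/-- `𝓠_{abmn} = 𝓕_{ab} 𝓕_{mn} - ⅓ 𝓕² 𝓘_{abmn}`. -/
def QQ (e : OpenPartialHomeomorph M E4) (p : M) (a b m n : Fin 4) : ℂ :=
  g.FF T ε e p a b * g.FF T ε e p m n - 1 / 3 * g.FFsq T ε e p * g.II ε e p a b m n

/-- The Ernst one-form `σ_m = 2 T^a 𝓕_{am}`. -/
def ernst (e : OpenPartialHomeomorph M E4) (p : M) (m : Fin 4) : ℂ :=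
  2 * ∑ a, (coframe e p a (T p) : ℂ) * g.FF T ε e p a m

/-- `σ` is an Ernst potential of `T`: a smooth complex function with `D_m σ = σ_m`. -/
def IsErnstPotential (σ : M → ℂ) : Prop :=
  ContMDiff (𝓡 4) 𝓘(ℝ, ℂ) ∞ σ ∧
  ∀ e ∈ IsManifold.maximalAtlas (𝓡 4) ∞ M, ∀ p ∈ e.source, ∀ m,
    pd e m σ p = g.ernst T ε e p m

/-- The components `𝓢_{abmn} = 𝓡_{abmn} + 6 (1 - σ)⁻¹ 𝓠_{abmn}` of the Mars–Simon tensor in the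
chart `e`; they are meaningful where `σ ≠ 1`. -/
def marsSimon (σ : M → ℂ) (e : OpenPartialHomeomorph M E4) : CompField M 4 ℂ :=
  fun p I ↦ g.RR ε e p (I 0) (I 1) (I 2) (I 3)
    + 6 * (1 - σ p)⁻¹ * g.QQ T ε e p (I 0) (I 1) (I 2) (I 3)

end

end LorentzMetric

set_option linter.unusedSectionVars false

namespace Spacetime

/-! Fix a chart and freeze the first index pair of `𝓢`. What remains is a self-dual two-form, and
for such a form the divergence and the exterior derivative carry the same information. If the
divergence is a linear expression in `𝓢` without derivatives, so is the exterior derivative, up to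
such terms. Comparing the divergence of the exterior derivative with the derivative of the
divergence, as in `□ ~ dδ + δd`, then expresses `□𝓢` through `D𝓢` and `𝓢`.

The heart is therefore the divergence (`sum_up_nab4_sMat`). The contracted Bianchi identity and `Ric
= 0` give `div 𝓡 = 0`; the tensor `𝓘` is parallel; the Killing equation gives `D_m 𝓕 = T^l 𝓡_{lm}`;
and `D_m σ = 2 T^a 𝓕_{am}`. Hence `div 𝓢` is algebraic in `T`, `𝓡`, `𝓕`, `𝓘`. Everything in it that
is not linear in `𝓢` cancels (`marsSimon_algebra`), because `𝓡` is trace-free and because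
self-duality yields `𝓕·𝓕 = -¼ 𝓕² g` and `𝓕·𝓘 + 𝓘·𝓕 = -½ 𝓕 g`. Self-duality of `𝓡` in its last pair,
and its pair symmetry, rest on the equality of left and right duals in vacuum
(`left_dual_eq_right_dual`).

Lower order terms are never computed: `InSpan` records that a function is a combination of given
generators with smooth coefficients. Modulo such terms covariant derivatives may be replaced by
partial ones, which commute, so no curvature commutator appears (`inSpan_cyclic`, `inSpan_wave`,
`inSpan_box_marsSimon`).

The coefficients found in a chart are not canonical, so they are patched by a partition of unity.
The equation is affine in its coefficients, hence stable under convex combinations, once it is known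
to be the same equation in every chart. Since all tensors are given by components, this requires the
transformation laws of the connection, the curvature, `D`, `□` and `𝓢` (`jacMat_mul_conn`,
`jacMat_mul_curv`, `transforms_covD`, `transforms_box`, `transforms_marsSimon`). -/

theorem two_le_infty : (2 : WithTop ℕ∞) ≤ ∞ :=
  WithTop.coe_le_coe.2 (le_top : (2 : ℕ∞) ≤ ⊤)

/-! ### Partial derivatives and smoothness in a chart. -/

section ChartCalculus

variable {M : Type*} [TopologicalSpace M] [ChartedSpace E4 M]
  {V : Type*} [NormedAddCommGroup V] [NormedSpace ℝ V]

/-- Smoothness of a function on a subset of the manifold. -/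
abbrev SmoothOn (W : Set M) (f : M → V) : Prop := ContMDiffOn (𝓡 4) 𝓘(ℝ, V) ∞ f W

/-- Differentiability, in a chart, of a function on the manifold. -/
def DiffAt (e : OpenPartialHomeomorph M E4) (p : M) (f : M → V) : Prop :=
  DifferentiableAt ℝ (f ∘ e.symm) (e p)

variable {e : OpenPartialHomeomorph M E4} {p : M} {W : Set M}

theorem pd_congr {f g : M → V} (hp : p ∈ e.source) (h : f =ᶠ[nhds p] g) (i : Fin 4) :
    pd e i f p = pd e i g p := by
  unfold pd
  congr 1
  apply Filter.EventuallyEq.fderiv_eq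
  have := (e.continuousAt_symm (e.map_source hp)).tendsto
  rw [e.left_inv hp] at this
  exact this.eventually h

theorem pd_congr_of_eqOn {f g : M → V} (hW : IsOpen W) (hp : p ∈ W) (hpe : p ∈ e.source)
    (h : ∀ q ∈ W, f q = g q) (i : Fin 4) : pd e i f p = pd e i g p :=
  pd_congr hpe (Filter.eventually_of_mem (hW.mem_nhds hp) h) i

@[simp] theorem pd_const (c : V) (i : Fin 4) : pd e i (fun _ : M ↦ c) p = 0 := by
  simp [pd, Function.comp_def]

theorem DiffAt.const (c : V) : DiffAt e p (fun _ : M ↦ c) := by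
  simp [DiffAt, Function.comp_def]

theorem DiffAt.add {f g : M → V} (hf : DiffAt e p f) (hg : DiffAt e p g) :
    DiffAt e p (fun q ↦ f q + g q) := DifferentiableAt.add hf hg

theorem DiffAt.sub {f g : M → V} (hf : DiffAt e p f) (hg : DiffAt e p g) :
    DiffAt e p (fun q ↦ f q - g q) := DifferentiableAt.sub hf hg

theorem DiffAt.neg {f : M → V} (hf : DiffAt e p f) :
    DiffAt e p (fun q ↦ - f q) := DifferentiableAt.neg hf

theorem DiffAt.smul {f : M → ℝ} {g : M → V} (hf : DiffAt e p f) (hg : DiffAt e p g) :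
    DiffAt e p (fun q ↦ f q • g q) := DifferentiableAt.smul hf hg

theorem DiffAt.mul {A : Type*} [NormedRing A] [NormedAlgebra ℝ A] {f g : M → A}
    (hf : DiffAt e p f) (hg : DiffAt e p g) :
    DiffAt e p (fun q ↦ f q * g q) := DifferentiableAt.mul hf hg

theorem DiffAt.sum {ι : Type*} {s : Finset ι} {f : ι → M → V} (hf : ∀ i ∈ s, DiffAt e p (f i)) :
    DiffAt e p (fun q ↦ ∑ i ∈ s, f i q) := by
  have := DifferentiableAt.fun_sum (𝕜 := ℝ) (u := s) (A := fun i ↦ f i ∘ e.symm) (x := e p) hf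
  simpa [DiffAt, Function.comp_def] using this

theorem DiffAt.ofReal {f : M → ℝ} (hf : DiffAt e p f) : DiffAt e p (fun q ↦ (f q : ℂ)) :=
  Complex.ofRealCLM.differentiableAt.comp _ hf

theorem pd_add {f g : M → V} (hf : DiffAt e p f) (hg : DiffAt e p g) (i : Fin 4) :
    pd e i (fun q ↦ f q + g q) p = pd e i f p + pd e i g p := by
  have := fderiv_add hf hg
  unfold pd
  rw [show (fun q ↦ f q + g q) ∘ e.symm = f ∘ e.symm + g ∘ e.symm from rfl, this]
  rfl

theorem pd_sub {f g : M → V} (hf : DiffAt e p f) (hg : DiffAt e p g) (i : Fin 4) :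
    pd e i (fun q ↦ f q - g q) p = pd e i f p - pd e i g p := by
  have := fderiv_sub hf hg
  unfold pd
  rw [show (fun q ↦ f q - g q) ∘ e.symm = f ∘ e.symm - g ∘ e.symm from rfl, this]
  rfl

theorem pd_neg (f : M → V) (i : Fin 4) :
    pd e i (fun q ↦ - f q) p = - pd e i f p := by
  unfold pd
  rw [show (fun q ↦ - f q) ∘ e.symm = -(f ∘ e.symm) from rfl, fderiv_neg]
  rfl

theorem pd_smul (hp : p ∈ e.source) {f : M → ℝ} {g : M → V} (hf : DiffAt e p f)
    (hg : DiffAt e p g) (i : Fin 4) :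
    pd e i (fun q ↦ f q • g q) p = f p • pd e i g p + pd e i f p • g p := by
  have := fderiv_smul hf hg
  unfold pd
  rw [show (fun q ↦ f q • g q) ∘ e.symm = (f ∘ e.symm) • (g ∘ e.symm) from rfl, this]
  simp [e.left_inv hp]

theorem pd_mul {A : Type*} [NormedCommRing A] [NormedAlgebra ℝ A] (hp : p ∈ e.source)
    {f g : M → A} (hf : DiffAt e p f) (hg : DiffAt e p g) (i : Fin 4) :
    pd e i (fun q ↦ f q * g q) p = f p * pd e i g p + pd e i f p * g p := by
  have := fderiv_mul hf hg
  unfold pd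
  rw [show (fun q ↦ f q * g q) ∘ e.symm = (f ∘ e.symm) * (g ∘ e.symm) from rfl, this]
  simp [e.left_inv hp, mul_comm]

theorem pd_sum {ι : Type*} {s : Finset ι} {f : ι → M → V} (hf : ∀ i ∈ s, DiffAt e p (f i))
    (j : Fin 4) : pd e j (fun q ↦ ∑ i ∈ s, f i q) p = ∑ i ∈ s, pd e j (f i) p := by
  have := fderiv_fun_sum (𝕜 := ℝ) (u := s) (A := fun i ↦ f i ∘ e.symm) (x := e p) hf
  unfold pd
  rw [show (fun q ↦ ∑ i ∈ s, f i q) ∘ e.symm = fun x ↦ ∑ i ∈ s, (f i ∘ e.symm) x from rfl, this]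
  simp

theorem pd_const_mul {f : M → ℂ} (c : ℂ) (hf : DiffAt e p f) (i : Fin 4) :
    pd e i (fun q ↦ c * f q) p = c * pd e i f p := by
  unfold pd
  rw [show (fun q ↦ c * f q) ∘ e.symm = fun x ↦ c * (f ∘ e.symm) x from rfl,
    fderiv_const_mul hf]
  rfl

theorem pd_ofReal {f : M → ℝ} (hf : DiffAt e p f) (i : Fin 4) :
    pd e i (fun q ↦ (f q : ℂ)) p = ((pd e i f p : ℝ) : ℂ) := by
  unfold pd
  have := (Complex.ofRealCLM.hasFDerivAt.comp _ hf.hasFDerivAt).fderiv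
  rw [show (fun q ↦ (f q : ℂ)) ∘ e.symm = Complex.ofRealCLM ∘ (f ∘ e.symm) from rfl, this]
  rfl

variable [IsManifold (𝓡 4) ∞ M]

theorem SmoothOn.contDiffAt (he : e ∈ IsManifold.maximalAtlas (𝓡 4) ∞ M) {f : M → V}
    (hf : SmoothOn W f) (hW : IsOpen W) (hp : p ∈ W) (hpe : p ∈ e.source) :
    ContDiffAt ℝ ∞ (f ∘ e.symm) (e p) := by
  have h1 := (contMDiffOn_symm_of_mem_maximalAtlas he).contMDiffAt
    (e.open_target.mem_nhds (e.map_source hpe))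
  have h2 : ContMDiffAt (𝓡 4) 𝓘(ℝ, V) ∞ f (e.symm (e p)) := by
    rw [e.left_inv hpe]; exact hf.contMDiffAt (hW.mem_nhds hp)
  exact (h2.comp _ h1).contDiffAt

theorem SmoothOn.diffAt (he : e ∈ IsManifold.maximalAtlas (𝓡 4) ∞ M) {f : M → V}
    (hf : SmoothOn W f) (hW : IsOpen W) (hp : p ∈ W) (hpe : p ∈ e.source) : DiffAt e p f :=
  (hf.contDiffAt he hW hp hpe).differentiableAt (by simp)

theorem contMDiffAt_iff_contDiffAt (he : e ∈ IsManifold.maximalAtlas (𝓡 4) ∞ M) {f : M → V}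
    (hpe : p ∈ e.source) :
    ContMDiffAt (𝓡 4) 𝓘(ℝ, V) ∞ f p ↔ ContDiffAt ℝ ∞ (f ∘ e.symm) (e p) := by
  constructor
  · intro h
    have h1 := (contMDiffOn_symm_of_mem_maximalAtlas he).contMDiffAt
      (e.open_target.mem_nhds (e.map_source hpe))
    have h2 : ContMDiffAt (𝓡 4) 𝓘(ℝ, V) ∞ f (e.symm (e p)) := by
      rw [e.left_inv hpe]; exact h
    exact (h2.comp _ h1).contDiffAt
  · intro h
    have h1 := (contMDiffOn_of_mem_maximalAtlas he).contMDiffAt (e.open_source.mem_nhds hpe)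
    refine (h.contMDiffAt.comp p h1).congr_of_eventuallyEq ?_
    filter_upwards [e.open_source.mem_nhds hpe] with q hq
    simp [e.left_inv hq]

theorem SmoothOn.pd (he : e ∈ IsManifold.maximalAtlas (𝓡 4) ∞ M) {f : M → V}
    (hf : SmoothOn W f) (hW : IsOpen W) (hWe : W ⊆ e.source) (i : Fin 4) :
    SmoothOn W (Spacetime.pd e i f) := by
  intro p hp
  apply ContMDiffAt.contMDiffWithinAt
  rw [contMDiffAt_iff_contDiffAt he (hWe hp)]
  have h := hf.contDiffAt he hW hp (hWe hp)
  have h2 := (h.fderiv_right (m := ∞) (by simp)).clm_apply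
    (contDiffAt_const (c := EuclideanSpace.single i (1 : ℝ)))
  refine h2.congr_of_eventuallyEq ?_
  filter_upwards [e.open_target.mem_nhds (e.map_source (hWe hp))] with x hx
  simp [Spacetime.pd, e.right_inv hx]

theorem pd_comm (he : e ∈ IsManifold.maximalAtlas (𝓡 4) ∞ M) {f : M → V}
    (hf : SmoothOn W f) (hW : IsOpen W) (hp : p ∈ W) (hpe : p ∈ e.source) (i j : Fin 4) :
    pd e i (pd e j f) p = pd e j (pd e i f) p := by
  have h := hf.contDiffAt he hW hp hpe
  have key : ∀ a b : Fin 4, pd e a (pd e b f) p =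
      fderiv ℝ (fderiv ℝ (f ∘ e.symm)) (e p) (EuclideanSpace.single a 1)
        (EuclideanSpace.single b 1) := by
    intro a b
    have h2 : DifferentiableAt ℝ (fderiv ℝ (f ∘ e.symm)) (e p) :=
      (h.fderiv_right (m := 1) (by rw [one_add_one_eq_two]; exact two_le_infty)).differentiableAt (by simp)
    have : pd e b f ∘ e.symm =ᶠ[nhds (e p)] fun x ↦
        fderiv ℝ (f ∘ e.symm) x (EuclideanSpace.single b 1) := by
      filter_upwards [e.open_target.mem_nhds (e.map_source hpe)] with x hx
      simp [Spacetime.pd, e.right_inv hx]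
    rw [pd, this.fderiv_eq, fderiv_clm_apply h2 (by fun_prop)]
    simp
  rw [key, key]
  exact (h.isSymmSndFDerivAt (by simpa using two_le_infty)).eq _ _

end ChartCalculus

/-! ### Coordinate frames and Jacobians. -/

section Frames

variable {M : Type*} [TopologicalSpace M] [ChartedSpace E4 M] [IsManifold (𝓡 4) ∞ M]
  {e e' : OpenPartialHomeomorph M E4} {p : M}

theorem mdifferentiable_of_mem_maximalAtlas (he : e ∈ IsManifold.maximalAtlas (𝓡 4) ∞ M) :
    e.MDifferentiable (𝓡 4) (𝓡 4) :=
  ⟨(contMDiffOn_of_mem_maximalAtlas he).mdifferentiableOn (by simp),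
    (contMDiffOn_symm_of_mem_maximalAtlas he).mdifferentiableOn (by simp)⟩

theorem mfderiv_frame (he : e ∈ IsManifold.maximalAtlas (𝓡 4) ∞ M) (hp : p ∈ e.source)
    (i : Fin 4) :
    mfderiv (𝓡 4) (𝓡 4) e p (frame e p i) = EuclideanSpace.single i (1 : ℝ) := by
  have h : mfderiv (𝓡 4) (𝓡 4) e p =
      ((mdifferentiable_of_mem_maximalAtlas he).mfderiv hp : _ →L[ℝ] _) := rfl
  unfold frame
  rw [h, ContinuousLinearMap.inverse_equiv]
  exact ContinuousLinearEquiv.apply_symm_apply _ _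

theorem coframe_frame (he : e ∈ IsManifold.maximalAtlas (𝓡 4) ∞ M) (hp : p ∈ e.source)
    (i j : Fin 4) : coframe e p i (frame e p j) = if i = j then 1 else 0 := by
  have : coframe e p i (frame e p j) =
      EuclideanSpace.proj (𝕜 := ℝ) i (mfderiv (𝓡 4) (𝓡 4) e p (frame e p j)) := rfl
  rw [this, mfderiv_frame he hp]
  simp

theorem sum_coframe_smul_frame (he : e ∈ IsManifold.maximalAtlas (𝓡 4) ∞ M) (hp : p ∈ e.source)
    (v : TangentSpace (𝓡 4) p) : ∑ i, coframe e p i v • frame e p i = v := by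
  apply ((mdifferentiable_of_mem_maximalAtlas he).mfderiv_injective hp)
  rw [map_sum]
  simp only [map_smul, mfderiv_frame he hp]
  have key : ∀ w : E4, ∑ i, w i • EuclideanSpace.single i (1 : ℝ) = w := by
    intro w
    ext j
    simp [Finset.sum_apply, Pi.single_apply]
  exact key (mfderiv (𝓡 4) (𝓡 4) e p v)

/-- The frame of a chart, as a basis of the tangent space. -/
noncomputable def frameBasis (he : e ∈ IsManifold.maximalAtlas (𝓡 4) ∞ M) (hp : p ∈ e.source) :
    Module.Basis (Fin 4) ℝ (TangentSpace (𝓡 4) p) :=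
  Module.Basis.ofEquivFun
    { toFun := fun v i ↦ coframe e p i v
      map_add' := fun v w ↦ by ext; simp
      map_smul' := fun c v ↦ by ext; simp
      invFun := fun c ↦ ∑ i, c i • frame e p i
      left_inv := fun v ↦ sum_coframe_smul_frame he hp v
      right_inv := fun c ↦ by ext i; simp [coframe_frame he hp] }

theorem frameBasis_apply (he : e ∈ IsManifold.maximalAtlas (𝓡 4) ∞ M) (hp : p ∈ e.source)
    (i : Fin 4) : frameBasis he hp i = frame e p i := by
  simp [frameBasis, Module.Basis.ofEquivFun, Pi.single_apply]

/-- The Jacobian `∂xⁱ/∂x'ʲ` of the change of charts from `e'` to `e`. -/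
noncomputable def jac (e e' : OpenPartialHomeomorph M E4) (p : M) (i j : Fin 4) : ℝ :=
  coframe e p i (frame e' p j)

theorem frame_eq_sum_jac (he : e ∈ IsManifold.maximalAtlas (𝓡 4) ∞ M) (hp : p ∈ e.source)
    (j : Fin 4) : frame e' p j = ∑ i, jac e e' p i j • frame e p i :=
  (sum_coframe_smul_frame he hp _).symm

theorem coframe_eq_sum_jac (he' : e' ∈ IsManifold.maximalAtlas (𝓡 4) ∞ M) (hp' : p ∈ e'.source)
    (i : Fin 4) (v : TangentSpace (𝓡 4) p) :
    coframe e p i v = ∑ j, jac e e' p i j * coframe e' p j v := by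
  conv_lhs => rw [← sum_coframe_smul_frame he' hp' v]
  simp [jac, mul_comm]

theorem sum_jac_mul_jac (he : e ∈ IsManifold.maximalAtlas (𝓡 4) ∞ M)
    (he' : e' ∈ IsManifold.maximalAtlas (𝓡 4) ∞ M) (hp : p ∈ e.source) (hp' : p ∈ e'.source)
    (i k : Fin 4) : ∑ j, jac e e' p i j * jac e' e p j k = if i = k then 1 else 0 := by
  rw [← coframe_frame he hp i k, coframe_eq_sum_jac he' hp']
  rfl

/-- In every chart the partial derivative is the intrinsic differential of `f` applied to the
coordinate frame, and two frames differ by the Jacobian. -/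
theorem pd_chain {V : Type*} [NormedAddCommGroup V] [NormedSpace ℝ V]
    (he : e ∈ IsManifold.maximalAtlas (𝓡 4) ∞ M)
    (he' : e' ∈ IsManifold.maximalAtlas (𝓡 4) ∞ M) (hp : p ∈ e.source) (hp' : p ∈ e'.source)
    {f : M → V} (hf : DiffAt e p f) (j : Fin 4) :
    pd e' j f p = ∑ i, jac e e' p i j • pd e i f p := by
  have hF : ∀ {c : OpenPartialHomeomorph M E4} (_ : c ∈ IsManifold.maximalAtlas (𝓡 4) ∞ M)
      (_ : p ∈ c.source) (v : TangentSpace (𝓡 4) p), MDifferentiableAt (𝓡 4) 𝓘(ℝ, V) f p →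
      mfderiv (𝓡 4) 𝓘(ℝ, V) f p v =
        fderiv ℝ (f ∘ c.symm) (c p) (mfderiv (𝓡 4) (𝓡 4) c p v) := by
    intro c hc hpc v hfd
    have h1 := (mdifferentiable_of_mem_maximalAtlas hc).mdifferentiableAt hpc
    have h2 := (mdifferentiable_of_mem_maximalAtlas hc).mdifferentiableAt_symm (c.map_source hpc)
    have hg : MDifferentiableAt (𝓡 4) 𝓘(ℝ, V) (f ∘ c.symm) (c p) := by
      refine MDifferentiableAt.comp (c p) (I' := 𝓡 4) ?_ h2
      rw [c.left_inv hpc]; exact hfd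
    have h3 : f =ᶠ[nhds p] (f ∘ c.symm) ∘ c := by
      filter_upwards [c.open_source.mem_nhds hpc] with q hq
      simp [c.left_inv hq]
    rw [h3.mfderiv_eq, mfderiv_comp p hg h1, ← mfderiv_eq_fderiv]
    rfl
  have hfd : MDifferentiableAt (𝓡 4) 𝓘(ℝ, V) f p := by
    have h1 := (mdifferentiable_of_mem_maximalAtlas he).mdifferentiableAt hp
    have hg : MDifferentiableAt (𝓡 4) 𝓘(ℝ, V) (f ∘ e.symm) (e p) :=
      DifferentiableAt.mdifferentiableAt hf
    refine (hg.comp p h1).congr_of_eventuallyEq ?_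
    filter_upwards [e.open_source.mem_nhds hp] with q hq
    simp [e.left_inv hq]
  have hpd : ∀ {c : OpenPartialHomeomorph M E4} (_ : c ∈ IsManifold.maximalAtlas (𝓡 4) ∞ M)
      (_ : p ∈ c.source) (k : Fin 4), pd c k f p = mfderiv (𝓡 4) 𝓘(ℝ, V) f p (frame c p k) := by
    intro c hc hpc k
    rw [hF hc hpc _ hfd, mfderiv_frame hc hpc]
    rfl
  rw [hpd he' hp', frame_eq_sum_jac he hp, map_sum]
  refine Finset.sum_congr rfl fun i _ ↦ ?_
  rw [hpd he hp, map_smul]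
  rfl

theorem smoothOn_coord (he : e ∈ IsManifold.maximalAtlas (𝓡 4) ∞ M) (i : Fin 4) :
    SmoothOn e.source (fun q ↦ (e q) i) :=
  (EuclideanSpace.proj (𝕜 := ℝ) i).contMDiff.comp_contMDiffOn
    (contMDiffOn_of_mem_maximalAtlas he)

/-- Recognising the Jacobian, defined through frames, as a derivative of a coordinate function gives
its smoothness and the symmetry `pd_jac_symm`. -/
theorem jac_eq_pd (he : e ∈ IsManifold.maximalAtlas (𝓡 4) ∞ M)
    (he' : e' ∈ IsManifold.maximalAtlas (𝓡 4) ∞ M) (hp : p ∈ e.source) (hp' : p ∈ e'.source)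
    (i j : Fin 4) : jac e e' p i j = pd e' j (fun q ↦ (e q) i) p := by
  have h := smoothOn_coord he i
  have h2 : ∀ k, pd e k (fun q ↦ (e q) i) p = if i = k then 1 else 0 := by
    intro k
    have : (fun q ↦ (e q) i) ∘ e.symm =ᶠ[nhds (e p)]
        (EuclideanSpace.proj (𝕜 := ℝ) i : E4 →L[ℝ] ℝ) := by
      filter_upwards [e.open_target.mem_nhds (e.map_source hp)] with x hx
      simp [e.right_inv hx]
    rw [pd, this.fderiv_eq, ContinuousLinearMap.fderiv]
    simp
  rw [pd_chain he he' hp hp' (SmoothOn.diffAt he h e.open_source hp hp)]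
  simp [h2]

theorem smoothOn_jac (he : e ∈ IsManifold.maximalAtlas (𝓡 4) ∞ M)
    (he' : e' ∈ IsManifold.maximalAtlas (𝓡 4) ∞ M) (i j : Fin 4) :
    SmoothOn (e.source ∩ e'.source) (fun p ↦ jac e e' p i j) := by
  have h := smoothOn_coord he i
  have := SmoothOn.pd he' (h.mono Set.inter_subset_left) (e.open_source.inter e'.open_source)
    Set.inter_subset_right j
  exact this.congr fun q hq ↦ jac_eq_pd he he' hq.1 hq.2 i j

/-- Second derivatives of a coordinate function commute. This makes the inhomogeneous term in the
law of the Christoffel symbols symmetric. -/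
theorem pd_jac_symm (he : e ∈ IsManifold.maximalAtlas (𝓡 4) ∞ M)
    (he' : e' ∈ IsManifold.maximalAtlas (𝓡 4) ∞ M) (hp : p ∈ e.source) (hp' : p ∈ e'.source)
    (i j k : Fin 4) :
    pd e' k (fun q ↦ jac e e' q i j) p = pd e' j (fun q ↦ jac e e' q i k) p := by
  have h := smoothOn_coord he i
  have hW := e.open_source.inter e'.open_source
  rw [pd_congr_of_eqOn hW ⟨hp, hp'⟩ hp' (fun q hq ↦ jac_eq_pd he he' hq.1 hq.2 i j),
    pd_congr_of_eqOn hW ⟨hp, hp'⟩ hp' (fun q hq ↦ jac_eq_pd he he' hq.1 hq.2 i k)]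
  exact pd_comm he' (h.mono Set.inter_subset_left) hW ⟨hp, hp'⟩ hp' k j

end Frames

end Spacetime

namespace Spacetime

/-! ### Levi-Civita symbol and metric-free duality of antisymmetric matrices. -/

section HodgeAlgebra

variable {R : Type*} [CommRing R]

/-- The Levi-Civita symbol in dimension four. -/
def lc (a b c d : Fin 4) : ℤ :=
  Int.sign (((b : ℤ) - a) * ((c : ℤ) - a) * ((d : ℤ) - a) * ((c : ℤ) - b) * ((d : ℤ) - b) *
    ((d : ℤ) - c))

/-- The flat dual `½ ∑ lc_{abrs} A^{rs}` of an antisymmetric matrix `A`. -/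
def flatDual (A : Matrix (Fin 4) (Fin 4) R) : Matrix (Fin 4) (Fin 4) R :=
  !![0, A 2 3, -A 1 3, A 1 2;
    -A 2 3, 0, A 0 3, -A 0 2;
    A 1 3, -A 0 3, 0, A 0 1;
    -A 1 2, A 0 2, -A 0 1, 0]

theorem sum_sum_comm {ι κ V : Type*} [Fintype ι] [Fintype κ] [AddCommMonoid V]
    (f : ι → ι → κ → κ → V) : ∑ m, ∑ n, ∑ r, ∑ s, f m n r s = ∑ r, ∑ s, ∑ m, ∑ n, f m n r s := by
  have h := Finset.sum_comm (s := Finset.univ) (t := Finset.univ)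
    (f := fun (x : ι × ι) (y : κ × κ) ↦ f x.1 x.2 y.1 y.2)
  simpa only [Fintype.sum_prod_type] using h

theorem flatDual_add (A B : Matrix (Fin 4) (Fin 4) R) :
    flatDual (A + B) = flatDual A + flatDual B := by
  ext i j; fin_cases i <;> fin_cases j <;> simp [flatDual] <;> ring

theorem flatDual_smul (c : R) (A : Matrix (Fin 4) (Fin 4) R) :
    flatDual (c • A) = c • flatDual A := by
  ext i j; fin_cases i <;> fin_cases j <;> simp [flatDual]

/-- An antisymmetric matrix with coefficients in any commutative ring. -/
structure IsAlt (A : Matrix (Fin 4) (Fin 4) R) : Prop where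
  diag : ∀ i, A i i = 0
  anti : ∀ i j, A i j = - A j i

theorem IsAlt.transpose {A : Matrix (Fin 4) (Fin 4) R} (h : IsAlt A) : A.transpose = -A := by
  ext i j
  simpa using h.anti j i

theorem IsAlt.exists_eq {A : Matrix (Fin 4) (Fin 4) R} (h : IsAlt A) :
    ∃ a b c d e f : R, A = !![0, a, b, c; -a, 0, d, e; -b, -d, 0, f; -c, -e, -f, 0] := by
  refine ⟨A 0 1, A 0 2, A 0 3, A 1 2, A 1 3, A 2 3, ?_⟩
  ext i j
  fin_cases i <;> fin_cases j <;> simp [h.diag, h.anti 1 0, h.anti 2 0, h.anti 3 0, h.anti 2 1,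
    h.anti 3 1, h.anti 3 2]

/-- There is no sign here because no metric is involved; the Lorentzian sign enters `hodge_hodge`
through a determinant. -/
theorem flatDual_flatDual {A : Matrix (Fin 4) (Fin 4) R} (h : IsAlt A) :
    flatDual (flatDual A) = A := by
  obtain ⟨a, b, c, d, e, f, rfl⟩ := h.exists_eq
  ext i j
  fin_cases i <;> fin_cases j <;> simp [flatDual]

/-- The entries of an antisymmetric matrix below the diagonal. -/
theorem IsAlt.entries {A : Matrix (Fin 4) (Fin 4) R} (h : IsAlt A) :
    (∀ i, A i i = 0) ∧ A 1 0 = -A 0 1 ∧ A 2 0 = -A 0 2 ∧ A 3 0 = -A 0 3 ∧ A 2 1 = -A 1 2 ∧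
      A 3 1 = -A 1 3 ∧ A 3 2 = -A 2 3 :=
  ⟨h.diag, h.anti _ _, h.anti _ _, h.anti _ _, h.anti _ _, h.anti _ _, h.anti _ _⟩

/-- Polarisation of `A * flatDual A = -Pf(A) • 1`, with `Pf` the Pfaffian. -/
theorem mul_flatDual_add {A B : Matrix (Fin 4) (Fin 4) R} (hA : IsAlt A) (hB : IsAlt B) :
    ∃ c : R, A * flatDual B + B * flatDual A = c • 1 := by
  obtain ⟨h1, h2, h3, h4, h5, h6, h7⟩ := hA.entries
  obtain ⟨k1, k2, k3, k4, k5, k6, k7⟩ := hB.entries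
  -- Minus the polarised Pfaffian, normalised to equal `-2 Pf(A)` when `B = A`.
  refine ⟨-(A 0 1 * B 2 3 - A 0 2 * B 1 3 + A 0 3 * B 1 2
    + B 0 1 * A 2 3 - B 0 2 * A 1 3 + B 0 3 * A 1 2), ?_⟩
  ext i j
  fin_cases i <;> fin_cases j <;>
    simp [flatDual, Matrix.mul_apply, Fin.sum_univ_four, h1, h2, h3, h4, h5, h6, h7, k1, k2, k3,
      k4, k5, k6, k7] <;> ring

theorem det_fin_four (M : Matrix (Fin 4) (Fin 4) R) :
    M.det = M 0 0 * (M 1 1 * (M 2 2 * M 3 3 - M 2 3 * M 3 2)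
      - M 1 2 * (M 2 1 * M 3 3 - M 2 3 * M 3 1) + M 1 3 * (M 2 1 * M 3 2 - M 2 2 * M 3 1))
      - M 0 1 * (M 1 0 * (M 2 2 * M 3 3 - M 2 3 * M 3 2)
      - M 1 2 * (M 2 0 * M 3 3 - M 2 3 * M 3 0) + M 1 3 * (M 2 0 * M 3 2 - M 2 2 * M 3 0))
      + M 0 2 * (M 1 0 * (M 2 1 * M 3 3 - M 2 3 * M 3 1)
      - M 1 1 * (M 2 0 * M 3 3 - M 2 3 * M 3 0) + M 1 3 * (M 2 0 * M 3 1 - M 2 1 * M 3 0))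
      - M 0 3 * (M 1 0 * (M 2 1 * M 3 2 - M 2 2 * M 3 1)
      - M 1 1 * (M 2 0 * M 3 2 - M 2 2 * M 3 0) + M 1 2 * (M 2 0 * M 3 1 - M 2 1 * M 3 0)) := by
  rw [Matrix.det_succ_row_zero, Fin.sum_univ_four]
  simp [Matrix.det_fin_three, Fin.succAbove, Fin.lt_def]
  ring

-- The Levi-Civita symbol contracted with four copies of `M` is `M.det` times itself. All
-- transformation and sign rules of the Hodge dual come from this identity.
set_option maxHeartbeats 4000000 in
theorem flatDual_conj (M : Matrix (Fin 4) (Fin 4) R) {A : Matrix (Fin 4) (Fin 4) R}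
    (hA : IsAlt A) :
    M.transpose * flatDual (M * A * M.transpose) * M = M.det • flatDual A := by
  obtain ⟨h1, h2, h3, h4, h5, h6, h7⟩ := hA.entries
  ext i j
  rw [det_fin_four]
  fin_cases i <;> fin_cases j <;>
    simp [flatDual, Matrix.mul_apply, Fin.sum_univ_four, h1, h2, h3, h4, h5, h6, h7] <;> ring

/-- The derivative of `flatDual_conj` at the identity, in the direction `G`. -/
theorem trace_smul_flatDual_sub (G : Matrix (Fin 4) (Fin 4) R) {A : Matrix (Fin 4) (Fin 4) R}
    (hA : IsAlt A) :
    G.trace • flatDual A - flatDual (G * A + A * G.transpose) =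
      G.transpose * flatDual A + flatDual A * G := by
  obtain ⟨h1, h2, h3, h4, h5, h6, h7⟩ := hA.entries
  ext i j
  simp only [Matrix.add_apply, Matrix.sub_apply, Matrix.smul_apply, Matrix.mul_apply,
    Fin.sum_univ_four]
  fin_cases i <;> fin_cases j <;>
    simp [flatDual, Matrix.mul_apply, Fin.sum_univ_four, Matrix.trace, h1, h2, h3, h5, h6,
      h7] <;> ring

theorem flatDual_apply_eq_sum {K : Type*} [Field K] [CharZero K]
    {A : Matrix (Fin 4) (Fin 4) K} (hA : IsAlt A) (i j : Fin 4) :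
    flatDual A i j = 1 / 2 * ∑ r, ∑ s, (lc i j r s : K) * A r s := by
  obtain ⟨h1, h2, h3, h4, h5, h6, h7⟩ := hA.entries
  have s2 : Int.sign 2 = 1 := rfl
  have s3 : Int.sign 3 = 1 := rfl
  fin_cases i <;> fin_cases j <;>
    simp [flatDual, Fin.sum_univ_four, lc, h1, h2, h3, h4, h5, h6, h7, s2, s3] <;> ring

/-- With `P s` read as the derivative `∂_s P` of a bivector, this says that the exterior derivative
of a dual is the dual of the divergence. It serves three times: for the cyclic identity of the dual
curvature, for the traces of `𝓡`, and for turning the divergence of `𝓢` into a cyclic sum. -/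
theorem flatDual_cyclic {P : Fin 4 → Matrix (Fin 4) (Fin 4) R} (hP : ∀ s, IsAlt (P s))
    (a b c : Fin 4) :
    flatDual (P c) a b + flatDual (P b) c a + flatDual (P a) b c =
      - ∑ r, (lc a b c r : R) * ∑ s, P s r s := by
  have h1 := fun s ↦ (hP s).diag
  have h2 := fun s ↦ (hP s).anti 1 0
  have h3 := fun s ↦ (hP s).anti 2 0
  have h4 := fun s ↦ (hP s).anti 3 0
  have h5 := fun s ↦ (hP s).anti 2 1
  have h6 := fun s ↦ (hP s).anti 3 1
  have h7 := fun s ↦ (hP s).anti 3 2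
  have s2 : Int.sign 2 = 1 := rfl
  have s3 : Int.sign 3 = 1 := rfl
  have s6 : Int.sign 6 = 1 := rfl
  fin_cases a <;> fin_cases b <;> fin_cases c <;>
    simp [flatDual, Fin.sum_univ_four, lc, h1, h2, h3, h4, h5, h6, h7, s2, s3, s6] <;> try ring

end HodgeAlgebra

end Spacetime

namespace Spacetime

/-! ### Closure properties of smooth functions. -/

section SmoothOn

variable {M : Type*} [TopologicalSpace M] [ChartedSpace E4 M]
  {V : Type*} [NormedAddCommGroup V] [NormedSpace ℝ V] {W : Set M}

theorem SmoothOn.const (c : V) : SmoothOn W (fun _ : M ↦ c) := contMDiffOn_const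

theorem SmoothOn.add {f g : M → V} (hf : SmoothOn W f) (hg : SmoothOn W g) :
    SmoothOn W (fun q ↦ f q + g q) :=
  (contDiff_add (𝕜 := ℝ) (F := V)).contMDiff.comp_contMDiffOn (hf.prodMk_space hg)

theorem SmoothOn.neg {f : M → V} (hf : SmoothOn W f) : SmoothOn W (fun q ↦ - f q) :=
  (contDiff_neg (𝕜 := ℝ) (F := V)).contMDiff.comp_contMDiffOn hf

theorem SmoothOn.sub {f g : M → V} (hf : SmoothOn W f) (hg : SmoothOn W g) :
    SmoothOn W (fun q ↦ f q - g q) := by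
  simpa only [sub_eq_add_neg] using SmoothOn.add hf (SmoothOn.neg hg)

theorem SmoothOn.smul {f : M → ℝ} {g : M → V} (hf : SmoothOn W f) (hg : SmoothOn W g) :
    SmoothOn W (fun q ↦ f q • g q) :=
  (contDiff_smul (𝕜 := ℝ) (F := V)).contMDiff.comp_contMDiffOn (hf.prodMk_space hg)

theorem SmoothOn.mul {A : Type*} [NormedRing A] [NormedAlgebra ℝ A] {f g : M → A}
    (hf : SmoothOn W f) (hg : SmoothOn W g) : SmoothOn W (fun q ↦ f q * g q) :=
  (contDiff_mul (𝕜 := ℝ) (𝔸 := A)).contMDiff.comp_contMDiffOn (hf.prodMk_space hg)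

theorem SmoothOn.sum {ι : Type*} {s : Finset ι} {f : ι → M → V}
    (hf : ∀ i ∈ s, SmoothOn W (f i)) : SmoothOn W (fun q ↦ ∑ i ∈ s, f i q) := by
  classical
  induction s using Finset.induction_on with
  | empty => simpa using SmoothOn.const (0 : V)
  | insert i s hi ih =>
    simp only [Finset.sum_insert hi]
    exact SmoothOn.add (hf i (by simp)) (ih fun j hj ↦ hf j (by simp [hj]))

theorem SmoothOn.prod {A : Type*} [NormedCommRing A] [NormedAlgebra ℝ A] {ι : Type*}
    {s : Finset ι} {f : ι → M → A} (hf : ∀ i ∈ s, SmoothOn W (f i)) :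
    SmoothOn W (fun q ↦ ∏ i ∈ s, f i q) := by
  classical
  induction s using Finset.induction_on with
  | empty => simpa using SmoothOn.const (1 : A)
  | insert i s hi ih =>
    simp only [Finset.prod_insert hi]
    exact SmoothOn.mul (hf i (by simp)) (ih fun j hj ↦ hf j (by simp [hj]))

theorem SmoothOn.inv {A : Type*} [NormedField A] [NormedAlgebra ℝ A] {f : M → A}
    (hf : SmoothOn W f) (h0 : ∀ q ∈ W, f q ≠ 0) : SmoothOn W (fun q ↦ (f q)⁻¹) := by
  intro q hq
  exact ContMDiffAt.comp_contMDiffWithinAt q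
    ((contDiffAt_inv ℝ (h0 q hq)).contMDiffAt) (hf q hq)

theorem SmoothOn.ofReal {f : M → ℝ} (hf : SmoothOn W f) : SmoothOn W (fun q ↦ (f q : ℂ)) :=
  Complex.ofRealCLM.contMDiff.comp_contMDiffOn hf

theorem SmoothOn.det {X : M → Matrix (Fin 4) (Fin 4) ℝ}
    (hX : ∀ i j, SmoothOn W (fun q ↦ X q i j)) : SmoothOn W (fun q ↦ (X q).det) := by
  simp only [Matrix.det_apply']
  exact SmoothOn.sum fun σ _ ↦ SmoothOn.mul (SmoothOn.const _) (SmoothOn.prod fun i _ ↦ hX _ _)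

end SmoothOn

/-! ### Differentiation of matrix-valued functions. -/

section MatrixCalculus

variable {M : Type*} [TopologicalSpace M] [ChartedSpace E4 M]
  {A : Type*} [NormedCommRing A] [NormedAlgebra ℝ A]

/-- The entrywise partial derivative of a matrix of functions. -/
noncomputable def pdMat (e : OpenPartialHomeomorph M E4) (m : Fin 4)
    (X : M → Matrix (Fin 4) (Fin 4) A) (p : M) : Matrix (Fin 4) (Fin 4) A :=
  Matrix.of fun i j ↦ pd e m (fun q ↦ X q i j) p

/-- Entrywise differentiability of a matrix of functions. -/
def MatDiffAt (e : OpenPartialHomeomorph M E4) (p : M) (X : M → Matrix (Fin 4) (Fin 4) A) : Prop :=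
  ∀ i j, DiffAt e p (fun q ↦ X q i j)

variable {e : OpenPartialHomeomorph M E4} {p : M} {X Y : M → Matrix (Fin 4) (Fin 4) A}

theorem MatDiffAt.mul (hX : MatDiffAt e p X) (hY : MatDiffAt e p Y) :
    MatDiffAt e p (fun q ↦ X q * Y q) := by
  intro i j
  simp only [Matrix.mul_apply]
  exact DiffAt.sum fun k _ ↦ (hX i k).mul (hY k j)

theorem MatDiffAt.const (C : Matrix (Fin 4) (Fin 4) A) : MatDiffAt e p (fun _ ↦ C) :=
  fun _ _ ↦ DiffAt.const _

theorem MatDiffAt.flatDual (hX : MatDiffAt e p X) :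
    MatDiffAt e p (fun q ↦ Spacetime.flatDual (X q)) := by
  intro i j
  fin_cases i <;> fin_cases j <;> simp only [Spacetime.flatDual] <;>
    first
    | exact DiffAt.const _
    | exact hX _ _
    | exact (hX _ _).neg

theorem pdMat_mul (hp : p ∈ e.source) (hX : MatDiffAt e p X) (hY : MatDiffAt e p Y) (m : Fin 4) :
    pdMat e m (fun q ↦ X q * Y q) p = pdMat e m X p * Y p + X p * pdMat e m Y p := by
  ext i j
  simp only [pdMat, Matrix.of_apply, Matrix.mul_apply, Matrix.add_apply]
  rw [pd_sum fun k _ ↦ (hX i k).mul (hY k j), ← Finset.sum_add_distrib]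
  refine Finset.sum_congr rfl fun k _ ↦ ?_
  rw [pd_mul hp (hX i k) (hY k j)]
  ring

theorem pdMat_smul (hp : p ∈ e.source) {f : M → A} (hf : DiffAt e p f) (hX : MatDiffAt e p X)
    (m : Fin 4) :
    pdMat e m (fun q ↦ f q • X q) p = f p • pdMat e m X p + pd e m f p • X p := by
  ext i j
  simp only [pdMat, Matrix.of_apply, Matrix.smul_apply, Matrix.add_apply, smul_eq_mul]
  rw [pd_mul hp hf (hX i j)]

theorem pdMat_const (C : Matrix (Fin 4) (Fin 4) A) (m : Fin 4) :
    pdMat e m (fun _ : M ↦ C) p = 0 := by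
  ext i j
  simp [pdMat]

theorem pdMat_flatDual (X : M → Matrix (Fin 4) (Fin 4) A) (m : Fin 4) :
    pdMat e m (fun q ↦ flatDual (X q)) p = flatDual (pdMat e m X p) := by
  ext i j
  fin_cases i <;> fin_cases j <;> simp [flatDual, pdMat, pd_neg]

end MatrixCalculus

end Spacetime

namespace LorentzMetric

/-! ### The metric, its inverse and the Christoffel symbols. -/

section Metric

variable {M : Type*} [TopologicalSpace M] [ChartedSpace E4 M] [IsManifold (𝓡 4) ∞ M]
  (g : LorentzMetric M) {e : OpenPartialHomeomorph M E4} {p : M}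

/-- The matrix of the metric in a chart. -/
noncomputable def loMat (e : OpenPartialHomeomorph M E4) (p : M) : Matrix (Fin 4) (Fin 4) ℝ :=
  Matrix.of (g.lo e p)

/-- The matrix of the inverse metric in a chart. -/
noncomputable def upMat (e : OpenPartialHomeomorph M E4) (p : M) : Matrix (Fin 4) (Fin 4) ℝ :=
  Matrix.of (g.up e p)

/-- The connection matrices `(Γ_m)^n_a = Γ^n_{ma}`. -/
noncomputable def conn (e : OpenPartialHomeomorph M E4) (m : Fin 4) (p : M) :
    Matrix (Fin 4) (Fin 4) ℝ :=
  Matrix.of fun n a ↦ g.christoffel e p n m a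

theorem upMat_eq_inv : g.upMat e p = (g.loMat e p)⁻¹ := rfl

theorem lo_symm (i j : Fin 4) : g.lo e p i j = g.lo e p j i := g.symm p _ _

theorem loMat_transpose : (g.loMat e p).transpose = g.loMat e p := by
  ext i j
  exact g.lo_symm j i

theorem upMat_transpose : (g.upMat e p).transpose = g.upMat e p := by
  rw [upMat_eq_inv, Matrix.transpose_nonsing_inv, loMat_transpose]

theorem up_symm (i j : Fin 4) : g.up e p i j = g.up e p j i :=
  (congrFun (congrFun (g.upMat_transpose (e := e) (p := p)) i) j).symm

/-- The matrix of an orthonormal basis diagonalizes the metric. -/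
theorem exists_loMat_eq (he : e ∈ IsManifold.maximalAtlas (𝓡 4) ∞ M) (hp : p ∈ e.source) :
    ∃ (b : Module.Basis (Fin 4) ℝ (TangentSpace (𝓡 4) p)),
      (∀ i j, g.inner p (b i) (b j) = if i = j then (if i = 0 then -1 else 1) else 0) ∧
      (b.toMatrix (frame e p)).det ≠ 0 ∧
      (g.loMat e p).det = - (b.toMatrix (frame e p)).det ^ 2 := by
  obtain ⟨b, hb⟩ := g.lorentzian p
  refine ⟨b, hb, ?_, ?_⟩
  · have h : b.toMatrix (frame e p) * (frameBasis he hp).toMatrix b = 1 := by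
      have := b.toMatrix_mul_toMatrix_flip (frameBasis he hp)
      rwa [show ⇑(frameBasis he hp) = frame e p from funext (frameBasis_apply he hp)] at this
    intro h0
    have := congrArg Matrix.det h
    simp [h0] at this
  · have h : g.loMat e p = (b.toMatrix (frame e p)).transpose *
        Matrix.diagonal (fun i ↦ if i = 0 then (-1 : ℝ) else 1) * b.toMatrix (frame e p) := by
      ext i j
      simp only [loMat, Matrix.of_apply, lo, Matrix.mul_apply,
        Matrix.transpose_apply, Module.Basis.toMatrix_apply]
      conv_lhs => rw [← b.sum_repr (frame e p i), ← b.sum_repr (frame e p j)]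
      simp only [map_sum, map_smul, sum_apply, smul_apply, hb, smul_eq_mul]
      refine Finset.sum_congr rfl fun k _ ↦ ?_
      simp only [Matrix.diagonal_apply, mul_ite, mul_zero, Finset.sum_ite_eq', Finset.mem_univ,
        if_true, mul_neg, mul_one]
      split_ifs <;> ring
    rw [h, Matrix.det_mul, Matrix.det_mul, Matrix.det_transpose, Matrix.det_diagonal]
    simp
    ring

theorem det_loMat_ne_zero (he : e ∈ IsManifold.maximalAtlas (𝓡 4) ∞ M) (hp : p ∈ e.source) :
    (g.loMat e p).det ≠ 0 := by
  obtain ⟨b, -, h0, h⟩ := g.exists_loMat_eq he hp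
  rw [h]
  exact neg_ne_zero.2 (pow_ne_zero _ h0)

theorem loMat_mul_upMat (he : e ∈ IsManifold.maximalAtlas (𝓡 4) ∞ M) (hp : p ∈ e.source) :
    g.loMat e p * g.upMat e p = 1 :=
  Matrix.mul_nonsing_inv _ (isUnit_iff_ne_zero.2 (g.det_loMat_ne_zero he hp))

theorem upMat_mul_loMat (he : e ∈ IsManifold.maximalAtlas (𝓡 4) ∞ M) (hp : p ∈ e.source) :
    g.upMat e p * g.loMat e p = 1 :=
  Matrix.nonsing_inv_mul _ (isUnit_iff_ne_zero.2 (g.det_loMat_ne_zero he hp))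

theorem smoothOn_lo (he : e ∈ IsManifold.maximalAtlas (𝓡 4) ∞ M) (i j : Fin 4) :
    SmoothOn e.source (fun p ↦ g.lo e p i j) := g.contMDiffOn e he i j

theorem smoothOn_up (he : e ∈ IsManifold.maximalAtlas (𝓡 4) ∞ M) (i j : Fin 4) :
    SmoothOn e.source (fun p ↦ g.up e p i j) := by
  -- Cramer's rule exhibits the entry as a quotient of determinants of smooth functions.
  have h : ∀ p, g.up e p i j = ((g.loMat e p).det)⁻¹ *
      ((g.loMat e p).updateRow j (Pi.single i 1)).det := by
    intro p
    change (g.loMat e p)⁻¹ i j = _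
    rw [Matrix.inv_def, Ring.inverse_eq_inv', Matrix.smul_apply, Matrix.adjugate_apply]
    rfl
  simp only [h]
  refine SmoothOn.mul (SmoothOn.inv (SmoothOn.det fun i j ↦ g.smoothOn_lo he i j)
    fun q hq ↦ g.det_loMat_ne_zero he hq) (SmoothOn.det fun k l ↦ ?_)
  simp only [Matrix.updateRow_apply]
  split_ifs
  · exact SmoothOn.const _
  · exact g.smoothOn_lo he k l

theorem smoothOn_christoffel (he : e ∈ IsManifold.maximalAtlas (𝓡 4) ∞ M) (k i j : Fin 4) :
    SmoothOn e.source (fun p ↦ g.christoffel e p k i j) := by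
  unfold christoffel
  refine SmoothOn.mul (SmoothOn.const _) (SmoothOn.sum fun l _ ↦
    SmoothOn.mul (g.smoothOn_up he k l) ?_)
  have h : ∀ a b c, SmoothOn e.source (pd e a (fun q ↦ g.lo e q b c)) := fun a b c ↦
    SmoothOn.pd he (g.smoothOn_lo he b c) e.open_source le_rfl a
  exact SmoothOn.sub (SmoothOn.add (h _ _ _) (h _ _ _)) (h _ _ _)

theorem christoffel_symm (k i j : Fin 4) : g.christoffel e p k i j = g.christoffel e p k j i := by
  unfold christoffel
  congr 1
  refine Finset.sum_congr rfl fun l _ ↦ ?_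
  simp only [g.lo_symm (i := i) (j := j)]
  ring

theorem sum_lo_mul_christoffel (he : e ∈ IsManifold.maximalAtlas (𝓡 4) ∞ M) (hp : p ∈ e.source)
    (b i j : Fin 4) : ∑ k, g.lo e p b k * g.christoffel e p k i j =
      1 / 2 * (pd e i (fun q ↦ g.lo e q j b) p + pd e j (fun q ↦ g.lo e q i b) p
        - pd e b (fun q ↦ g.lo e q i j) p) := by
  have h : ∀ l, ∑ k, g.lo e p b k * g.up e p k l = if b = l then 1 else 0 := fun l ↦ by
    have := congrFun (congrFun (g.loMat_mul_upMat he hp) b) l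
    rw [Matrix.mul_apply, Matrix.one_apply] at this
    exact this
  unfold christoffel
  calc _ = 1 / 2 * ∑ l, (∑ k, g.lo e p b k * g.up e p k l) *
        (pd e i (fun q ↦ g.lo e q j l) p + pd e j (fun q ↦ g.lo e q i l) p
        - pd e l (fun q ↦ g.lo e q i j) p) := by
        simp only [Finset.mul_sum, Finset.sum_mul]
        rw [Finset.sum_comm]
        exact Finset.sum_congr rfl fun _ _ ↦ Finset.sum_congr rfl fun _ _ ↦ by ring
    _ = _ := by simp [h]

/-- Metric compatibility: in the sum of the two lowered Christoffel symbols all but one derivative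
of the metric cancel. -/
theorem pd_lo (he : e ∈ IsManifold.maximalAtlas (𝓡 4) ∞ M) (hp : p ∈ e.source) (m a b : Fin 4) :
    pd e m (fun q ↦ g.lo e q a b) p =
      ∑ n, (g.christoffel e p n m a * g.lo e p n b + g.christoffel e p n m b * g.lo e p a n) := by
  have h1 := g.sum_lo_mul_christoffel he hp b m a
  have h2 := g.sum_lo_mul_christoffel he hp a m b
  have h3 : ∑ n, (g.christoffel e p n m a * g.lo e p n b + g.christoffel e p n m b * g.lo e p a n)
      = ∑ k, g.lo e p b k * g.christoffel e p k m a +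
        ∑ k, g.lo e p a k * g.christoffel e p k m b := by
    rw [← Finset.sum_add_distrib]
    refine Finset.sum_congr rfl fun n _ ↦ ?_
    rw [g.lo_symm n b]
    ring
  rw [h3, h1, h2]
  simp only [g.lo_symm (i := b) (j := a)]
  ring

theorem matDiffAt_loMat (he : e ∈ IsManifold.maximalAtlas (𝓡 4) ∞ M) (hp : p ∈ e.source) :
    MatDiffAt e p (g.loMat e) :=
  fun i j ↦ SmoothOn.diffAt he (g.smoothOn_lo he i j) e.open_source hp hp

theorem matDiffAt_upMat (he : e ∈ IsManifold.maximalAtlas (𝓡 4) ∞ M) (hp : p ∈ e.source) :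
    MatDiffAt e p (g.upMat e) :=
  fun i j ↦ SmoothOn.diffAt he (g.smoothOn_up he i j) e.open_source hp hp

theorem matDiffAt_conn (he : e ∈ IsManifold.maximalAtlas (𝓡 4) ∞ M) (hp : p ∈ e.source)
    (m : Fin 4) : MatDiffAt e p (g.conn e m) :=
  fun i j ↦ SmoothOn.diffAt he (g.smoothOn_christoffel he i m j) e.open_source hp hp

theorem pdMat_loMat (he : e ∈ IsManifold.maximalAtlas (𝓡 4) ∞ M) (hp : p ∈ e.source)
    (m : Fin 4) : pdMat e m (g.loMat e) p =
      (g.conn e m p).transpose * g.loMat e p + g.loMat e p * g.conn e m p := by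
  ext a b
  simp only [pdMat, loMat, conn, Matrix.of_apply, Matrix.add_apply, Matrix.mul_apply,
    Matrix.transpose_apply, g.pd_lo he hp, ← Finset.sum_add_distrib]
  exact Finset.sum_congr rfl fun _ _ ↦ by ring

theorem pdMat_upMat (he : e ∈ IsManifold.maximalAtlas (𝓡 4) ∞ M) (hp : p ∈ e.source)
    (m : Fin 4) : pdMat e m (g.upMat e) p =
      - (g.conn e m p * g.upMat e p + g.upMat e p * (g.conn e m p).transpose) := by
  have h1 : pdMat e m (fun q ↦ g.upMat e q * g.loMat e q) p = 0 := by
    ext i j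
    simp only [pdMat, Matrix.of_apply, Matrix.zero_apply]
    rw [pd_congr_of_eqOn (g := fun _ ↦ (1 : Matrix (Fin 4) (Fin 4) ℝ) i j) e.open_source hp hp
      (fun q hq ↦ by rw [g.upMat_mul_loMat he hq]), pd_const]
  rw [pdMat_mul hp (g.matDiffAt_upMat he hp) (g.matDiffAt_loMat he hp), g.pdMat_loMat he hp] at h1
  have h2 := g.loMat_mul_upMat he hp
  have h3 := g.upMat_mul_loMat he hp
  set H := g.upMat e p
  set L := g.loMat e p
  set D := pdMat e m (g.upMat e) p
  set C := g.conn e m p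
  -- The derivative of `H * L = 1` is solved for `D` by multiplying with `H` on the right.
  calc D = (D * L + H * (C.transpose * L + L * C)) * H
        - H * C.transpose * (L * H) - (H * L) * C * H + D * (1 - L * H) := by noncomm_ring
    _ = _ := by rw [h1, h2, h3]; noncomm_ring

/-- Jacobi's formula, obtained by differentiating `flatDual_conj` with `M` the inverse metric and a
constant form `A`. -/
theorem pd_det_upMat (he : e ∈ IsManifold.maximalAtlas (𝓡 4) ∞ M) (hp : p ∈ e.source)
    (m : Fin 4) : pd e m (fun q ↦ (g.upMat e q).det) p =
      - 2 * (g.conn e m p).trace * (g.upMat e p).det := by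
  -- The test form `dx⁰ ∧ dx¹`; the entry `(2, 3)` of its dual is `1`, so the scalar coefficient can
  -- be read off at the end.
  let A : Matrix (Fin 4) (Fin 4) ℝ := !![0, 1, 0, 0; -1, 0, 0, 0; 0, 0, 0, 0; 0, 0, 0, 0]
  have hA : IsAlt A := by
    constructor
    · intro i; fin_cases i <;> simp [A]
    · intro i j; fin_cases i <;> fin_cases j <;> simp [A]
  have hAltConj : ∀ X : Matrix (Fin 4) (Fin 4) ℝ, ∀ B : Matrix (Fin 4) (Fin 4) ℝ, IsAlt B →
      IsAlt (X * B * X.transpose) := by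
    intro X B hB
    have : ∀ i j, (X * B * X.transpose) i j = - (X * B * X.transpose) j i := by
      intro i j
      have h : (X * B * X.transpose).transpose = -(X * B * X.transpose) := by
        rw [Matrix.transpose_mul, Matrix.transpose_mul, Matrix.transpose_transpose, hB.transpose]
        noncomm_ring
      have := congrFun (congrFun h j) i
      simpa using this
    exact ⟨fun i ↦ by linarith [this i i], this⟩
  have hH := g.matDiffAt_upMat he hp
  have hdet : DiffAt e p (fun q ↦ (g.upMat e q).det) :=
    SmoothOn.diffAt he (SmoothOn.det fun i j ↦ g.smoothOn_up he i j) e.open_source hp hp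
  have key : ∀ q, g.upMat e q * flatDual (g.upMat e q * A * g.upMat e q) * g.upMat e q =
      (g.upMat e q).det • flatDual A := by
    intro q
    have := flatDual_conj (g.upMat e q) hA
    rwa [g.upMat_transpose] at this
  have hX : MatDiffAt e p (fun q ↦ g.upMat e q * A * g.upMat e q) :=
    (hH.mul (MatDiffAt.const A)).mul hH
  have d1 : pdMat e m (fun q ↦ g.upMat e q * flatDual (g.upMat e q * A * g.upMat e q) *
      g.upMat e q) p = pd e m (fun q ↦ (g.upMat e q).det) p • flatDual A := by
    simp only [key]
    rw [pdMat_smul hp hdet (MatDiffAt.const _), pdMat_const]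
    simp
  rw [pdMat_mul hp (hH.mul hX.flatDual) hH, pdMat_mul hp hH hX.flatDual, pdMat_flatDual,
    pdMat_mul hp (hH.mul (MatDiffAt.const A)) hH, pdMat_mul hp hH (MatDiffAt.const A), pdMat_const,
    g.pdMat_upMat he hp] at d1
  have k0 := key p
  have kT : ∀ B, IsAlt B → g.upMat e p * flatDual (g.upMat e p * B * g.upMat e p) * g.upMat e p =
      (g.upMat e p).det • flatDual B := by
    intro B hB
    have := flatDual_conj (g.upMat e p) hB
    rwa [g.upMat_transpose] at this
  have hHt := g.upMat_transpose (e := e) (p := p)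
  have hX0 := hAltConj (g.upMat e p) A hA
  rw [hHt] at hX0
  set H := g.upMat e p
  set C := g.conn e m p
  have hA' : IsAlt (C.transpose * A + A * C) := by
    have : ∀ i j, (C.transpose * A + A * C) i j = - (C.transpose * A + A * C) j i := by
      intro i j
      have h : (C.transpose * A + A * C).transpose = -(C.transpose * A + A * C) := by
        rw [Matrix.transpose_add, Matrix.transpose_mul, Matrix.transpose_mul,
          Matrix.transpose_transpose, hA.transpose]
        noncomm_ring
      have := congrFun (congrFun h j) i
      simpa using this
    exact ⟨fun i ↦ by linarith [this i i], this⟩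
  -- The infinitesimal identity is used for `C` on the conjugated form and for its transpose on `A`.
  -- Each use contributes one trace, whence the factor `-2`; the remaining terms cancel.
  have t1 := trace_smul_flatDual_sub C hX0
  have t2 := trace_smul_flatDual_sub C.transpose hA
  rw [Matrix.transpose_transpose, Matrix.trace_transpose] at t2
  have k1 := kT _ hA'
  have e1 : (-(C * H + H * C.transpose) * A + H * 0) * H + H * A * -(C * H + H * C.transpose) =
      -(1 : ℝ) • ((C * (H * A * H) + H * A * H * C.transpose) + H * (C.transpose * A + A * C) * H)
      := by
    rw [neg_one_smul]; noncomm_ring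
  rw [e1, flatDual_smul, flatDual_add] at d1
  have t1' : flatDual (C * (H * A * H) + H * A * H * C.transpose) = C.trace • flatDual (H * A * H)
      - (C.transpose * flatDual (H * A * H) + flatDual (H * A * H) * C) := by
    rw [← t1]; abel
  have t2' : flatDual (C.transpose * A + A * C) = C.trace • flatDual A
      - (C * flatDual A + flatDual A * C.transpose) := by
    rw [← t2]; abel
  rw [t1'] at d1
  rw [t2'] at k1
  set B := flatDual (H * A * H)
  set B' := flatDual (H * (C.transpose * A + A * C) * H)
  have d2 : pd e m (fun q ↦ (g.upMat e q).det) p • flatDual A =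
      - (C * (H * B * H)) - (H * B * H) * C.transpose - C.trace • (H * B * H) - H * B' * H := by
    rw [← d1]
    simp only [neg_one_smul, neg_add, neg_sub, mul_add, add_mul, mul_sub, sub_mul,
      Matrix.mul_smul, Matrix.smul_mul, neg_mul, mul_neg, mul_assoc]
    abel
  rw [k0, k1] at d2
  have d3 := congrFun (congrFun d2 2) 3
  simp only [Matrix.sub_apply, Matrix.neg_apply, Matrix.smul_apply, Matrix.mul_smul,
    Matrix.smul_mul, smul_eq_mul, smul_sub, smul_add, Matrix.add_apply] at d3
  have a23 : flatDual A 2 3 = 1 := by simp [flatDual, A]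
  rw [a23] at d3
  linarith

end Metric

end LorentzMetric

namespace Spacetime

theorem det_ite_eq_lc : ∀ a b c d : Fin 4,
    Matrix.det (Matrix.of fun i j ↦ if ![a, b, c, d] j = i then (1 : ℤ) else 0) = lc a b c d := by
  simp only [det_fin_four, Matrix.of_apply]
  decide +kernel

section

variable {M : Type*} [TopologicalSpace M] [ChartedSpace E4 M]
  {A : Type*} [NormedCommRing A] [NormedAlgebra ℝ A]
  {e : OpenPartialHomeomorph M E4} {p : M} {X Y : M → Matrix (Fin 4) (Fin 4) A}

theorem pdMat_add (hX : MatDiffAt e p X) (hY : MatDiffAt e p Y) (m : Fin 4) :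
    pdMat e m (fun q ↦ X q + Y q) p = pdMat e m X p + pdMat e m Y p := by
  ext i j
  exact pd_add (hX i j) (hY i j) m

theorem pdMat_sub (hX : MatDiffAt e p X) (hY : MatDiffAt e p Y) (m : Fin 4) :
    pdMat e m (fun q ↦ X q - Y q) p = pdMat e m X p - pdMat e m Y p := by
  ext i j
  exact pd_sub (hX i j) (hY i j) m

theorem pdMat_transpose (X : M → Matrix (Fin 4) (Fin 4) A) (m : Fin 4) :
    pdMat e m (fun q ↦ (X q).transpose) p = (pdMat e m X p).transpose := rfl

theorem MatDiffAt.transpose (hX : MatDiffAt e p X) : MatDiffAt e p (fun q ↦ (X q).transpose) :=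
  fun i j ↦ hX j i

theorem MatDiffAt.sub (hX : MatDiffAt e p X) (hY : MatDiffAt e p Y) :
    MatDiffAt e p (fun q ↦ X q - Y q) := fun i j ↦ (hX i j).sub (hY i j)

theorem pdMat_congr_of_eqOn {W : Set M} (hW : IsOpen W) (hp : p ∈ W) (hpe : p ∈ e.source)
    (h : ∀ q ∈ W, X q = Y q) (m : Fin 4) : pdMat e m X p = pdMat e m Y p := by
  ext i j
  exact pd_congr_of_eqOn hW hp hpe (fun q hq ↦ by rw [h q hq]) m

theorem pdMat_comm [IsManifold (𝓡 4) ∞ M] (he : e ∈ IsManifold.maximalAtlas (𝓡 4) ∞ M)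
    {W : Set M} (hX : ∀ i j, SmoothOn W (fun q ↦ X q i j)) (hW : IsOpen W)
    (hp : p ∈ W) (hpe : p ∈ e.source) (i j : Fin 4) :
    pdMat e i (pdMat e j X) p = pdMat e j (pdMat e i X) p := by
  ext a b
  exact pd_comm he (hX a b) hW hp hpe i j

end

end Spacetime

namespace LorentzMetric

/-! ### The volume form and its derivative. -/

section Volume

variable {M : Type*} [TopologicalSpace M] [ChartedSpace E4 M] [IsManifold (𝓡 4) ∞ M]
  {g : LorentzMetric M} (ε : g.VolumeForm) {e : OpenPartialHomeomorph M E4} {p : M}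

/-- The component `∈₀₁₂₃` of the volume form. -/
noncomputable def VolumeForm.vol (e : OpenPartialHomeomorph M E4) (p : M) : ℝ :=
  ε.form p (frame e p)

theorem comp_eq_vol_mul_lc (he : e ∈ IsManifold.maximalAtlas (𝓡 4) ∞ M) (hp : p ∈ e.source)
    (a b c d : Fin 4) : ε.comp e p a b c d = ε.vol e p * lc a b c d := by
  have h := (ε.form p).eq_smul_basis_det (frameBasis he hp)
  have hf : ⇑(frameBasis he hp) = frame e p := funext (frameBasis_apply he hp)
  unfold VolumeForm.comp
  rw [h, AlternatingMap.smul_apply, hf, smul_eq_mul]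
  congr 1
  rw [← det_ite_eq_lc, Module.Basis.det_apply, Int.cast_det]
  congr 1
  ext i j
  have : ![frame e p a, frame e p b, frame e p c, frame e p d] j =
      frameBasis he hp (![a, b, c, d] j) := by
    rw [hf]; fin_cases j <;> rfl
  rw [Module.Basis.toMatrix_apply, this, Module.Basis.repr_self, Finsupp.single_apply]
  simp

theorem smoothOn_vol (he : e ∈ IsManifold.maximalAtlas (𝓡 4) ∞ M) :
    SmoothOn e.source (fun p ↦ ε.vol e p) := ε.contMDiffOn e he

/-- In an orthonormal basis the form is `±1` and the metric has determinant `-1`. Passing to the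
coordinate frame multiplies them by a determinant and by its square; the sign is that of the
signature. -/
theorem vol_sq_mul_det (he : e ∈ IsManifold.maximalAtlas (𝓡 4) ∞ M) (hp : p ∈ e.source) :
    ε.vol e p ^ 2 * (g.upMat e p).det = -1 := by
  obtain ⟨b, hb, h0, hdet⟩ := g.exists_loMat_eq he hp
  have h1 : ε.vol e p = ε.form p b * (b.toMatrix (frame e p)).det := by
    unfold VolumeForm.vol
    conv_lhs => rw [(ε.form p).eq_smul_basis_det b]
    rw [AlternatingMap.smul_apply, smul_eq_mul, Module.Basis.det_apply]
  have h2 : ε.form p b ^ 2 = 1 := by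
    rcases ε.normalized p b hb with h | h <;> simp [h]
  have h3 : (g.loMat e p).det * (g.upMat e p).det = 1 := by
    rw [← Matrix.det_mul, g.loMat_mul_upMat he hp, Matrix.det_one]
  rw [hdet] at h3
  rw [h1, mul_pow, h2]
  linarith

theorem vol_ne_zero (he : e ∈ IsManifold.maximalAtlas (𝓡 4) ∞ M) (hp : p ∈ e.source) :
    ε.vol e p ≠ 0 := by
  intro h
  have := vol_sq_mul_det ε he hp
  simp [h] at this

/-- The volume form is parallel. Differentiating the normalisation `vol_sq_mul_det` avoids choosing
a sign of the square root. -/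
theorem pd_vol (he : e ∈ IsManifold.maximalAtlas (𝓡 4) ∞ M) (hp : p ∈ e.source) (m : Fin 4) :
    pd e m (fun q ↦ ε.vol e q) p = (g.conn e m p).trace * ε.vol e p := by
  have hv : DiffAt e p (fun q ↦ ε.vol e q) :=
    SmoothOn.diffAt he (smoothOn_vol ε he) e.open_source hp hp
  have hd : DiffAt e p (fun q ↦ (g.upMat e q).det) :=
    SmoothOn.diffAt he (SmoothOn.det fun i j ↦ g.smoothOn_up he i j) e.open_source hp hp
  have h : pd e m (fun q ↦ ε.vol e q * ε.vol e q * (g.upMat e q).det) p = 0 := by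
    rw [pd_congr_of_eqOn (g := fun _ ↦ (-1 : ℝ)) e.open_source hp hp
      (fun q hq ↦ by rw [← vol_sq_mul_det ε he hq]; ring), pd_const]
  rw [pd_mul hp (hv.mul hv) hd, pd_mul hp hv hv, g.pd_det_upMat he hp] at h
  have h1 := vol_sq_mul_det ε he hp
  have h2 := vol_ne_zero ε he hp
  have h3 : (g.upMat e p).det ≠ 0 := by
    intro h0
    simp [h0] at h1
  have h4 : 2 * (ε.vol e p * (g.upMat e p).det) *
      (pd e m (fun q ↦ ε.vol e q) p - (g.conn e m p).trace * ε.vol e p) = 0 := by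
    linear_combination h
  have h5 : 2 * (ε.vol e p * (g.upMat e p).det) ≠ 0 := by positivity
  linarith [(mul_eq_zero.1 h4).resolve_left h5]

end Volume

/-! ### Curvature: algebraic symmetries and the Bianchi identities. -/

section Curvature

variable {M : Type*} [TopologicalSpace M] [ChartedSpace E4 M] [IsManifold (𝓡 4) ∞ M]
  (g : LorentzMetric M) {e : OpenPartialHomeomorph M E4} {p : M}

/-- The curvature matrices `(R_{cd})^a_b = R^a_{bcd}`. -/
noncomputable def curv (e : OpenPartialHomeomorph M E4) (c d : Fin 4) (p : M) :
    Matrix (Fin 4) (Fin 4) ℝ :=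
  Matrix.of fun a b ↦ g.riemannUp e p a b c d

theorem curv_eq (c d : Fin 4) : g.curv e c d p =
    pdMat e c (g.conn e d) p - pdMat e d (g.conn e c) p
      + (g.conn e c p * g.conn e d p - g.conn e d p * g.conn e c p) := by
  ext a b
  simp [curv, riemannUp, pdMat, conn, Matrix.mul_apply]

theorem smoothOn_riemannUp (he : e ∈ IsManifold.maximalAtlas (𝓡 4) ∞ M) (a b c d : Fin 4) :
    SmoothOn e.source (fun p ↦ g.riemannUp e p a b c d) := by
  have h := fun i j k ↦ g.smoothOn_christoffel he i j k
  have h2 := fun m i j k ↦ SmoothOn.pd he (h i j k) e.open_source le_rfl m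
  exact SmoothOn.add (SmoothOn.sub (h2 _ _ _ _) (h2 _ _ _ _)) (SmoothOn.sum fun n _ ↦
    SmoothOn.sub (SmoothOn.mul (h _ _ _) (h _ _ _)) (SmoothOn.mul (h _ _ _) (h _ _ _)))

theorem smoothOn_riemann (he : e ∈ IsManifold.maximalAtlas (𝓡 4) ∞ M) (a b c d : Fin 4) :
    SmoothOn e.source (fun p ↦ g.riemann e p a b c d) :=
  SmoothOn.sum fun n _ ↦ SmoothOn.mul (g.smoothOn_lo he a n) (g.smoothOn_riemannUp he n b c d)

theorem riemannUp_swap (a b c d : Fin 4) :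
    g.riemannUp e p a b d c = - g.riemannUp e p a b c d := by
  have : g.curv e d c p = - g.curv e c d p := by
    rw [curv_eq, curv_eq]; abel
  simpa [curv] using congrFun (congrFun this a) b

/-- Only the symmetry of the Christoffel symbols is used: the terms then cancel in pairs. -/
theorem riemannUp_cyclic (a b c d : Fin 4) :
    g.riemannUp e p a b c d + g.riemannUp e p a c d b + g.riemannUp e p a d b c = 0 := by
  have hs : ∀ k i j, (fun q ↦ g.christoffel e q k i j) = fun q ↦ g.christoffel e q k j i :=
    fun k i j ↦ funext fun q ↦ g.christoffel_symm k i j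
  unfold riemannUp
  rw [hs a d b, hs a c b, hs a d c]
  have : (∑ n, (g.christoffel e p a c n * g.christoffel e p n d b
      - g.christoffel e p a d n * g.christoffel e p n c b))
    + (∑ n, (g.christoffel e p a d n * g.christoffel e p n b c
      - g.christoffel e p a b n * g.christoffel e p n d c))
    + (∑ n, (g.christoffel e p a b n * g.christoffel e p n c d
      - g.christoffel e p a c n * g.christoffel e p n b d)) = 0 := by
    rw [← Finset.sum_add_distrib, ← Finset.sum_add_distrib]
    refine Finset.sum_eq_zero fun n _ ↦ ?_
    rw [g.christoffel_symm n d b, g.christoffel_symm n c b, g.christoffel_symm n d c]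
    ring
  linarith

theorem loMat_mul_curv_apply (a b c d : Fin 4) :
    (g.loMat e p * g.curv e c d p) a b = g.riemann e p a b c d := by
  simp [Matrix.mul_apply, riemann, loMat, curv]

theorem riemann_swap_right (a b c d : Fin 4) :
    g.riemann e p a b d c = - g.riemann e p a b c d := by
  simp [riemann, g.riemannUp_swap (d := d) (c := c)]

theorem riemann_cyclic_right (a b c d : Fin 4) :
    g.riemann e p a b c d + g.riemann e p a c d b + g.riemann e p a d b c = 0 := by
  unfold riemann
  rw [← Finset.sum_add_distrib, ← Finset.sum_add_distrib]
  refine Finset.sum_eq_zero fun n _ ↦ ?_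
  rw [← mul_add, ← mul_add, g.riemannUp_cyclic, mul_zero]

/-- Second derivatives of the metric commute; expressing them through the connection by
`pdMat_loMat`, the commutator is the antisymmetry of the lowered curvature. -/
theorem riemann_swap_left (he : e ∈ IsManifold.maximalAtlas (𝓡 4) ∞ M) (hp : p ∈ e.source)
    (a b c d : Fin 4) : g.riemann e p b a c d = - g.riemann e p a b c d := by
  have hL := g.matDiffAt_loMat he hp
  have hC := fun m ↦ g.matDiffAt_conn he hp m
  have hd : ∀ i j, pdMat e i (pdMat e j (g.loMat e)) p =
      (pdMat e i (g.conn e j) p).transpose * g.loMat e p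
        + (g.conn e j p).transpose * pdMat e i (g.loMat e) p
        + (pdMat e i (g.loMat e) p * g.conn e j p
        + g.loMat e p * pdMat e i (g.conn e j) p) := by
    intro i j
    rw [pdMat_congr_of_eqOn e.open_source hp hp (fun q hq ↦ g.pdMat_loMat he hq j),
      pdMat_add ((hC j).transpose.mul hL) (hL.mul (hC j)), pdMat_mul hp (hC j).transpose hL,
      pdMat_mul hp hL (hC j), pdMat_transpose]
  have key : (g.curv e c d p).transpose * g.loMat e p + g.loMat e p * g.curv e c d p = 0 := by
    have h := pdMat_comm he (g.smoothOn_lo he) e.open_source hp hp c d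
    change pdMat e c (pdMat e d (g.loMat e)) p = pdMat e d (pdMat e c (g.loMat e)) p at h
    rw [hd, hd, g.pdMat_loMat he hp, g.pdMat_loMat he hp] at h
    rw [← sub_eq_zero] at h
    rw [curv_eq, ← h]
    simp only [Matrix.transpose_add, Matrix.transpose_sub, Matrix.transpose_mul]
    noncomm_ring
  have h1 := congrFun (congrFun key a) b
  rw [Matrix.add_apply, loMat_mul_curv_apply, Matrix.zero_apply] at h1
  have h2 : ((g.curv e c d p).transpose * g.loMat e p) a b = g.riemann e p b a c d := by
    rw [← loMat_mul_curv_apply, ← g.loMat_transpose, ← Matrix.transpose_mul, g.loMat_transpose]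
    rfl
  linarith

/-- The algebraic symmetries of a curvature tensor imply the pair symmetry. -/
theorem _root_.Spacetime.pair_symm_of_cyclic {X : Fin 4 → Fin 4 → Fin 4 → Fin 4 → ℝ}
    (h1 : ∀ a b c d, X b a c d = - X a b c d) (h2 : ∀ a b c d, X a b d c = - X a b c d)
    (h3 : ∀ a b c d, X a b c d + X a c d b + X a d b c = 0) (a b c d : Fin 4) :
    X a b c d = X c d a b := by
  linarith [h3 a b c d, h3 b c d a, h3 c d a b, h3 d a b c, h1 a b c d, h1 a c d b, h1 a d b c,
    h1 b c d a, h1 b d a c, h1 c d a b, h2 a b c d, h2 a c d b, h2 a d b c, h2 b c d a,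
    h2 b d a c, h2 c d a b, h2 b a c d, h2 c a d b, h2 d a b c, h2 c b d a, h2 d b a c,
    h2 d c a b]

theorem riemann_pair_symm (he : e ∈ IsManifold.maximalAtlas (𝓡 4) ∞ M) (hp : p ∈ e.source)
    (a b c d : Fin 4) : g.riemann e p a b c d = g.riemann e p c d a b :=
  pair_symm_of_cyclic (g.riemann_swap_left he hp) g.riemann_swap_right g.riemann_cyclic_right
    a b c d

theorem matDiffAt_curv (he : e ∈ IsManifold.maximalAtlas (𝓡 4) ∞ M) (hp : p ∈ e.source)
    (c d : Fin 4) : MatDiffAt e p (g.curv e c d) :=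
  fun i j ↦ SmoothOn.diffAt he (g.smoothOn_riemannUp he i j c d) e.open_source hp hp

/-- The identity `dΩ + [Γ, Ω] = 0` for the matrix-valued curvature form. Christoffel terms for the
form indices are omitted since they cancel in the cyclic sum, as `nablaCurv_cyclic` verifies. -/
theorem bianchi (he : e ∈ IsManifold.maximalAtlas (𝓡 4) ∞ M) (hp : p ∈ e.source)
    (a c d : Fin 4) :
    (pdMat e a (g.curv e c d) p + (g.conn e a p * g.curv e c d p - g.curv e c d p * g.conn e a p))
    + (pdMat e c (g.curv e d a) p
      + (g.conn e c p * g.curv e d a p - g.curv e d a p * g.conn e c p))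
    + (pdMat e d (g.curv e a c) p
      + (g.conn e d p * g.curv e a c p - g.curv e a c p * g.conn e d p)) = 0 := by
  have hC := fun m ↦ g.matDiffAt_conn he hp m
  have hC2 : ∀ i j, MatDiffAt e p (pdMat e i (g.conn e j)) := fun i j k l ↦
    SmoothOn.diffAt he (SmoothOn.pd he (g.smoothOn_christoffel he k j l) e.open_source le_rfl i)
      e.open_source hp hp
  have hd : ∀ m i j, pdMat e m (g.curv e i j) p =
      pdMat e m (pdMat e i (g.conn e j)) p - pdMat e m (pdMat e j (g.conn e i)) p
      + ((pdMat e m (g.conn e i) p * g.conn e j p + g.conn e i p * pdMat e m (g.conn e j) p)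
      - (pdMat e m (g.conn e j) p * g.conn e i p + g.conn e j p * pdMat e m (g.conn e i) p)) := by
    intro m i j
    rw [pdMat_congr_of_eqOn e.open_source hp hp (fun q _ ↦ g.curv_eq i j),
      pdMat_add ((hC2 i j).sub (hC2 j i)) (((hC i).mul (hC j)).sub ((hC j).mul (hC i))),
      pdMat_sub (hC2 i j) (hC2 j i), pdMat_sub ((hC i).mul (hC j)) ((hC j).mul (hC i)),
      pdMat_mul hp (hC i) (hC j), pdMat_mul hp (hC j) (hC i)]
  have hcomm : ∀ i j k, pdMat e i (pdMat e j (g.conn e k)) p =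
      pdMat e j (pdMat e i (g.conn e k)) p := fun i j k ↦
    pdMat_comm he (fun a b ↦ g.smoothOn_christoffel he a k b) e.open_source hp hp i j
  rw [hd, hd, hd, hcomm a c d, hcomm a d c, hcomm c d a]
  simp only [curv_eq]
  noncomm_ring

/-- The covariant derivative `D_m R^a_{bcd}`. -/
noncomputable def nablaCurv (e : OpenPartialHomeomorph M E4) (p : M) (m a b c d : Fin 4) : ℝ :=
  (pdMat e m (g.curv e c d) p
      + (g.conn e m p * g.curv e c d p - g.curv e c d p * g.conn e m p)) a b
    - ∑ n, (g.christoffel e p n m c * g.riemannUp e p a b n d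
      + g.christoffel e p n m d * g.riemannUp e p a b c n)

theorem nablaCurv_cyclic (he : e ∈ IsManifold.maximalAtlas (𝓡 4) ∞ M) (hp : p ∈ e.source)
    (m a b c d : Fin 4) : g.nablaCurv e p m a b c d + g.nablaCurv e p c a b d m
      + g.nablaCurv e p d a b m c = 0 := by
  have h := congrFun (congrFun (g.bianchi he hp m c d) a) b
  rw [Matrix.add_apply, Matrix.add_apply, Matrix.zero_apply] at h
  unfold nablaCurv
  have : (∑ n, (g.christoffel e p n m c * g.riemannUp e p a b n d
      + g.christoffel e p n m d * g.riemannUp e p a b c n))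
      + (∑ n, (g.christoffel e p n c d * g.riemannUp e p a b n m
      + g.christoffel e p n c m * g.riemannUp e p a b d n))
      + (∑ n, (g.christoffel e p n d m * g.riemannUp e p a b n c
      + g.christoffel e p n d c * g.riemannUp e p a b m n)) = 0 := by
    rw [← Finset.sum_add_distrib, ← Finset.sum_add_distrib]
    refine Finset.sum_eq_zero fun n _ ↦ ?_
    rw [g.christoffel_symm n c m, g.christoffel_symm n d m, g.christoffel_symm n d c,
      g.riemannUp_swap a b c n, g.riemannUp_swap a b m n, g.riemannUp_swap a b n d]
    ring
  linarith

theorem nablaCurv_swap (m a b c d : Fin 4) :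
    g.nablaCurv e p m a b d c = - g.nablaCurv e p m a b c d := by
  have h1 : g.curv e d c = fun q ↦ - g.curv e c d q := by
    ext q a b
    exact g.riemannUp_swap a b c d
  have h2 : pdMat e m (g.curv e d c) p = - pdMat e m (g.curv e c d) p := by
    rw [h1]; ext i j; exact pd_neg _ _
  have h3 : ∀ n, g.riemannUp e p a b d n = - g.riemannUp e p a b n d := fun n ↦
    g.riemannUp_swap a b n d
  have h4 : ∀ n, g.riemannUp e p a b n c = - g.riemannUp e p a b c n := fun n ↦
    g.riemannUp_swap a b c n
  unfold nablaCurv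
  rw [h2, h1]
  simp only [h3, h4, Matrix.add_apply, Matrix.sub_apply, Matrix.neg_apply, mul_neg, neg_mul,
    Finset.sum_add_distrib, Finset.sum_neg_distrib]
  ring

/-- This is the derivative of the Ricci tensor: the correction for the upper index cancels the one
for the form index contracted with it. -/
theorem sum_nablaCurv_trace (hvac : g.IsVacuum) (he : e ∈ IsManifold.maximalAtlas (𝓡 4) ∞ M)
    (hp : p ∈ e.source) (m b d : Fin 4) : ∑ a, g.nablaCurv e p m a b a d = 0 := by
  have hric : ∀ i j, ∑ a, g.riemannUp e p a i a j = 0 := hvac e he p hp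
  have h1 : ∑ a, pdMat e m (g.curv e a d) p a b = 0 := by
    have : pd e m (fun q ↦ ∑ a, g.riemannUp e q a b a d) p = 0 := by
      rw [pd_congr_of_eqOn (f := fun q ↦ ∑ a, g.riemannUp e q a b a d) (g := fun _ ↦ (0 : ℝ))
        e.open_source hp hp (fun q hq ↦ hvac e he q hq b d), pd_const]
    rwa [pd_sum fun a _ ↦ SmoothOn.diffAt he (g.smoothOn_riemannUp he a b a d)
      e.open_source hp hp] at this
  have h2 : ∑ a, (g.curv e a d p * g.conn e m p) a b = 0 := by
    simp only [Matrix.mul_apply]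
    rw [Finset.sum_comm]
    refine Finset.sum_eq_zero fun n _ ↦ ?_
    rw [← Finset.sum_mul]
    have := hric n d
    simp only [curv, Matrix.of_apply]
    rw [this, zero_mul]
  have h3 : ∑ a, ∑ n, g.christoffel e p n m d * g.riemannUp e p a b a n = 0 := by
    rw [Finset.sum_comm]
    refine Finset.sum_eq_zero fun n _ ↦ ?_
    rw [← Finset.mul_sum, hric, mul_zero]
  have h4 : ∑ a, (g.conn e m p * g.curv e a d p) a b =
      ∑ a, ∑ n, g.christoffel e p n m a * g.riemannUp e p a b n d := by
    simp only [Matrix.mul_apply, conn, curv, Matrix.of_apply]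
    exact Finset.sum_comm
  simp only [nablaCurv, Matrix.add_apply, Matrix.sub_apply, Finset.sum_sub_distrib,
    Finset.sum_add_distrib]
  rw [h1, h2, h3, h4]
  ring

/-- Contracting the Bianchi identity writes the divergence as a difference of two derivatives of the
Ricci tensor. -/
theorem sum_nablaCurv_div (hvac : g.IsVacuum) (he : e ∈ IsManifold.maximalAtlas (𝓡 4) ∞ M)
    (hp : p ∈ e.source) (b c d : Fin 4) : ∑ a, g.nablaCurv e p a a b c d = 0 := by
  have h1 := g.sum_nablaCurv_trace hvac he hp c b d
  have h2 := g.sum_nablaCurv_trace hvac he hp d b c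
  have h3 : ∀ a, g.nablaCurv e p a a b c d =
      g.nablaCurv e p c a b a d - g.nablaCurv e p d a b a c := by
    intro a
    have := g.nablaCurv_cyclic he hp a a b c d
    rw [g.nablaCurv_swap c a b a d] at this
    linarith
  simp only [h3, Finset.sum_sub_distrib, h1, h2, sub_zero]

end Curvature

end LorentzMetric

namespace Spacetime

/-! ### The Hodge dual on two-forms. -/

section Hodge

variable {R : Type*} [CommRing R]

/-- The Hodge dual of a two-form with matrix `A`, for the volume element `w` and the inverse
metric `h`. -/
def hodge (w : R) (h A : Matrix (Fin 4) (Fin 4) R) : Matrix (Fin 4) (Fin 4) R :=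
  w • flatDual (h * A * h)

theorem hodge_add (w : R) (h A B : Matrix (Fin 4) (Fin 4) R) :
    hodge w h (A + B) = hodge w h A + hodge w h B := by
  simp [hodge, mul_add, add_mul, flatDual_add]

theorem hodge_smul (w c : R) (h A : Matrix (Fin 4) (Fin 4) R) :
    hodge w h (c • A) = c • hodge w h A := by
  simp [hodge, flatDual_smul, smul_smul, mul_comm]

theorem hodge_zero (w : R) (h : Matrix (Fin 4) (Fin 4) R) : hodge w h 0 = 0 := by
  simpa using hodge_smul w 0 h 0

theorem hodge_neg (w : R) (h A : Matrix (Fin 4) (Fin 4) R) : hodge w h (-A) = - hodge w h A := by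
  simpa using hodge_smul w (-1) h A

theorem hodge_sub (w : R) (h A B : Matrix (Fin 4) (Fin 4) R) :
    hodge w h (A - B) = hodge w h A - hodge w h B := by
  rw [sub_eq_add_neg, hodge_add, hodge_neg, ← sub_eq_add_neg]

theorem hodge_sum {ι : Type*} (s : Finset ι) (w : R) (h : Matrix (Fin 4) (Fin 4) R)
    (A : ι → Matrix (Fin 4) (Fin 4) R) :
    hodge w h (∑ i ∈ s, A i) = ∑ i ∈ s, hodge w h (A i) := by
  classical
  induction s using Finset.induction_on with
  | empty => simp [hodge_zero]
  | insert i s hi ih => rw [Finset.sum_insert hi, hodge_add, ih, Finset.sum_insert hi]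

theorem isAlt_flatDual (A : Matrix (Fin 4) (Fin 4) R) : IsAlt (flatDual A) := by
  constructor
  · intro i; fin_cases i <;> simp [flatDual]
  · intro i j; fin_cases i <;> fin_cases j <;> simp [flatDual]

theorem isAlt_hodge (w : R) (h A : Matrix (Fin 4) (Fin 4) R) : IsAlt (hodge w h A) := by
  have := isAlt_flatDual (h * A * h)
  constructor
  · intro i; simp [hodge, this.diag i]
  · intro i j; simp [hodge, this.anti i j]

theorem isAlt_conj {h A : Matrix (Fin 4) (Fin 4) R} (hh : h.transpose = h) (hA : IsAlt A) :
    IsAlt (h * A * h) := by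
  have hs : ∀ i j, h i j = h j i := fun i j ↦ congrFun (congrFun hh j) i
  constructor
  · intro i
    simp only [Matrix.mul_apply, Fin.sum_univ_four]
    obtain ⟨h1, h2, h3, h4, h5, h6, h7⟩ := hA.entries
    rw [h1, h1, h1, h1, h2, h3, h4, h5, h6, h7, hs 0 i, hs 1 i, hs 2 i, hs 3 i]
    ring
  · intro i j
    have h : (h * A * h).transpose = -(h * A * h) := by
      rw [Matrix.transpose_mul, Matrix.transpose_mul, hh, hA.transpose]
      noncomm_ring
    simpa using congrFun (congrFun h j) i

/-- Dualising twice conjugates by the inverse metric, so `flatDual_conj` produces `w ^ 2 * h.det`.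
Its value `-1` is why self-duality requires the factor `i`. -/
theorem hodge_hodge {w : R} {h A : Matrix (Fin 4) (Fin 4) R} (hh : h.transpose = h)
    (hw : w ^ 2 * h.det = -1) (hA : IsAlt A) : hodge w h (hodge w h A) = - A := by
  have h1 := flatDual_conj h hA
  rw [hh] at h1
  unfold hodge
  rw [Matrix.mul_smul, Matrix.smul_mul, flatDual_smul, h1, flatDual_smul, flatDual_flatDual hA,
    smul_smul, smul_smul, show w * w * h.det = w ^ 2 * h.det by ring, hw, neg_one_smul]

/-- `A h B + B h A` is a multiple of the metric for self-dual two-forms `A`, `B`. -/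
theorem mul_add_mul_of_selfDual {w c : R} {h g A B : Matrix (Fin 4) (Fin 4) R}
    (hh : h.transpose = h) (hg : h * g = 1) (hA : IsAlt A) (hB : IsAlt B)
    (sA : A = c • hodge w h A) (sB : B = c • hodge w h B) :
    ∃ k : R, A * h * B + B * h * A = k • g := by
  -- Self-duality replaces the last factor of each product by a dual, which reduces the claim to
  -- `mul_flatDual_add` for the forms with raised indices.
  obtain ⟨k, hk⟩ := mul_flatDual_add (isAlt_conj hh hA) (isAlt_conj hh hB)
  refine ⟨(c * w) * k, ?_⟩
  have e1 : h * A * h * B = (c * w) • (h * A * h * flatDual (h * B * h)) := by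
    conv_lhs => rw [sB]
    rw [hodge, smul_smul, Matrix.mul_smul]
  have e2 : h * B * h * A = (c * w) • (h * B * h * flatDual (h * A * h)) := by
    conv_lhs => rw [sA]
    rw [hodge, smul_smul, Matrix.mul_smul]
  have e3 : h * (A * h * B + B * h * A) = h * (((c * w) * k) • g) := by
    rw [mul_add, ← mul_assoc, ← mul_assoc, ← mul_assoc, ← mul_assoc, e1, e2, ← smul_add, hk,
      Matrix.mul_smul, hg, smul_smul]
  have hg' : g * h = 1 := mul_eq_one_comm.1 hg
  calc _ = g * h * (A * h * B + B * h * A) := by rw [hg', one_mul]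
    _ = g * h * (((c * w) * k) • g) := by rw [mul_assoc, e3, ← mul_assoc]
    _ = _ := by rw [hg', one_mul]

end Hodge

end Spacetime

namespace LorentzMetric

/-! ### The Ricci identity for one-forms. -/

section RicciIdentity

variable {M : Type*} [TopologicalSpace M] [ChartedSpace E4 M] [IsManifold (𝓡 4) ∞ M]
  (g : LorentzMetric M) {e : OpenPartialHomeomorph M E4} {p : M} {W : Set M}

/-- The covariant derivative of a one-form with components `x`. -/
noncomputable def covD1 (e : OpenPartialHomeomorph M E4) (x : Fin 4 → M → ℝ) (a b : Fin 4)
    (p : M) : ℝ :=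
  pd e a (x b) p - ∑ n, g.christoffel e p n a b * x n p

/-- The covariant derivative of a covariant two-tensor with components `y`. -/
noncomputable def covD2 (e : OpenPartialHomeomorph M E4) (y : Fin 4 → Fin 4 → M → ℝ)
    (m a b : Fin 4) (p : M) : ℝ :=
  pd e m (y a b) p - (∑ n, g.christoffel e p n m a * y n b p
    + ∑ n, g.christoffel e p n m b * y a n p)

theorem smoothOn_covD1 (he : e ∈ IsManifold.maximalAtlas (𝓡 4) ∞ M) (hW : IsOpen W)
    (hWe : W ⊆ e.source) {x : Fin 4 → M → ℝ} (hx : ∀ a, SmoothOn W (x a)) (a b : Fin 4) :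
    SmoothOn W (g.covD1 e x a b) :=
  SmoothOn.sub (SmoothOn.pd he (hx b) hW hWe a) (SmoothOn.sum fun n _ ↦
    SmoothOn.mul ((g.smoothOn_christoffel he n a b).mono hWe) (hx n))

/-- Second partial derivatives commute and the Christoffel term of the outer derivative index drops
by symmetry; what is left assembles into the curvature. -/
theorem ricci_identity (he : e ∈ IsManifold.maximalAtlas (𝓡 4) ∞ M) (hW : IsOpen W)
    (hWe : W ⊆ e.source) (hp : p ∈ W) {x : Fin 4 → M → ℝ} (hx : ∀ a, SmoothOn W (x a))
    (m a b : Fin 4) :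
    g.covD2 e (g.covD1 e x) m a b p - g.covD2 e (g.covD1 e x) a m b p =
      - ∑ n, g.riemannUp e p n b m a * x n p := by
  have hpe := hWe hp
  have dx : ∀ n, DiffAt e p (x n) := fun n ↦ SmoothOn.diffAt he (hx n) hW hp hpe
  have dpx : ∀ i n, DiffAt e p (pd e i (x n)) := fun i n ↦
    SmoothOn.diffAt he (SmoothOn.pd he (hx n) hW hWe i) hW hp hpe
  have dG : ∀ k i j, DiffAt e p (fun q ↦ g.christoffel e q k i j) := fun k i j ↦
    SmoothOn.diffAt he (g.smoothOn_christoffel he k i j) e.open_source hpe hpe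
  have hpd : ∀ m a, pd e m (g.covD1 e x a b) p = pd e m (pd e a (x b)) p
      - ∑ n, (g.christoffel e p n a b * pd e m (x n) p
        + pd e m (fun q ↦ g.christoffel e q n a b) p * x n p) := by
    intro m a
    unfold covD1
    rw [pd_sub (dpx a b) (DiffAt.sum fun n _ ↦ (dG n a b).mul (dx n)),
      pd_sum fun n _ ↦ (dG n a b).mul (dx n)]
    congr 1
    exact Finset.sum_congr rfl fun n _ ↦ pd_mul hpe (dG n a b) (dx n) m
  have hc := pd_comm he (hx b) hW hp hpe m a
  have hs : ∑ n, g.christoffel e p n m a * g.covD1 e x n b p =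
      ∑ n, g.christoffel e p n a m * g.covD1 e x n b p :=
    Finset.sum_congr rfl fun n _ ↦ by rw [g.christoffel_symm n m a]
  have hq : ∀ m a, ∑ n, g.christoffel e p n m b * g.covD1 e x a n p =
      ∑ n, g.christoffel e p n m b * pd e a (x n) p
      - ∑ n, (∑ k, g.christoffel e p n a k * g.christoffel e p k m b) * x n p := by
    intro m a
    simp only [covD1, mul_sub, Finset.sum_sub_distrib, Finset.mul_sum, Finset.sum_mul]
    congr 1
    rw [Finset.sum_comm]
    exact Finset.sum_congr rfl fun _ _ ↦ Finset.sum_congr rfl fun _ _ ↦ by ring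
  have hR : ∑ n, g.riemannUp e p n b m a * x n p =
      ∑ n, pd e m (fun q ↦ g.christoffel e q n a b) p * x n p
      - ∑ n, pd e a (fun q ↦ g.christoffel e q n m b) p * x n p
      + (∑ n, (∑ k, g.christoffel e p n m k * g.christoffel e p k a b) * x n p
      - ∑ n, (∑ k, g.christoffel e p n a k * g.christoffel e p k m b) * x n p) := by
    rw [← Finset.sum_sub_distrib, ← Finset.sum_sub_distrib, ← Finset.sum_add_distrib]
    refine Finset.sum_congr rfl fun n _ ↦ ?_
    rw [riemannUp, Finset.sum_sub_distrib]
    ring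
  unfold covD2
  rw [hpd, hpd, hc, hs, hq, hq, hR, Finset.sum_add_distrib, Finset.sum_add_distrib]
  ring

end RicciIdentity

/-! ### Killing fields and the derivative of `F`. -/

section Killing

variable {M : Type*} [TopologicalSpace M] [ChartedSpace E4 M] [IsManifold (𝓡 4) ∞ M]
  (g : LorentzMetric M) (T : ∀ p : M, TangentSpace (𝓡 4) p)
  {e : OpenPartialHomeomorph M E4} {p : M}

/-- The covariant components `T_a` of a vector field. -/
noncomputable def lower (e : OpenPartialHomeomorph M E4) (a : Fin 4) (p : M) : ℝ :=
  g.inner p (frame e p a) (T p)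

theorem F_eq_covD1 (a b : Fin 4) : g.F T e p a b = g.covD1 e (g.lower T e) a b p := by
  simp only [F, covD, covD1, flat, Fin.tail]
  simp
  rfl

theorem lower_eq_sum (he : e ∈ IsManifold.maximalAtlas (𝓡 4) ∞ M) (hp : p ∈ e.source)
    (a : Fin 4) : g.lower T e a p = ∑ l, g.lo e p a l * coframe e p l (T p) := by
  unfold lower
  conv_lhs => rw [← sum_coframe_smul_frame he hp (T p)]
  simp [lo, mul_comm]

/-- The components of `T` are the fibre coordinates of the tangent map of the chart along the
section `T`; smoothness as a section of the tangent bundle enters here. -/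
theorem smoothOn_coframe {T : ∀ p : M, TangentSpace (𝓡 4) p}
    (hT : ContMDiff (𝓡 4) (𝓡 4).tangent ∞ (fun p ↦ (⟨p, T p⟩ : TangentBundle (𝓡 4) M)))
    (he : e ∈ IsManifold.maximalAtlas (𝓡 4) ∞ M) (a : Fin 4) :
    SmoothOn e.source (fun p ↦ coframe e p a (T p)) := by
  intro q hq
  have h1 := (contMDiffOn_of_mem_maximalAtlas he)
  have h2 := h1.contMDiffOn_tangentMapWithin (m := ∞) (by simp) e.open_source.uniqueMDiffOn
  have h3 : ContMDiffOn (𝓡 4) (𝓡 4).tangent ∞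
      (fun p ↦ tangentMapWithin (𝓡 4) (𝓡 4) e e.source ⟨p, T p⟩) e.source :=
    h2.comp hT.contMDiffOn (fun x hx ↦ hx)
  have h4 := (contMDiff_snd_tangentBundle_modelSpace E4 (𝓡 4) (n := ∞)).comp_contMDiffOn h3
  have h5 : SmoothOn e.source (fun p ↦
      (show E4 from (tangentMapWithin (𝓡 4) (𝓡 4) e e.source ⟨p, T p⟩).2) a) :=
    (EuclideanSpace.proj (𝕜 := ℝ) a).contMDiff.comp_contMDiffOn h4
  refine h5.congr (fun x hx ↦ ?_) q hq
  simp only [tangentMapWithin]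
  rw [mfderivWithin_of_isOpen e.open_source hx]
  rfl

variable {T}

theorem smoothOn_lower (hT : g.IsKilling T) (he : e ∈ IsManifold.maximalAtlas (𝓡 4) ∞ M)
    (a : Fin 4) : SmoothOn e.source (g.lower T e a) :=
  (SmoothOn.sum (s := Finset.univ) fun l _ ↦
    SmoothOn.mul (g.smoothOn_lo he a l) (smoothOn_coframe hT.1 he l)).congr
      fun _ hq ↦ g.lower_eq_sum T he hq a

theorem smoothOn_F (hT : g.IsKilling T) (he : e ∈ IsManifold.maximalAtlas (𝓡 4) ∞ M)
    (a b : Fin 4) : SmoothOn e.source (fun p ↦ g.F T e p a b) := by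
  simp only [F_eq_covD1]
  exact g.smoothOn_covD1 he e.open_source le_rfl (g.smoothOn_lower hT he) a b

theorem F_antisymm (hT : g.IsKilling T) (he : e ∈ IsManifold.maximalAtlas (𝓡 4) ∞ M)
    (hp : p ∈ e.source) (a b : Fin 4) : g.F T e p a b = - g.F T e p b a := by
  linarith [hT.2 e he p hp a b]

/-- `D_m F_{ab} = R_{lmab} T^l` for a Killing field. -/
theorem covD2_F (hT : g.IsKilling T) (he : e ∈ IsManifold.maximalAtlas (𝓡 4) ∞ M)
    (hp : p ∈ e.source) (m a b : Fin 4) :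
    g.covD2 e (fun a b q ↦ g.F T e q a b) m a b p =
      ∑ l, g.riemann e p l m a b * coframe e p l (T p) := by
  have hF : (fun a b q ↦ g.F T e q a b) = g.covD1 e (g.lower T e) := by
    ext a b q; exact g.F_eq_covD1 T a b
  have hanti : ∀ m a b, g.covD2 e (fun a b q ↦ g.F T e q a b) m a b p =
      - g.covD2 e (fun a b q ↦ g.F T e q a b) m b a p := by
    intro m a b
    have h1 : pd e m (fun q ↦ g.F T e q a b) p = - pd e m (fun q ↦ g.F T e q b a) p := by
      rw [← pd_neg]
      exact pd_congr_of_eqOn e.open_source hp hp (fun q hq ↦ g.F_antisymm hT he hq a b) m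
    have h2 : ∀ c d : Fin 4, ∑ n, g.christoffel e p n m c * g.F T e p n d =
        - ∑ n, g.christoffel e p n m c * g.F T e p d n := by
      intro c d
      rw [← Finset.sum_neg_distrib]
      exact Finset.sum_congr rfl fun n _ ↦ by rw [g.F_antisymm hT he hp n d]; ring
    unfold covD2
    rw [h1, h2, h2]
    ring
  have hR : ∀ m a b, ∑ n, g.riemannUp e p n b m a * g.lower T e n p =
      ∑ l, g.riemann e p l b m a * coframe e p l (T p) := by
    intro m a b
    simp only [g.lower_eq_sum T he hp, riemann, Finset.mul_sum, Finset.sum_mul]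
    rw [Finset.sum_comm]
    exact Finset.sum_congr rfl fun l _ ↦ Finset.sum_congr rfl fun n _ ↦ by
      rw [g.lo_symm l n]; ring
  have hI : ∀ m a b, g.covD2 e (fun a b q ↦ g.F T e q a b) m a b p
      - g.covD2 e (fun a b q ↦ g.F T e q a b) a m b p =
      - ∑ l, g.riemann e p l b m a * coframe e p l (T p) := by
    intro m a b
    rw [← hR, hF]
    exact g.ricci_identity he e.open_source le_rfl hp (g.smoothOn_lower hT he) m a b
  have hcyc : ∑ l, g.riemann e p l b m a * coframe e p l (T p)
      + ∑ l, g.riemann e p l m a b * coframe e p l (T p)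
      + ∑ l, g.riemann e p l a b m * coframe e p l (T p) = 0 := by
    rw [← Finset.sum_add_distrib, ← Finset.sum_add_distrib]
    refine Finset.sum_eq_zero fun l _ ↦ ?_
    rw [← add_mul, ← add_mul, g.riemann_cyclic_right, zero_mul]
  have hsw : ∑ l, g.riemann e p l m b a * coframe e p l (T p) =
      - ∑ l, g.riemann e p l m a b * coframe e p l (T p) := by
    rw [← Finset.sum_neg_distrib]
    exact Finset.sum_congr rfl fun l _ ↦ by rw [g.riemann_swap_right l m a b]; ring
  -- Kostant's argument: the Ricci identity in the three cyclic positions, the antisymmetry of `DF`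
  -- in its last pair and the cyclic identity of the curvature determine `DF`, much as the
  -- derivatives of a metric determine its Christoffel symbols.
  linarith [hI m a b, hI a b m, hI b m a, hanti m a b, hanti a m b, hanti b m a, hanti a b m,
    hanti m b a]

end Killing

/-! ### The dual curvature in vacuum. -/

section Dual

variable {M : Type*} [TopologicalSpace M] [ChartedSpace E4 M] [IsManifold (𝓡 4) ∞ M]
  {g : LorentzMetric M} (ε : g.VolumeForm) {e : OpenPartialHomeomorph M E4} {p : M}

theorem sum_epsMixed (he : e ∈ IsManifold.maximalAtlas (𝓡 4) ∞ M) (hp : p ∈ e.source)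
    {A : Matrix (Fin 4) (Fin 4) ℝ} (hA : IsAlt A) (a b : Fin 4) :
    1 / 2 * ∑ m, ∑ n, g.epsMixed ε e p a b m n * A m n =
      hodge (ε.vol e p) (g.upMat e p) A a b := by
  have h1 := flatDual_apply_eq_sum (isAlt_conj (g.upMat_transpose (e := e) (p := p)) hA) a b
  rw [hodge, Matrix.smul_apply, h1, smul_eq_mul]
  have h2 : ∀ r s, (g.upMat e p * A * g.upMat e p) r s =
      ∑ m, ∑ n, g.up e p r m * A m n * g.up e p s n := by
    intro r s
    simp only [Matrix.mul_apply, Finset.sum_mul, upMat, Matrix.of_apply]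
    rw [Finset.sum_comm]
    exact Finset.sum_congr rfl fun _ _ ↦ Finset.sum_congr rfl fun n _ ↦ by rw [g.up_symm n s]
  simp only [h2, epsMixed, comp_eq_vol_mul_lc ε he hp, Finset.mul_sum, Finset.sum_mul]
  rw [sum_sum_comm]
  exact Finset.sum_congr rfl fun _ _ ↦ Finset.sum_congr rfl fun _ _ ↦
    Finset.sum_congr rfl fun _ _ ↦ Finset.sum_congr rfl fun _ _ ↦ by ring

/-- The right dual `½ R_{abmn} ∈_{cd}^{mn}` of the curvature, as a matrix in the last two
indices. -/
noncomputable def dualCurv (e : OpenPartialHomeomorph M E4) (p : M) (a b : Fin 4) :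
    Matrix (Fin 4) (Fin 4) ℝ :=
  hodge (ε.vol e p) (g.upMat e p) (Matrix.of fun c d ↦ g.riemann e p a b c d)

theorem isAlt_riemann_right (a b : Fin 4) : IsAlt (Matrix.of fun c d ↦ g.riemann e p a b c d) :=
  ⟨fun i ↦ by have := g.riemann_swap_right (e := e) (p := p) a b i i; simp; linarith,
    fun i j ↦ g.riemann_swap_right a b j i⟩

theorem sum_up_mul_riemann (hvac : g.IsVacuum) (he : e ∈ IsManifold.maximalAtlas (𝓡 4) ∞ M)
    (hp : p ∈ e.source) (m d : Fin 4) : ∑ n, ∑ s, g.up e p n s * g.riemann e p m n s d = 0 := by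
  have h1 : ∀ s, ∑ n, g.up e p n s * g.riemann e p m n s d = - g.riemannUp e p s m s d := by
    intro s
    have h2 : ∀ n, g.up e p n s * g.riemann e p m n s d =
        - (g.upMat e p s n * (g.loMat e p * g.curv e s d p) n m) := by
      intro n
      rw [loMat_mul_curv_apply, g.riemann_swap_left he hp, g.up_symm n s]
      simp [upMat]
    simp only [h2, Finset.sum_neg_distrib]
    rw [← Matrix.mul_apply, ← mul_assoc, g.upMat_mul_loMat he hp, one_mul]
    rfl
  rw [Finset.sum_comm]
  simp only [h1, Finset.sum_neg_distrib]
  rw [show ∑ s, g.riemannUp e p s m s d = 0 from hvac e he p hp m d, neg_zero]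

theorem riemann_left_eq_right (he : e ∈ IsManifold.maximalAtlas (𝓡 4) ∞ M) (hp : p ∈ e.source)
    (c d : Fin 4) : (Matrix.of fun m n ↦ g.riemann e p m n c d) =
      Matrix.of fun m n ↦ g.riemann e p c d m n := by
  ext m n; exact g.riemann_pair_symm he hp m n c d

/-- By `flatDual_cyclic` the cyclic sum of the duals is a contraction of the curvature, namely a
Ricci component, and so vanishes in vacuum. -/
theorem dualCurv_cyclic_left (hvac : g.IsVacuum) (he : e ∈ IsManifold.maximalAtlas (𝓡 4) ∞ M)
    (hp : p ∈ e.source) (a b c d : Fin 4) :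
    dualCurv ε e p c d a b + dualCurv ε e p b d c a + dualCurv ε e p a d b c = 0 := by
  have hP : ∀ s, IsAlt (g.upMat e p * (Matrix.of fun m n ↦ g.riemann e p s d m n) *
      g.upMat e p) := fun s ↦ isAlt_conj g.upMat_transpose (isAlt_riemann_right _ _)
  have h := flatDual_cyclic hP a b c
  have hz : ∀ r, ∑ s, (g.upMat e p * (Matrix.of fun m n ↦ g.riemann e p s d m n) *
      g.upMat e p) r s = 0 := by
    intro r
    have : ∀ s, (g.upMat e p * (Matrix.of fun m n ↦ g.riemann e p s d m n) * g.upMat e p) r s =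
        ∑ m, g.up e p r m * ∑ n, g.up e p n s * g.riemann e p m n s d := by
      intro s
      rw [mul_assoc]
      simp only [Matrix.mul_apply, upMat, Matrix.of_apply]
      exact Finset.sum_congr rfl fun m _ ↦ by
        congr 1; exact Finset.sum_congr rfl fun n _ ↦ by
          rw [g.riemann_pair_symm he hp m n s d, mul_comm]
    simp only [this]
    rw [Finset.sum_comm]
    refine Finset.sum_eq_zero fun m _ ↦ ?_
    rw [← Finset.mul_sum, Finset.sum_comm, sum_up_mul_riemann hvac he hp, mul_zero]
  simp only [hz, mul_zero, Finset.sum_const_zero, neg_zero] at h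
  simp only [dualCurv, hodge, Matrix.smul_apply, ← smul_add, h, smul_zero]

theorem isAlt_dualCurv (a b : Fin 4) : IsAlt (dualCurv ε e p a b) := isAlt_hodge _ _ _

theorem dualCurv_swap_left (he : e ∈ IsManifold.maximalAtlas (𝓡 4) ∞ M) (hp : p ∈ e.source)
    (a b c d : Fin 4) : dualCurv ε e p b a c d = - dualCurv ε e p a b c d := by
  simp only [dualCurv]
  rw [← Matrix.neg_apply, ← hodge_neg]
  congr 2
  ext m n
  exact g.riemann_swap_left he hp a b m n

/-- In vacuum the right dual has all the algebraic symmetries that force pair symmetry. This makes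
left and right duals equal. -/
theorem dualCurv_pair_symm (hvac : g.IsVacuum) (he : e ∈ IsManifold.maximalAtlas (𝓡 4) ∞ M)
    (hp : p ∈ e.source) (a b c d : Fin 4) : dualCurv ε e p a b c d = dualCurv ε e p c d a b := by
  -- The available cyclic identity permutes the first index with the last pair; reversing both pairs
  -- makes the fixed index come first, as the general lemma requires.
  have h := pair_symm_of_cyclic (X := fun a b c d ↦ dualCurv ε e p b a d c)
    (fun a b c d ↦ dualCurv_swap_left ε he hp _ _ _ _)
    (fun a b c d ↦ (isAlt_dualCurv ε _ _).anti _ _)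
    (fun a b c d ↦ by
      have h1 := dualCurv_cyclic_left ε hvac he hp c d b a
      have h2 := fun x y z ↦ dualCurv_swap_left ε he hp a x y z
      have h3 := fun x y z ↦ (isAlt_dualCurv ε (e := e) (p := p) x a).anti y z
      linarith [h3 b c d, h3 c d b, h3 d b c]) b a d c
  exact h

theorem dualCurv_cyclic (hvac : g.IsVacuum) (he : e ∈ IsManifold.maximalAtlas (𝓡 4) ∞ M)
    (hp : p ∈ e.source) (a b c d : Fin 4) :
    dualCurv ε e p a b c d + dualCurv ε e p a c d b + dualCurv ε e p a d b c = 0 := by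
  have h1 := dualCurv_cyclic_left ε hvac he hp c d b a
  have h2 := fun x y z ↦ dualCurv_swap_left ε he hp a x y z
  linarith [h2 b c d, h2 c d b, h2 d b c]

/-- In vacuum the left dual of the curvature coincides with its right dual. -/
theorem left_dual_eq_right_dual (hvac : g.IsVacuum)
    (he : e ∈ IsManifold.maximalAtlas (𝓡 4) ∞ M) (hp : p ∈ e.source) (a b c d : Fin 4) :
    hodge (ε.vol e p) (g.upMat e p) (Matrix.of fun m n ↦ g.riemann e p m n c d) a b =
      dualCurv ε e p a b c d := by
  rw [riemann_left_eq_right he hp, dualCurv_pair_symm ε hvac he hp]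
  rfl

end Dual

end LorentzMetric

namespace Spacetime

/-! ### Complex two-forms, self-dual parts and their scalar product. -/

section Complexify

/-- Real matrices as complex matrices. -/
noncomputable abbrev cx : Matrix (Fin 4) (Fin 4) ℝ →+* Matrix (Fin 4) (Fin 4) ℂ :=
  Complex.ofRealHom.mapMatrix

theorem cx_apply (X : Matrix (Fin 4) (Fin 4) ℝ) (i j : Fin 4) : cx X i j = (X i j : ℂ) := rfl

theorem cx_transpose (X : Matrix (Fin 4) (Fin 4) ℝ) : (cx X).transpose = cx X.transpose := rfl

theorem cx_smul (c : ℝ) (X : Matrix (Fin 4) (Fin 4) ℝ) : cx (c • X) = (c : ℂ) • cx X := by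
  ext i j; simp

theorem cx_flatDual (X : Matrix (Fin 4) (Fin 4) ℝ) : cx (flatDual X) = flatDual (cx X) := by
  ext i j
  fin_cases i <;> fin_cases j <;> simp [flatDual]

theorem cx_hodge (w : ℝ) (h X : Matrix (Fin 4) (Fin 4) ℝ) :
    cx (hodge w h X) = hodge (w : ℂ) (cx h) (cx X) := by
  rw [hodge, cx_smul, cx_flatDual, map_mul, map_mul, hodge]

theorem IsAlt.cx {X : Matrix (Fin 4) (Fin 4) ℝ} (h : IsAlt X) : IsAlt (Spacetime.cx X) :=
  ⟨fun i ↦ by simp [h.diag i], fun i j ↦ by simp [h.anti i j]⟩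

theorem cx_trace (X : Matrix (Fin 4) (Fin 4) ℝ) : (cx X).trace = (X.trace : ℂ) := by
  simp [Matrix.trace]

theorem cx_det (X : Matrix (Fin 4) (Fin 4) ℝ) : (cx X).det = (X.det : ℂ) :=
  (RingHom.map_det Complex.ofRealHom X).symm

theorem IsAlt.add {R : Type*} [CommRing R] {A B : Matrix (Fin 4) (Fin 4) R} (hA : IsAlt A)
    (hB : IsAlt B) : IsAlt (A + B) :=
  ⟨fun i ↦ by simp [hA.diag, hB.diag], fun i j ↦ by
    simp only [Matrix.add_apply, hA.anti i j, hB.anti i j]; ring⟩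

theorem IsAlt.smul {R : Type*} [CommRing R] {A : Matrix (Fin 4) (Fin 4) R} (c : R)
    (hA : IsAlt A) : IsAlt (c • A) :=
  ⟨fun i ↦ by simp [hA.diag], fun i j ↦ by
    simp only [Matrix.smul_apply, hA.anti i j, smul_eq_mul]; ring⟩

/-- Twice the self-dual part of a complex two-form. -/
noncomputable def selfDual (w : ℂ) (h A : Matrix (Fin 4) (Fin 4) ℂ) : Matrix (Fin 4) (Fin 4) ℂ :=
  A + Complex.I • hodge w h A

variable {w : ℂ} {h A B : Matrix (Fin 4) (Fin 4) ℂ}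

theorem isAlt_selfDual (hA : IsAlt A) : IsAlt (selfDual w h A) :=
  hA.add ((isAlt_hodge w h A).smul _)

/-- Since `⋆⋆ = -1`, the operator `i⋆` is an involution, and `A + i⋆A` is fixed by it. -/
theorem selfDual_eq_hodge (hh : h.transpose = h) (hw : w ^ 2 * h.det = -1) (hA : IsAlt A) :
    selfDual w h A = Complex.I • hodge w h (selfDual w h A) := by
  rw [selfDual, hodge_add, hodge_smul, hodge_hodge hh hw hA, smul_add, smul_smul, Complex.I_mul_I,
    smul_neg, neg_smul, one_smul, neg_neg, add_comm]

theorem selfDual_add : selfDual w h (A + B) = selfDual w h A + selfDual w h B := by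
  simp only [selfDual, hodge_add, smul_add]; abel

theorem selfDual_smul (c : ℂ) : selfDual w h (c • A) = c • selfDual w h A := by
  simp only [selfDual, hodge_smul, smul_add, smul_comm c Complex.I]

theorem selfDual_zero : selfDual w h 0 = 0 := by
  simp [selfDual, hodge_zero]

theorem selfDual_sum {ι : Type*} (s : Finset ι) (A : ι → Matrix (Fin 4) (Fin 4) ℂ) :
    selfDual w h (∑ i ∈ s, A i) = ∑ i ∈ s, selfDual w h (A i) := by
  simp only [selfDual, hodge_sum, Finset.smul_sum, Finset.sum_add_distrib]

theorem selfDual_neg : selfDual w h (-A) = - selfDual w h A := by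
  simpa using selfDual_smul (w := w) (h := h) (A := A) (-1)

theorem selfDual_sub : selfDual w h (A - B) = selfDual w h A - selfDual w h B := by
  rw [sub_eq_add_neg, selfDual_add, selfDual_neg, ← sub_eq_add_neg]

/-- The scalar product `A_{ab} B^{ab}` of two-forms. -/
noncomputable def formInner (h A B : Matrix (Fin 4) (Fin 4) ℂ) : ℂ := - (A * h * B * h).trace

theorem formInner_comm : formInner h A B = formInner h B A := by
  unfold formInner
  rw [mul_assoc (A * h), Matrix.trace_mul_comm, ← mul_assoc]

theorem formInner_eq_sum (hh : h.transpose = h) (hB : IsAlt B) : formInner h A B =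
    ∑ a, ∑ b, A a b * (h * B * h) a b := by
  have h1 := isAlt_conj hh hB
  unfold formInner
  rw [mul_assoc, mul_assoc, ← mul_assoc h, Matrix.trace, ← Finset.sum_neg_distrib]
  refine Finset.sum_congr rfl fun a _ ↦ ?_
  rw [Matrix.diag_apply, Matrix.mul_apply, ← Finset.sum_neg_distrib]
  exact Finset.sum_congr rfl fun b _ ↦ by rw [h1.anti a b]; ring

theorem trace_flatDual_mul_comm (hA : IsAlt A) (hB : IsAlt B) :
    (flatDual A * B).trace = (A * flatDual B).trace := by
  obtain ⟨h1, h2, h3, h4, h5, h6, h7⟩ := hA.entries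
  obtain ⟨k1, k2, k3, k4, k5, k6, k7⟩ := hB.entries
  simp only [Matrix.trace, Matrix.diag_apply, Matrix.mul_apply, Fin.sum_univ_four]
  simp [flatDual, h1, h2, h3, h4, h5, h6, h7, k1, k2, k3, k4, k5, k6, k7]
  ring

theorem formInner_hodge (hh : h.transpose = h) (hA : IsAlt A) (hB : IsAlt B) :
    formInner h (hodge w h A) B = formInner h A (hodge w h B) := by
  have h1 := trace_flatDual_mul_comm (isAlt_conj hh hA) (isAlt_conj hh hB)
  have e1 : (hodge w h A * h * B * h).trace = w * (flatDual (h * A * h) * (h * B * h)).trace := by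
    rw [hodge]
    simp only [Matrix.smul_mul, Matrix.trace_smul, smul_eq_mul, mul_assoc]
  have e2 : (A * h * hodge w h B * h).trace = w * ((h * A * h) * flatDual (h * B * h)).trace := by
    rw [hodge, Matrix.trace_mul_comm]
    simp only [Matrix.mul_smul, Matrix.trace_smul, smul_eq_mul, mul_assoc]
  rw [formInner, formInner, e1, e2, h1]

/-- The dual is symmetric for the scalar product, so it moves onto `B`, where `i⋆` acts as the
identity. -/
theorem formInner_selfDual (hh : h.transpose = h) (hA : IsAlt A) (hB : IsAlt B)
    (sB : B = Complex.I • hodge w h B) : formInner h (selfDual w h A) B = 2 * formInner h A B := by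
  have e1 : formInner h (selfDual w h A) B = formInner h A B
      + Complex.I * formInner h (hodge w h A) B := by
    simp only [formInner, selfDual, add_mul, Matrix.trace_add, Matrix.smul_mul, Matrix.trace_smul,
      smul_eq_mul]
    ring
  have e2 : formInner h A (Complex.I • hodge w h B) = Complex.I * formInner h A (hodge w h B) := by
    simp only [formInner, Matrix.smul_mul, Matrix.mul_smul, Matrix.trace_smul, smul_eq_mul]
    ring
  rw [e1, formInner_hodge hh hA hB, ← e2, ← sB]
  ring

/-- The two-form `g_a ∧ g_b`, where `g_a` is the `a`-th row of `g`. -/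
def rowWedge {R : Type*} [CommRing R] (g : Matrix (Fin 4) (Fin 4) R) (a b : Fin 4) :
    Matrix (Fin 4) (Fin 4) R :=
  Matrix.of fun m n ↦ g a m * g b n - g a n * g b m

theorem isAlt_rowWedge {R : Type*} [CommRing R] (g : Matrix (Fin 4) (Fin 4) R) (a b : Fin 4) :
    IsAlt (rowWedge g a b) :=
  ⟨fun i ↦ by simp [rowWedge], fun i j ↦ by simp [rowWedge]⟩

theorem flatDual_rowWedge_one : ∀ a b c d : Fin 4,
    @Eq ℤ (flatDual (rowWedge (1 : Matrix (Fin 4) (Fin 4) ℤ) a b) c d) (lc a b c d) := by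
  intro a b c d
  revert a b
  fin_cases c <;> fin_cases d <;>
    simp [flatDual, rowWedge, Matrix.one_apply] <;> decide +kernel

theorem mul_rowWedge_mul {R : Type*} [CommRing R] {h g : Matrix (Fin 4) (Fin 4) R}
    (hh : h.transpose = h) (hg : g * h = 1) (a b : Fin 4) :
    h * rowWedge g a b * h = rowWedge 1 a b := by
  have hs : ∀ i j, h i j = h j i := fun i j ↦ congrFun (congrFun hh j) i
  ext m n
  simp only [Matrix.mul_apply, rowWedge, Matrix.of_apply, ← hg, Finset.sum_mul, Finset.mul_sum,
    ← Finset.sum_sub_distrib]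
  rw [Finset.sum_comm]
  rw [Finset.sum_congr rfl fun i _ ↦ Finset.sum_congr rfl fun j _ ↦
    show h m i * (g a i * g b j - g a j * g b i) * h j n =
      g a i * h i m * (g b j * h j n) - g a j * h j n * (g b i * h i m) by rw [hs m i]; ring]
  simp only [Finset.sum_sub_distrib]
  congr 1
  rw [Finset.sum_comm]

theorem hodge_rowWedge {R : Type*} [CommRing R] {w : R} {h g : Matrix (Fin 4) (Fin 4) R}
    (hh : h.transpose = h) (hg : g * h = 1) (a b c d : Fin 4) :
    hodge w h (rowWedge g a b) c d = w * lc a b c d := by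
  rw [hodge, mul_rowWedge_mul hh hg, Matrix.smul_apply, smul_eq_mul, ← flatDual_rowWedge_one]
  congr 1
  fin_cases c <;> fin_cases d <;> simp [flatDual, rowWedge, Matrix.one_apply]

/-- Raising the indices of `g_a ∧ g_b` gives a coordinate bivector; the `2` counts the two orders of
the index pair. -/
theorem formInner_rowWedge {g : Matrix (Fin 4) (Fin 4) ℂ} (hh : h.transpose = h) (hg : g * h = 1)
    (hB : IsAlt B) (a b : Fin 4) : formInner h (rowWedge g a b) B = 2 * B a b := by
  rw [formInner_comm]
  have : formInner h B (rowWedge g a b) = ∑ c, ∑ d, B c d * rowWedge 1 a b c d := by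
    rw [formInner_eq_sum hh (isAlt_rowWedge g a b), mul_rowWedge_mul hh hg]
  rw [this]
  simp only [rowWedge, Matrix.of_apply, mul_sub, Finset.sum_sub_distrib, Matrix.one_apply]
  simp
  rw [hB.anti b a]
  ring

end Complexify

end Spacetime

namespace LorentzMetric

/-! ### Covariant derivatives of complex tensors commute with duality. -/

section ComplexFields

variable {M : Type*} [TopologicalSpace M] [ChartedSpace E4 M] [IsManifold (𝓡 4) ∞ M]
  {g : LorentzMetric M} (ε : g.VolumeForm) {e : OpenPartialHomeomorph M E4} {p : M}

theorem cx_upMat_transpose : (cx (g.upMat e p)).transpose = cx (g.upMat e p) := by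
  rw [cx_transpose, g.upMat_transpose]

theorem vol_sq_mul_det_cx (he : e ∈ IsManifold.maximalAtlas (𝓡 4) ∞ M) (hp : p ∈ e.source) :
    (ε.vol e p : ℂ) ^ 2 * (cx (g.upMat e p)).det = -1 := by
  rw [cx_det]
  exact_mod_cast vol_sq_mul_det ε he hp

variable (g) in
/-- The covariant derivative of a complex two-tensor. -/
noncomputable def nab2 (e : OpenPartialHomeomorph M E4) (m : Fin 4)
    (X : M → Matrix (Fin 4) (Fin 4) ℂ) (p : M) : Matrix (Fin 4) (Fin 4) ℂ :=
  pdMat e m X p - (cx (g.conn e m p)).transpose * X p - X p * cx (g.conn e m p)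

variable (g) in
/-- The covariant derivative of a complex four-tensor, as a matrix in the last two indices. -/
noncomputable def nab4 (e : OpenPartialHomeomorph M E4) (m : Fin 4)
    (X : M → Fin 4 → Fin 4 → Matrix (Fin 4) (Fin 4) ℂ) (p : M) (a b : Fin 4) :
    Matrix (Fin 4) (Fin 4) ℂ :=
  g.nab2 e m (fun q ↦ X q a b) p - ∑ n, (g.christoffel e p n m a : ℂ) • X p n b
    - ∑ n, (g.christoffel e p n m b : ℂ) • X p a n

theorem _root_.Spacetime.MatDiffAt.cx {X : M → Matrix (Fin 4) (Fin 4) ℝ} (h : MatDiffAt e p X) :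
    MatDiffAt e p (fun q ↦ Spacetime.cx (X q)) := fun i j ↦ (h i j).ofReal

theorem _root_.Spacetime.MatDiffAt.smul {f : M → ℂ} {X : M → Matrix (Fin 4) (Fin 4) ℂ}
    (hf : DiffAt e p f) (h : MatDiffAt e p X) : MatDiffAt e p (fun q ↦ f q • X q) :=
  fun i j ↦ hf.mul (h i j)

theorem _root_.Spacetime.pdMat_cx {X : M → Matrix (Fin 4) (Fin 4) ℝ} (h : MatDiffAt e p X)
    (m : Fin 4) : pdMat e m (fun q ↦ Spacetime.cx (X q)) p = Spacetime.cx (pdMat e m X p) := by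
  ext i j
  exact pd_ofReal (h i j) m

theorem matDiffAt_hodge (he : e ∈ IsManifold.maximalAtlas (𝓡 4) ∞ M) (hp : p ∈ e.source)
    {X : M → Matrix (Fin 4) (Fin 4) ℂ} (hX : MatDiffAt e p X) :
    MatDiffAt e p (fun q ↦ hodge (ε.vol e q : ℂ) (cx (g.upMat e q)) (X q)) := by
  have hH := (g.matDiffAt_upMat he hp).cx
  have hv : DiffAt e p (fun q ↦ ε.vol e q) :=
    SmoothOn.diffAt he (smoothOn_vol ε he) e.open_source hp hp
  exact MatDiffAt.smul hv.ofReal (MatDiffAt.flatDual ((hH.mul hX).mul hH))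

/-- The metric and the volume form are parallel. In matrix terms the inverse metric contributes
connection terms inside the flat dual, the volume element contributes a trace, and
`trace_smul_flatDual_sub` combines them. -/
theorem nab2_hodge (he : e ∈ IsManifold.maximalAtlas (𝓡 4) ∞ M) (hp : p ∈ e.source)
    {X : M → Matrix (Fin 4) (Fin 4) ℂ} (hX : MatDiffAt e p X) (hA : IsAlt (X p)) (m : Fin 4) :
    g.nab2 e m (fun q ↦ hodge (ε.vol e q : ℂ) (cx (g.upMat e q)) (X q)) p =
      hodge (ε.vol e p : ℂ) (cx (g.upMat e p)) (g.nab2 e m X p) := by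
  have hH := (g.matDiffAt_upMat he hp).cx
  have hv : DiffAt e p (fun q ↦ ε.vol e q) :=
    SmoothOn.diffAt he (smoothOn_vol ε he) e.open_source hp hp
  have hh := cx_upMat_transpose (g := g) (e := e) (p := p)
  have hc := isAlt_conj hh hA
  have t := trace_smul_flatDual_sub (cx (g.conn e m p)) hc
  have d : pdMat e m (fun q ↦ hodge (ε.vol e q : ℂ) (cx (g.upMat e q)) (X q)) p =
      (ε.vol e p : ℂ) • flatDual (pdMat e m
        (fun q ↦ cx (g.upMat e q) * X q * cx (g.upMat e q)) p)
      + ((cx (g.conn e m p)).trace * (ε.vol e p : ℂ)) •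
        flatDual (cx (g.upMat e p) * X p * cx (g.upMat e p)) := by
    unfold hodge
    rw [pdMat_smul hp hv.ofReal (MatDiffAt.flatDual ((hH.mul hX).mul hH)), pdMat_flatDual,
      pd_ofReal hv, pd_vol ε he hp, cx_trace, Complex.ofReal_mul]
  have d2 : pdMat e m (fun q ↦ cx (g.upMat e q)) p =
      -(cx (g.conn e m p) * cx (g.upMat e p)
        + cx (g.upMat e p) * (cx (g.conn e m p)).transpose) := by
    rw [pdMat_cx (g.matDiffAt_upMat he hp), g.pdMat_upMat he hp, map_neg, map_add, map_mul,
      map_mul, cx_transpose]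
  rw [pdMat_mul hp (hH.mul hX) hH, pdMat_mul hp hH hX, d2] at d
  unfold nab2
  rw [d]
  set H := cx (g.upMat e p)
  set C := cx (g.conn e m p)
  set D := pdMat e m X p
  set w := (ε.vol e p : ℂ)
  have e1 : (-(C * H + H * C.transpose) * X p + H * D) * H + H * X p * -(C * H + H * C.transpose)
      = H * (D - C.transpose * X p - X p * C) * H
        - (C * (H * X p * H) + H * X p * H * C.transpose) := by
    noncomm_ring
  rw [e1, show H * (D - C.transpose * X p - X p * C) * H
        - (C * (H * X p * H) + H * X p * H * C.transpose) =
        H * (D - C.transpose * X p - X p * C) * H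
        + (-1 : ℂ) • (C * (H * X p * H) + H * X p * H * C.transpose) by
          rw [neg_one_smul, sub_eq_add_neg], flatDual_add, flatDual_smul]
  have t' : flatDual (C * (H * X p * H) + H * X p * H * C.transpose) =
      C.trace • flatDual (H * X p * H) - (C.transpose * flatDual (H * X p * H)
        + flatDual (H * X p * H) * C) := by
    rw [← t]; abel
  rw [t']
  simp only [hodge]
  generalize flatDual (H * X p * H) = Y
  generalize flatDual (H * (D - C.transpose * X p - X p * C) * H) = Z
  rw [Matrix.mul_smul, Matrix.smul_mul]
  module

theorem nab2_add {X Y : M → Matrix (Fin 4) (Fin 4) ℂ} (hX : MatDiffAt e p X)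
    (hY : MatDiffAt e p Y) (m : Fin 4) :
    g.nab2 e m (fun q ↦ X q + Y q) p = g.nab2 e m X p + g.nab2 e m Y p := by
  unfold nab2
  rw [pdMat_add hX hY]
  noncomm_ring

theorem nab2_smul (hp : p ∈ e.source) {f : M → ℂ} {X : M → Matrix (Fin 4) (Fin 4) ℂ}
    (hf : DiffAt e p f) (hX : MatDiffAt e p X) (m : Fin 4) :
    g.nab2 e m (fun q ↦ f q • X q) p = f p • g.nab2 e m X p + pd e m f p • X p := by
  unfold nab2
  rw [pdMat_smul hp hf hX, Matrix.mul_smul, Matrix.smul_mul]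
  module

theorem nab2_selfDual (he : e ∈ IsManifold.maximalAtlas (𝓡 4) ∞ M) (hp : p ∈ e.source)
    {X : M → Matrix (Fin 4) (Fin 4) ℂ} (hX : MatDiffAt e p X) (hA : IsAlt (X p)) (m : Fin 4) :
    g.nab2 e m (fun q ↦ selfDual (ε.vol e q : ℂ) (cx (g.upMat e q)) (X q)) p =
      selfDual (ε.vol e p : ℂ) (cx (g.upMat e p)) (g.nab2 e m X p) := by
  unfold selfDual
  have h := matDiffAt_hodge ε he hp hX
  rw [nab2_add hX (MatDiffAt.smul (DiffAt.const _) h), nab2_smul hp (DiffAt.const _) h,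
    nab2_hodge ε he hp hX hA, pd_const, zero_smul, add_zero]

theorem nab4_selfDual (he : e ∈ IsManifold.maximalAtlas (𝓡 4) ∞ M) (hp : p ∈ e.source)
    {X : M → Fin 4 → Fin 4 → Matrix (Fin 4) (Fin 4) ℂ}
    (hX : ∀ a b, MatDiffAt e p (fun q ↦ X q a b))
    (hA : ∀ a b, IsAlt (X p a b)) (m a b : Fin 4) :
    g.nab4 e m (fun q a b ↦ selfDual (ε.vol e q : ℂ) (cx (g.upMat e q)) (X q a b)) p a b =
      selfDual (ε.vol e p : ℂ) (cx (g.upMat e p)) (g.nab4 e m X p a b) := by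
  unfold nab4
  rw [nab2_selfDual ε he hp (hX a b) (hA a b), selfDual_sub, selfDual_sub, selfDual_sum,
    selfDual_sum]
  simp only [selfDual_smul]

end ComplexFields

end LorentzMetric

namespace Spacetime

/-! ### Algebra of self-dual two-forms. -/

section SelfDualAlgebra

variable {w : ℂ} {h g : Matrix (Fin 4) (Fin 4) ℂ}

/-- That the sum is a multiple of the metric is `mul_add_mul_of_selfDual`; the multiple is found by
taking a trace in dimension four. -/
theorem selfDual_mul_add_mul {A B : Matrix (Fin 4) (Fin 4) ℂ}
    (hh : h.transpose = h) (hg : h * g = 1) (hA : IsAlt A) (hB : IsAlt B)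
    (sA : A = Complex.I • hodge w h A) (sB : B = Complex.I • hodge w h B) :
    A * h * B + B * h * A = (-(1 / 2) * formInner h A B) • g := by
  obtain ⟨k, hk⟩ := mul_add_mul_of_selfDual hh hg hA hB sA sB
  have h1 := congrArg (fun X ↦ (X * h).trace) hk
  simp only [add_mul, Matrix.trace_add, Matrix.smul_mul, Matrix.trace_smul,
    mul_eq_one_comm.1 hg, Matrix.trace_one, smul_eq_mul] at h1
  have h2 : (B * h * A * h).trace = (A * h * B * h).trace := by
    rw [mul_assoc (B * h), Matrix.trace_mul_comm, ← mul_assoc]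
  rw [hk]
  congr 1
  rw [h2] at h1
  unfold formInner
  simp only [Fintype.card_fin] at h1
  push_cast at h1
  linear_combination (-1 / 4 : ℂ) * h1

/-- A counterpart of `dualCurv_cyclic_left`: by self-duality the cyclic sum is itself a cyclic sum
of duals, which `flatDual_cyclic` identifies with the dual of the trace. -/
theorem trace_eq_zero_of_cyclic {X : Fin 4 → Matrix (Fin 4) (Fin 4) ℂ}
    (hh : h.transpose = h) (hg : g * h = 1) (hw : w ≠ 0) (hX : ∀ s, IsAlt (X s))
    (sX : ∀ s, X s = Complex.I • hodge w h (X s))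
    (hc : ∀ a b c, X c a b + X b c a + X a b c = 0) (b : Fin 4) :
    ∑ s, ∑ n, h s n * X s n b = 0 := by
  set v : Fin 4 → ℂ := fun r ↦ ∑ s, (h * X s * h) r s with hv
  have h1 : ∀ a b c, ∑ r, (lc a b c r : ℂ) * v r = 0 := by
    intro a b c
    have h2 := flatDual_cyclic (fun s ↦ isAlt_conj hh (hX s)) a b c
    have h3 := hc a b c
    rw [sX a, sX b, sX c] at h3
    simp only [hodge, Matrix.smul_apply, ← smul_add] at h3
    rw [h2] at h3
    simp only [smul_eq_mul, mul_eq_zero, Complex.I_ne_zero, hw, neg_eq_zero, false_or] at h3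
    exact h3
  -- The triple of indices complementary to `r` isolates the component `v r`.
  have hv0 : ∀ r, v r = 0 := by
    intro r
    fin_cases r
    · simpa [lc, Fin.sum_univ_four, show Int.sign 2 = 1 from rfl, show Int.sign 3 = 1 from rfl]
        using h1 1 2 3
    · simpa [lc, Fin.sum_univ_four, show Int.sign 2 = 1 from rfl, show Int.sign 3 = 1 from rfl]
        using h1 0 2 3
    · simpa [lc, Fin.sum_univ_four, show Int.sign 2 = 1 from rfl, show Int.sign 3 = 1 from rfl]
        using h1 0 1 3
    · simpa [lc, Fin.sum_univ_four, show Int.sign 2 = 1 from rfl, show Int.sign 3 = 1 from rfl]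
        using h1 0 1 2
  have h4 : ∑ r, g b r * v r = ∑ s, (X s * h) b s := by
    simp only [hv, Finset.mul_sum]
    rw [Finset.sum_comm]
    refine Finset.sum_congr rfl fun s _ ↦ ?_
    rw [← Matrix.mul_apply, ← mul_assoc, ← mul_assoc, hg, one_mul]
  simp only [hv0, mul_zero, Finset.sum_const_zero] at h4
  have h5 : ∑ s, ∑ n, h s n * X s n b = - ∑ s, (X s * h) b s := by
    rw [← Finset.sum_neg_distrib]
    refine Finset.sum_congr rfl fun s _ ↦ ?_
    rw [Matrix.mul_apply, ← Finset.sum_neg_distrib]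
    refine Finset.sum_congr rfl fun n _ ↦ ?_
    rw [(hX s).anti n b, show h s n = h n s from congrFun (congrFun hh n) s]
    ring
  rw [h5, ← h4, neg_zero]

theorem formInner_add (A B C : Matrix (Fin 4) (Fin 4) ℂ) :
    formInner h (A + B) C = formInner h A C + formInner h B C := by
  simp only [formInner, add_mul, Matrix.trace_add]; ring

theorem formInner_smul (c : ℂ) (A C : Matrix (Fin 4) (Fin 4) ℂ) :
    formInner h (c • A) C = c * formInner h A C := by
  simp only [formInner, Matrix.smul_mul, Matrix.trace_smul, smul_eq_mul]; ring

theorem formInner_sum {ι : Type*} (s : Finset ι) (A : ι → Matrix (Fin 4) (Fin 4) ℂ)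
    (C : Matrix (Fin 4) (Fin 4) ℂ) :
    formInner h (∑ i ∈ s, A i) C = ∑ i ∈ s, formInner h (A i) C := by
  simp only [formInner, Finset.sum_mul, Matrix.trace_sum, Finset.sum_neg_distrib]

/-- The algebraic identity behind the divergence equation of the Mars–Simon tensor. -/
theorem marsSimon_algebra {f : Matrix (Fin 4) (Fin 4) ℂ} {t : Fin 4 → ℂ} {l φ : ℂ}
    {r i S : Fin 4 → Fin 4 → Matrix (Fin 4) (Fin 4) ℂ}
    (hS : ∀ a b, S a b = r a b + l • (f a b • f - (1 / 3 * φ) • i a b))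
    (hφ : φ = formInner h f f)
    (hr : ∀ a b, ∑ k, ∑ n, h k n * r a k n b = 0)
    (hi : ∀ a b, formInner h (i a b) f = f a b)
    (hf : f * h * f = (-(1 / 4) * φ) • g)
    (hJ : ∀ m n, f * h * i m n + i m n * h * f = (-(1 / 2) * f m n) • g)
    (hsymm : ∀ a b m n, i a b m n = i m n a b) (b : Fin 4) :
    ∑ k, ∑ n, h k n • ((l ^ 2 / 6 * (2 * ∑ a, t a * f a k)) • (f n b • f - (1 / 3 * φ) • i n b)
      + l • ((∑ a, t a • r a k) n b • f + f n b • (∑ a, t a • r a k)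
        - (1 / 3 * (2 * formInner h (∑ a, t a • r a k) f)) • i n b)) =
    l • ∑ k, ∑ n, ∑ a, (h k n * t a) • (f n b • S a k
      - (2 / 3 * formInner h (S a k) f) • i n b) := by
  ext m n'
  -- The factor is `1 - 1/3`: pairing with `f` sends `f a k • f` to `φ * f a k` and `i a k` to `f a
  -- k`.
  have hin : ∀ a k, formInner h (S a k) f = formInner h (r a k) f + l * (2 / 3 * φ * f a k) := by
    intro a k
    rw [hS, sub_eq_add_neg, ← neg_smul, formInner_add, formInner_smul, formInner_add,
      formInner_smul, formInner_smul, hi, ← hφ]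
    ring
  -- For fixed `a` this is the difference of the two sides. The terms quadratic in `l` contribute `φ
  -- f g` with coefficients `1/6` (from `hf`) and `-1/6` (from `hJ`); the term linear in `l` is a
  -- trace of `r`.
  have key : ∀ a, ∑ k, ∑ n, h k n * (l ^ 2 * (-(2 / 3) * f a k * f n b * f m n'
      + 1 / 3 * φ * (f a k * i n b m n' + i a k m n' * f n b)) + l * (r a k n b * f m n')) = 0 := by
    intro a
    have e1 : ∑ k, ∑ n, h k n * (f a k * f n b) = -(1 / 4) * φ * g a b := by
      have := congrFun (congrFun hf a) b
      rw [Matrix.smul_apply, smul_eq_mul] at this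
      rw [← this, Matrix.mul_apply, Finset.sum_comm]
      simp only [Matrix.mul_apply, Finset.sum_mul]
      exact Finset.sum_congr rfl fun _ _ ↦ Finset.sum_congr rfl fun _ _ ↦ by ring
    have e2 : ∑ k, ∑ n, h k n * (f a k * i n b m n' + i a k m n' * f n b) =
        -(1 / 2) * f m n' * g a b := by
      have := congrFun (congrFun (hJ m n') a) b
      rw [Matrix.smul_apply, smul_eq_mul] at this
      rw [← this, Matrix.add_apply, Matrix.mul_apply, Matrix.mul_apply, Finset.sum_comm,
        ← Finset.sum_add_distrib]
      simp only [Matrix.mul_apply, Finset.sum_mul]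
      refine Finset.sum_congr rfl fun n _ ↦ ?_
      rw [← Finset.sum_add_distrib]
      exact Finset.sum_congr rfl fun k _ ↦ by rw [hsymm n b, hsymm a k]; ring
    have e3 := hr a b
    calc _ = ∑ k, ∑ n, (l ^ 2 * (-(2 / 3)) * f m n' * (h k n * (f a k * f n b))
          + l ^ 2 * (1 / 3 * φ) * (h k n * (f a k * i n b m n' + i a k m n' * f n b))
          + l * f m n' * (h k n * r a k n b)) :=
          Finset.sum_congr rfl fun _ _ ↦ Finset.sum_congr rfl fun _ _ ↦ by ring
      _ = 0 := by
        simp only [Finset.sum_add_distrib, ← Finset.mul_sum]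
        rw [e1, e2, e3]
        ring
  have key2 : ∑ k, ∑ n, ∑ a, t a * (h k n * (l ^ 2 * (-(2 / 3) * f a k * f n b * f m n'
      + 1 / 3 * φ * (f a k * i n b m n' + i a k m n' * f n b)) + l * (r a k n b * f m n')))
      = 0 := by
    rw [Finset.sum_congr rfl fun k _ ↦ Finset.sum_comm, Finset.sum_comm]
    refine Finset.sum_eq_zero fun a _ ↦ ?_
    simp only [← Finset.mul_sum]
    rw [key, mul_zero]
  rw [← sub_eq_zero, ← key2]
  simp only [Matrix.sum_apply, Matrix.smul_apply, Matrix.add_apply, Matrix.sub_apply, smul_eq_mul,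
    formInner_sum, formInner_smul, Finset.mul_sum, Finset.sum_mul]
  rw [← Finset.sum_sub_distrib]
  refine Finset.sum_congr rfl fun k _ ↦ ?_
  rw [← Finset.sum_sub_distrib]
  refine Finset.sum_congr rfl fun n _ ↦ ?_
  have hSe : ∀ a k, S a k m n' = r a k m n' + l * (f a k * f m n' - 1 / 3 * φ * i a k m n') := by
    intro a k
    rw [hS]; simp
  -- The products of `f n b` with `r a k`, and of `i n b` with its pairing, are absorbed by the
  -- corresponding terms in `S`; the other occurrence of `r` survives as a trace.
  have e : ∀ a, h k n * ((l ^ 2 / 6 * (2 * (t a * f a k))) * (f n b * f m n' - 1 / 3 * φ * i n b m n')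
      + l * (t a * r a k n b * f m n' + f n b * (t a * r a k m n')
        - (1 / 3 * (2 * (t a * formInner h (r a k) f))) * i n b m n'))
      - l * (h k n * t a * (f n b * S a k m n' - 2 / 3 * formInner h (S a k) f * i n b m n')) =
      t a * (h k n * (l ^ 2 * (-(2 / 3) * f a k * f n b * f m n'
      + 1 / 3 * φ * (f a k * i n b m n' + i a k m n' * f n b)) + l * (r a k n b * f m n'))) := by
    intro a
    rw [hin, hSe]
    ring
  simp only [← e, Finset.sum_sub_distrib, ← Finset.mul_sum, Finset.sum_add_distrib,
    ← Finset.sum_mul]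

end SelfDualAlgebra

end Spacetime

namespace Spacetime

theorem lc_pair_symm : ∀ a b c d : Fin 4, lc a b c d = lc c d a b := by decide +kernel

end Spacetime

namespace LorentzMetric

/-! ### Algebra of `𝓕`, `𝓡` and `𝓘`. -/

section Fields

variable {M : Type*} [TopologicalSpace M] [ChartedSpace E4 M] [IsManifold (𝓡 4) ∞ M]
  {g : LorentzMetric M} (ε : g.VolumeForm) (T : ∀ p : M, TangentSpace (𝓡 4) p)
  {e : OpenPartialHomeomorph M E4} {p : M}

/-- Twice the self-dual part, with respect to the metric at the point `p`. -/
noncomputable abbrev sd (e : OpenPartialHomeomorph M E4) (p : M)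
    (A : Matrix (Fin 4) (Fin 4) ℂ) : Matrix (Fin 4) (Fin 4) ℂ :=
  selfDual (ε.vol e p : ℂ) (cx (g.upMat e p)) A

/-- The matrix of `F`. -/
noncomputable def FMat (g : LorentzMetric M) (T : ∀ p : M, TangentSpace (𝓡 4) p)
    (e : OpenPartialHomeomorph M E4) (p : M) : Matrix (Fin 4) (Fin 4) ℝ :=
  Matrix.of (g.F T e p)

/-- The matrix of the curvature in the last two indices. -/
noncomputable def riemMat (g : LorentzMetric M) (e : OpenPartialHomeomorph M E4) (p : M)
    (a b : Fin 4) : Matrix (Fin 4) (Fin 4) ℝ :=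
  Matrix.of fun c d ↦ g.riemann e p a b c d

/-- The matrix of `𝓕`. -/
noncomputable def fMat (e : OpenPartialHomeomorph M E4) (p : M) : Matrix (Fin 4) (Fin 4) ℂ :=
  Matrix.of (g.FF T ε e p)

/-- The matrix of `𝓡` in the last two indices. -/
noncomputable def rMat (e : OpenPartialHomeomorph M E4) (p : M) (a b : Fin 4) :
    Matrix (Fin 4) (Fin 4) ℂ :=
  Matrix.of fun c d ↦ g.RR ε e p a b c d

/-- The matrix of `𝓘` in the last two indices. -/
noncomputable def iMat (e : OpenPartialHomeomorph M E4) (p : M) (a b : Fin 4) :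
    Matrix (Fin 4) (Fin 4) ℂ :=
  Matrix.of fun c d ↦ g.II ε e p a b c d

variable {T}

theorem isAlt_FMat (hT : g.IsKilling T) (he : e ∈ IsManifold.maximalAtlas (𝓡 4) ∞ M)
    (hp : p ∈ e.source) : IsAlt (FMat g T e p) :=
  ⟨fun i ↦ by have := g.F_antisymm hT he hp i i; simp only [FMat, Matrix.of_apply]; linarith,
    fun i j ↦ g.F_antisymm hT he hp i j⟩

theorem fMat_eq (hT : g.IsKilling T) (he : e ∈ IsManifold.maximalAtlas (𝓡 4) ∞ M)
    (hp : p ∈ e.source) : fMat ε T e p = sd ε e p (cx (FMat g T e p)) := by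
  ext a b
  have h := sum_epsMixed ε he hp (isAlt_FMat hT he hp) a b
  rw [sd, selfDual, ← cx_hodge, Matrix.add_apply, Matrix.smul_apply, cx_apply, cx_apply, ← h]
  rfl

/-- The definition dualises the first index pair, whereas the matrix calculus acts on the last; in
vacuum the two duals agree. -/
theorem rMat_eq (hvac : g.IsVacuum) (he : e ∈ IsManifold.maximalAtlas (𝓡 4) ∞ M)
    (hp : p ∈ e.source) (a b : Fin 4) :
    rMat ε e p a b = sd ε e p (cx (riemMat g e p a b)) := by
  ext c d
  have hA : IsAlt (Matrix.of fun m n ↦ g.riemann e p m n c d) := by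
    rw [riemann_left_eq_right he hp]; exact isAlt_riemann_right _ _
  have h := sum_epsMixed ε he hp hA a b
  rw [left_dual_eq_right_dual ε hvac he hp] at h
  rw [sd, selfDual, ← cx_hodge, Matrix.add_apply, Matrix.smul_apply, cx_apply, cx_apply]
  change _ = _ + Complex.I • ((dualCurv ε e p a b c d : ℝ) : ℂ)
  rw [← h]
  rfl

theorem cx_loMat_mul_upMat (he : e ∈ IsManifold.maximalAtlas (𝓡 4) ∞ M) (hp : p ∈ e.source) :
    cx (g.loMat e p) * cx (g.upMat e p) = 1 := by
  rw [← map_mul, g.loMat_mul_upMat he hp, map_one]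

theorem cx_upMat_mul_loMat (he : e ∈ IsManifold.maximalAtlas (𝓡 4) ∞ M) (hp : p ∈ e.source) :
    cx (g.upMat e p) * cx (g.loMat e p) = 1 := by
  rw [← map_mul, g.upMat_mul_loMat he hp, map_one]

/-- `𝓘` is, up to normalisation, the self-dual part of `g_a ∧ g_b`. Its self-duality, its pairing
with `𝓕` and its vanishing derivative are all read off from this form. -/
theorem iMat_eq (he : e ∈ IsManifold.maximalAtlas (𝓡 4) ∞ M)
    (hp : p ∈ e.source) (a b : Fin 4) :
    iMat ε e p a b = sd ε e p ((1 / 4 : ℂ) • rowWedge (cx (g.loMat e p)) a b) := by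
  ext c d
  rw [sd, selfDual_smul, selfDual, Matrix.smul_apply, Matrix.add_apply, Matrix.smul_apply,
    hodge_rowWedge cx_upMat_transpose (cx_loMat_mul_upMat he hp)]
  simp only [iMat, II, Matrix.of_apply, comp_eq_vol_mul_lc ε he hp, rowWedge, cx_apply, loMat]
  push_cast
  simp only [smul_eq_mul]
  ring

theorem iMat_pair_symm (he : e ∈ IsManifold.maximalAtlas (𝓡 4) ∞ M)
    (hp : p ∈ e.source) (a b c d : Fin 4) : iMat ε e p a b c d = iMat ε e p c d a b := by
  simp only [iMat, II, Matrix.of_apply, comp_eq_vol_mul_lc ε he hp, lc_pair_symm a b c d,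
    g.lo_symm a c, g.lo_symm b d, g.lo_symm a d, g.lo_symm b c, mul_comm]

theorem isAlt_fMat (hT : g.IsKilling T) (he : e ∈ IsManifold.maximalAtlas (𝓡 4) ∞ M)
    (hp : p ∈ e.source) : IsAlt (fMat ε T e p) := by
  rw [fMat_eq ε hT he hp]; exact isAlt_selfDual (isAlt_FMat hT he hp).cx

theorem isAlt_riemMat (a b : Fin 4) : IsAlt (riemMat g e p a b) := isAlt_riemann_right a b

theorem isAlt_rMat (hvac : g.IsVacuum) (he : e ∈ IsManifold.maximalAtlas (𝓡 4) ∞ M)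
    (hp : p ∈ e.source) (a b : Fin 4) : IsAlt (rMat ε e p a b) := by
  rw [rMat_eq ε hvac he hp]; exact isAlt_selfDual (isAlt_riemMat a b).cx

theorem isAlt_iMat (he : e ∈ IsManifold.maximalAtlas (𝓡 4) ∞ M)
    (hp : p ∈ e.source) (a b : Fin 4) : IsAlt (iMat ε e p a b) := by
  rw [iMat_eq ε he hp]; exact isAlt_selfDual ((isAlt_rowWedge _ a b).smul _)

theorem sd_eq_hodge (he : e ∈ IsManifold.maximalAtlas (𝓡 4) ∞ M) (hp : p ∈ e.source)
    {A : Matrix (Fin 4) (Fin 4) ℂ} (hA : IsAlt A) : sd ε e p A =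
      Complex.I • hodge (ε.vol e p : ℂ) (cx (g.upMat e p)) (sd ε e p A) :=
  selfDual_eq_hodge cx_upMat_transpose (vol_sq_mul_det_cx ε he hp) hA

theorem fMat_eq_hodge (hT : g.IsKilling T) (he : e ∈ IsManifold.maximalAtlas (𝓡 4) ∞ M)
    (hp : p ∈ e.source) : fMat ε T e p =
      Complex.I • hodge (ε.vol e p : ℂ) (cx (g.upMat e p)) (fMat ε T e p) := by
  rw [fMat_eq ε hT he hp]; exact sd_eq_hodge ε he hp (isAlt_FMat hT he hp).cx

theorem rMat_eq_hodge (hvac : g.IsVacuum) (he : e ∈ IsManifold.maximalAtlas (𝓡 4) ∞ M)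
    (hp : p ∈ e.source) (a b : Fin 4) : rMat ε e p a b =
      Complex.I • hodge (ε.vol e p : ℂ) (cx (g.upMat e p)) (rMat ε e p a b) := by
  rw [rMat_eq ε hvac he hp]; exact sd_eq_hodge ε he hp (isAlt_riemMat a b).cx

theorem iMat_eq_hodge (he : e ∈ IsManifold.maximalAtlas (𝓡 4) ∞ M)
    (hp : p ∈ e.source) (a b : Fin 4) : iMat ε e p a b =
      Complex.I • hodge (ε.vol e p : ℂ) (cx (g.upMat e p)) (iMat ε e p a b) := by
  rw [iMat_eq ε he hp]; exact sd_eq_hodge ε he hp ((isAlt_rowWedge _ a b).smul _)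

theorem FFsq_eq (hT : g.IsKilling T) (he : e ∈ IsManifold.maximalAtlas (𝓡 4) ∞ M)
    (hp : p ∈ e.source) : g.FFsq T ε e p =
      formInner (cx (g.upMat e p)) (fMat ε T e p) (fMat ε T e p) := by
  rw [formInner_eq_sum cx_upMat_transpose (isAlt_fMat ε hT he hp)]
  unfold FFsq
  refine Finset.sum_congr rfl fun a _ ↦ Finset.sum_congr rfl fun b _ ↦ ?_
  simp only [Matrix.mul_apply, Finset.mul_sum, Finset.sum_mul, fMat, Matrix.of_apply, cx_apply,
    upMat]
  rw [Finset.sum_comm]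
  refine Finset.sum_congr rfl fun n _ ↦ Finset.sum_congr rfl fun m _ ↦ ?_
  rw [g.up_symm n b]
  push_cast
  ring

/-- `𝓘` acts as the identity on self-dual forms: `1/4` is compensated by `2` from
`formInner_selfDual` and `2` from `formInner_rowWedge`. -/
theorem formInner_iMat (hT : g.IsKilling T) (he : e ∈ IsManifold.maximalAtlas (𝓡 4) ∞ M)
    (hp : p ∈ e.source) (a b : Fin 4) :
    formInner (cx (g.upMat e p)) (iMat ε e p a b) (fMat ε T e p) = fMat ε T e p a b := by
  rw [iMat_eq ε he hp, sd, formInner_selfDual cx_upMat_transpose ((isAlt_rowWedge _ a b).smul _)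
    (isAlt_fMat ε hT he hp) (fMat_eq_hodge ε hT he hp), formInner_smul,
    formInner_rowWedge cx_upMat_transpose (cx_loMat_mul_upMat he hp) (isAlt_fMat ε hT he hp)]
  ring

/-- Real and imaginary parts both satisfy the cyclic identity, and self-duality then kills the
trace. -/
theorem rMat_trace (hvac : g.IsVacuum) (he : e ∈ IsManifold.maximalAtlas (𝓡 4) ∞ M)
    (hp : p ∈ e.source) (a b : Fin 4) :
    ∑ k, ∑ n, cx (g.upMat e p) k n * rMat ε e p a k n b = 0 := by
  refine trace_eq_zero_of_cyclic cx_upMat_transpose (cx_loMat_mul_upMat he hp)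
    (w := (ε.vol e p : ℂ)) (by exact_mod_cast vol_ne_zero ε he hp)
    (fun s ↦ isAlt_rMat ε hvac he hp a s) (fun s ↦ rMat_eq_hodge ε hvac he hp a s)
    (fun b c d ↦ ?_) b
  have e1 : ∀ b c d, rMat ε e p a b c d = (g.riemann e p a b c d : ℂ)
      + Complex.I * (dualCurv ε e p a b c d : ℂ) := by
    intro b c d
    rw [rMat_eq ε hvac he hp, sd, selfDual, ← cx_hodge]
    rfl
  have e2 := g.riemann_cyclic_right (e := e) (p := p) a b c d
  have e3 := dualCurv_cyclic ε hvac he hp a b c d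
  simp only [e1]
  have e2' : (g.riemann e p a b c d : ℂ) + g.riemann e p a c d b + g.riemann e p a d b c = 0 := by
    exact_mod_cast e2
  have e3' : (dualCurv ε e p a b c d : ℂ) + dualCurv ε e p a c d b + dualCurv ε e p a d b c = 0 := by
    exact_mod_cast e3
  linear_combination e2' + Complex.I * e3'

/-! ### Covariant derivatives of `𝓕`, `𝓡` and `𝓘`. -/

section Derivatives

theorem matDiffAt_FMat (hT : g.IsKilling T) (he : e ∈ IsManifold.maximalAtlas (𝓡 4) ∞ M)
    (hp : p ∈ e.source) : MatDiffAt e p (FMat g T e) := fun a b ↦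
  SmoothOn.diffAt he (g.smoothOn_F hT he a b) e.open_source hp hp

theorem matDiffAt_riemMat (he : e ∈ IsManifold.maximalAtlas (𝓡 4) ∞ M)
    (hp : p ∈ e.source) (a b : Fin 4) : MatDiffAt e p (fun q ↦ riemMat g e q a b) := fun c d ↦
  SmoothOn.diffAt he (g.smoothOn_riemann he a b c d) e.open_source hp hp

theorem nab2_congr {X Y : M → Matrix (Fin 4) (Fin 4) ℂ} (hp : p ∈ e.source)
    (h : ∀ q ∈ e.source, X q = Y q) (m : Fin 4) : g.nab2 e m X p = g.nab2 e m Y p := by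
  unfold nab2
  rw [pdMat_congr_of_eqOn e.open_source hp hp h, h p hp]

theorem nab4_congr {X Y : M → Fin 4 → Fin 4 → Matrix (Fin 4) (Fin 4) ℂ} (hp : p ∈ e.source)
    (h : ∀ q ∈ e.source, ∀ a b, X q a b = Y q a b) (m a b : Fin 4) :
    g.nab4 e m X p a b = g.nab4 e m Y p a b := by
  unfold nab4
  rw [nab2_congr hp fun q hq ↦ h q hq a b]
  simp only [h p hp]

/-- The self-dual part commutes with the derivative, so it can be applied to the Killing identity
`covD2_F`. -/
theorem nab2_fMat (hvac : g.IsVacuum) (hT : g.IsKilling T)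
    (he : e ∈ IsManifold.maximalAtlas (𝓡 4) ∞ M) (hp : p ∈ e.source) (m : Fin 4) :
    g.nab2 e m (fMat ε T e) p =
      ∑ l, (coframe e p l (T p) : ℂ) • rMat ε e p l m := by
  rw [nab2_congr hp fun q hq ↦ fMat_eq ε hT he hq,
    nab2_selfDual ε he hp (matDiffAt_FMat hT he hp).cx (isAlt_FMat hT he hp).cx]
  have h : g.nab2 e m (fun q ↦ cx (FMat g T e q)) p =
      ∑ l, (coframe e p l (T p) : ℂ) • cx (riemMat g e p l m) := by
    unfold nab2
    rw [pdMat_cx (matDiffAt_FMat hT he hp), cx_transpose, ← map_mul, ← map_mul, ← map_sub,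
      ← map_sub]
    simp only [← cx_smul, ← map_sum]
    congr 1
    ext a b
    have := g.covD2_F hT he hp m a b
    simp only [Matrix.sum_apply, Matrix.smul_apply, riemMat, Matrix.of_apply, smul_eq_mul,
      Matrix.sub_apply, Matrix.mul_apply, Matrix.transpose_apply, pdMat, FMat, conn]
    unfold covD2 at this
    rw [Finset.sum_congr rfl fun l _ ↦ mul_comm (coframe e p l (T p)) _, ← this]
    rw [Finset.sum_congr rfl fun x _ ↦ mul_comm (g.F T e p a x) _]
    ring
  rw [h, selfDual_sum]
  refine Finset.sum_congr rfl fun l _ ↦ ?_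
  rw [selfDual_smul, rMat_eq ε hvac he hp]

/-- Metric compatibility lets the lowering of the first index pass through the derivative. -/
theorem nab4_riemMat (he : e ∈ IsManifold.maximalAtlas (𝓡 4) ∞ M) (hp : p ∈ e.source)
    (m a b c d : Fin 4) :
    g.nab4 e m (fun q a b ↦ cx (riemMat g e q a b)) p a b c d =
      ((∑ n, g.lo e p a n * g.nablaCurv e p m n b c d : ℝ) : ℂ) := by
  have hL := g.matDiffAt_loMat he hp
  have hK := g.matDiffAt_curv he hp c d
  have h1 : pdMat e m (fun q ↦ g.loMat e q * g.curv e c d q) p -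
      (g.conn e m p).transpose * (g.loMat e p * g.curv e c d p)
      - (g.loMat e p * g.curv e c d p) * g.conn e m p =
      g.loMat e p * (pdMat e m (g.curv e c d) p
      + (g.conn e m p * g.curv e c d p - g.curv e c d p * g.conn e m p)) := by
    rw [pdMat_mul hp hL hK, g.pdMat_loMat he hp]
    noncomm_ring
  have h2 := congrFun (congrFun h1 a) b
  have h3 : pdMat e m (fun q ↦ g.loMat e q * g.curv e c d q) p a b =
      pd e m (fun q ↦ g.riemann e q a b c d) p := by
    simp only [pdMat, Matrix.of_apply, loMat_mul_curv_apply]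
  rw [Matrix.sub_apply, Matrix.sub_apply, h3, Matrix.mul_apply, Matrix.mul_apply,
    Matrix.mul_apply] at h2
  simp only [loMat_mul_curv_apply, Matrix.transpose_apply, conn, Matrix.of_apply] at h2
  have h4 : ∑ n, g.lo e p a n * g.nablaCurv e p m n b c d =
      ∑ n, g.loMat e p a n * (pdMat e m (g.curv e c d) p
      + (g.conn e m p * g.curv e c d p - g.curv e c d p * g.conn e m p)) n b
      - (∑ n, g.christoffel e p n m c * g.riemann e p a b n d
      + ∑ n, g.christoffel e p n m d * g.riemann e p a b c n) := by
    simp only [nablaCurv, mul_sub, Finset.sum_sub_distrib]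
    congr 1
    simp only [riemann, Finset.mul_sum]
    rw [Finset.sum_comm]
    rw [← Finset.sum_add_distrib]
    refine Finset.sum_congr rfl fun k _ ↦ ?_
    rw [← Finset.sum_add_distrib]
    exact Finset.sum_congr rfl fun n _ ↦ by ring
  have h5 : ∑ n, g.loMat e p a n * (pdMat e m (g.curv e c d) p
      + (g.conn e m p * g.curv e c d p - g.curv e c d p * g.conn e m p)) n b =
      pd e m (fun q ↦ g.riemann e q a b c d) p
      - ∑ n, g.christoffel e p n m a * g.riemann e p n b c d
      - ∑ n, g.riemann e p a n c d * g.christoffel e p n m b := by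
    rw [h2]; rfl
  rw [h4, h5]
  have h6 : pdMat e m (fun q ↦ cx (riemMat g e q a b)) p c d =
      (pd e m (fun q ↦ g.riemann e q a b c d) p : ℝ) := by
    rw [pdMat_cx (matDiffAt_riemMat he hp a b)]
    rfl
  simp only [nab4, nab2, Matrix.sub_apply, Matrix.sum_apply, Matrix.smul_apply, Matrix.mul_apply,
    Matrix.transpose_apply, cx_apply, smul_eq_mul]
  rw [h6]
  simp only [conn, riemMat, Matrix.of_apply]
  push_cast
  rw [Finset.sum_congr rfl fun x _ ↦ mul_comm (g.riemann e p a b c x : ℂ) _,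
    Finset.sum_congr rfl fun x _ ↦ mul_comm (g.riemann e p a x c d : ℂ) _]
  ring

/-- The dual acts on the last index pair, away from the contracted index, so the contracted Bianchi
identity survives complexification. -/
theorem sum_up_nab4_rMat (hvac : g.IsVacuum) (he : e ∈ IsManifold.maximalAtlas (𝓡 4) ∞ M)
    (hp : p ∈ e.source) (b : Fin 4) :
    ∑ m, ∑ a, cx (g.upMat e p) m a • g.nab4 e m (rMat ε e) p a b = 0 := by
  have h1 : ∑ m, ∑ a, cx (g.upMat e p) m a •
      g.nab4 e m (fun q a b ↦ cx (riemMat g e q a b)) p a b = 0 := by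
    ext c d
    simp only [Matrix.sum_apply, Matrix.smul_apply, nab4_riemMat he hp, cx_apply, smul_eq_mul,
      Matrix.zero_apply]
    have : ∑ m, ∑ a, g.up e p m a * ∑ n, g.lo e p a n * g.nablaCurv e p m n b c d = 0 := by
      rw [← g.sum_nablaCurv_div hvac he hp b c d]
      refine Finset.sum_congr rfl fun m _ ↦ ?_
      have h : ∀ n, ∑ a, g.up e p m a * g.lo e p a n = if m = n then 1 else 0 := fun n ↦ by
        have := congrFun (congrFun (g.upMat_mul_loMat he hp) m) n
        rw [Matrix.mul_apply, Matrix.one_apply] at this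
        exact this
      simp only [Finset.mul_sum]
      rw [Finset.sum_comm]
      simp only [← mul_assoc, ← Finset.sum_mul, h]
      simp
    exact_mod_cast this
  have h2 : ∀ m a, g.nab4 e m (rMat ε e) p a b = sd ε e p
      (g.nab4 e m (fun q a b ↦ cx (riemMat g e q a b)) p a b) := by
    intro m a
    rw [nab4_congr hp fun q hq a b ↦ rMat_eq ε hvac he hq a b]
    exact nab4_selfDual ε he hp (fun a b ↦ (matDiffAt_riemMat he hp a b).cx)
      (fun a b ↦ (isAlt_riemMat a b).cx) m a b
  simp only [h2, ← selfDual_smul, ← selfDual_sum, h1, selfDual_zero]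

theorem matDiffAt_rowWedge (he : e ∈ IsManifold.maximalAtlas (𝓡 4) ∞ M) (hp : p ∈ e.source)
    (a b : Fin 4) :
    MatDiffAt e p (fun q ↦ (1 / 4 : ℂ) • rowWedge (cx (g.loMat e q)) a b) := by
  have h := (g.matDiffAt_loMat he hp).cx
  exact MatDiffAt.smul (DiffAt.const _) fun c d ↦ ((h a c).mul (h b d)).sub ((h a d).mul (h b c))

/-- Since self-dual parts commute with the derivative, only the metric part `g_a ∧ g_b` has to be
differentiated. -/
theorem nab4_iMat (he : e ∈ IsManifold.maximalAtlas (𝓡 4) ∞ M) (hp : p ∈ e.source)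
    (m a b : Fin 4) : g.nab4 e m (iMat ε e) p a b = 0 := by
  rw [nab4_congr hp fun q hq a b ↦ iMat_eq ε he hq a b,
    nab4_selfDual ε he hp (matDiffAt_rowWedge he hp) (fun a b ↦ (isAlt_rowWedge _ a b).smul _)]
  convert selfDual_zero
  have h := (g.matDiffAt_loMat he hp).cx
  have hpd : ∀ i j, pd e m (fun q ↦ cx (g.loMat e q) i j) p =
      ∑ n, ((g.christoffel e p n m i : ℂ) * g.lo e p n j
        + (g.christoffel e p n m j : ℂ) * g.lo e p i n) := by
    intro i j
    have := g.pd_lo he hp m i j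
    change pd e m (fun q ↦ (g.lo e q i j : ℂ)) p = _
    rw [pd_ofReal (SmoothOn.diffAt he (g.smoothOn_lo he i j) e.open_source hp hp), this]
    push_cast
    rfl
  ext c d
  have h1 : pdMat e m (fun q ↦ (1 / 4 : ℂ) • rowWedge (cx (g.loMat e q)) a b) p c d =
      1 / 4 * ((cx (g.loMat e p) a c * pd e m (fun q ↦ cx (g.loMat e q) b d) p
      + pd e m (fun q ↦ cx (g.loMat e q) a c) p * cx (g.loMat e p) b d)
      - (cx (g.loMat e p) a d * pd e m (fun q ↦ cx (g.loMat e q) b c) p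
      + pd e m (fun q ↦ cx (g.loMat e q) a d) p * cx (g.loMat e p) b c)) := by
    rw [← pd_mul hp (h a c) (h b d), ← pd_mul hp (h a d) (h b c),
      ← pd_sub ((h a c).mul (h b d)) ((h a d).mul (h b c)),
      ← pd_const_mul _ (((h a c).mul (h b d)).sub ((h a d).mul (h b c)))]
    rfl
  simp only [nab4, nab2, Matrix.sub_apply, Matrix.sum_apply, Matrix.smul_apply, Matrix.mul_apply,
    Matrix.transpose_apply, smul_eq_mul]
  rw [h1]
  simp only [hpd]
  simp only [cx_apply, conn, rowWedge, loMat, Matrix.of_apply,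
    Matrix.zero_apply, Finset.mul_sum, Finset.sum_mul]
  simp only [← Finset.sum_add_distrib, ← Finset.sum_sub_distrib, Finset.mul_sum]
  refine Finset.sum_eq_zero fun n _ ↦ ?_
  ring

end Derivatives

end Fields

end LorentzMetric

namespace LorentzMetric

/-! ### The divergence of the Mars–Simon tensor. -/

section Fields

variable {M : Type*} [TopologicalSpace M] [ChartedSpace E4 M] [IsManifold (𝓡 4) ∞ M]
  {g : LorentzMetric M} (ε : g.VolumeForm) (T : ∀ p : M, TangentSpace (𝓡 4) p)
  {e : OpenPartialHomeomorph M E4} {p : M}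

theorem smoothOn_epsMixed (he : e ∈ IsManifold.maximalAtlas (𝓡 4) ∞ M) (a b m n : Fin 4) :
    SmoothOn e.source (fun q ↦ g.epsMixed ε e q a b m n) := by
  unfold epsMixed
  refine SmoothOn.sum fun r _ ↦ SmoothOn.sum fun s _ ↦ SmoothOn.mul (SmoothOn.mul ?_
    (g.smoothOn_up he r m)) (g.smoothOn_up he s n)
  exact (SmoothOn.mul (smoothOn_vol ε he) (SmoothOn.const _)).congr
    fun q hq ↦ comp_eq_vol_mul_lc ε he hq a b r s

variable {T} in
theorem smoothOn_FF (hT : g.IsKilling T) (he : e ∈ IsManifold.maximalAtlas (𝓡 4) ∞ M)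
    (a b : Fin 4) : SmoothOn e.source (fun q ↦ g.FF T ε e q a b) := by
  unfold FF
  refine SmoothOn.add (g.smoothOn_F hT he a b).ofReal (SmoothOn.mul (SmoothOn.const _)
    (SmoothOn.ofReal (SmoothOn.mul (SmoothOn.const _) ?_)))
  exact SmoothOn.sum fun m _ ↦ SmoothOn.sum fun n _ ↦
    SmoothOn.mul (smoothOn_epsMixed ε he a b m n) (g.smoothOn_F hT he m n)

theorem smoothOn_RR (he : e ∈ IsManifold.maximalAtlas (𝓡 4) ∞ M)
    (a b c d : Fin 4) : SmoothOn e.source (fun q ↦ g.RR ε e q a b c d) := by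
  unfold RR
  refine SmoothOn.add (g.smoothOn_riemann he a b c d).ofReal (SmoothOn.mul (SmoothOn.const _)
    (SmoothOn.ofReal (SmoothOn.mul (SmoothOn.const _) ?_)))
  exact SmoothOn.sum fun m _ ↦ SmoothOn.sum fun n _ ↦
    SmoothOn.mul (smoothOn_epsMixed ε he a b m n) (g.smoothOn_riemann he m n c d)

variable {T} in
theorem smoothOn_FFsq (hT : g.IsKilling T) (he : e ∈ IsManifold.maximalAtlas (𝓡 4) ∞ M) :
    SmoothOn e.source (fun q ↦ g.FFsq T ε e q) := by
  unfold FFsq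
  exact SmoothOn.sum fun a _ ↦ SmoothOn.sum fun b _ ↦ SmoothOn.sum fun m _ ↦ SmoothOn.sum fun n _ ↦
    SmoothOn.mul (SmoothOn.ofReal (SmoothOn.mul (g.smoothOn_up he a m) (g.smoothOn_up he b n)))
      (SmoothOn.mul (smoothOn_FF ε hT he a b) (smoothOn_FF ε hT he m n))

theorem smoothOn_II (he : e ∈ IsManifold.maximalAtlas (𝓡 4) ∞ M)
    (a b c d : Fin 4) : SmoothOn e.source (fun q ↦ g.II ε e q a b c d) := by
  unfold II
  simp only [div_eq_mul_inv]
  refine SmoothOn.mul (SmoothOn.add (SmoothOn.ofReal (SmoothOn.sub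
    (SmoothOn.mul (g.smoothOn_lo he a c) (g.smoothOn_lo he b d))
    (SmoothOn.mul (g.smoothOn_lo he a d) (g.smoothOn_lo he b c))))
    (SmoothOn.mul (SmoothOn.const _) (SmoothOn.ofReal ?_))) (SmoothOn.const _)
  exact (SmoothOn.mul (smoothOn_vol ε he) (SmoothOn.const _)).congr
    fun q hq ↦ comp_eq_vol_mul_lc ε he hq a b c d

/-- The factor `6 (1 - σ)⁻¹`. -/
noncomputable def msFactor (σ : M → ℂ) (q : M) : ℂ := 6 * (1 - σ q)⁻¹

/-- The matrix of `𝓠` in the last two indices. -/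
noncomputable def qMat (e : OpenPartialHomeomorph M E4) (q : M) (a b : Fin 4) :
    Matrix (Fin 4) (Fin 4) ℂ :=
  fMat ε T e q a b • fMat ε T e q - (1 / 3 * g.FFsq T ε e q) • iMat ε e q a b

/-- The matrix of the Mars–Simon tensor in the last two indices. -/
noncomputable def sMat (σ : M → ℂ) (e : OpenPartialHomeomorph M E4) (q : M) (a b : Fin 4) :
    Matrix (Fin 4) (Fin 4) ℂ :=
  rMat ε e q a b + msFactor σ q • qMat ε T e q a b

theorem marsSimon_apply (σ : M → ℂ) (q : M) (I : Fin 4 → Fin 4) :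
    g.marsSimon T ε σ e q I = sMat ε T σ e q (I 0) (I 1) (I 2) (I 3) := rfl

variable {T} {σ : M → ℂ}

theorem isOpen_ne_one (hσ : g.IsErnstPotential T ε σ) : IsOpen {q | σ q ≠ 1} :=
  isOpen_ne_fun hσ.1.continuous continuous_const

theorem smoothOn_msFactor (hσ : g.IsErnstPotential T ε σ) :
    SmoothOn {q | σ q ≠ 1} (msFactor σ) := by
  unfold msFactor
  exact SmoothOn.mul (SmoothOn.const _) (SmoothOn.inv (SmoothOn.sub (SmoothOn.const _)
    hσ.1.contMDiffOn) fun q hq h ↦ hq (sub_eq_zero.1 h).symm)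

theorem smoothOn_sMat (hT : g.IsKilling T) (hσ : g.IsErnstPotential T ε σ)
    (he : e ∈ IsManifold.maximalAtlas (𝓡 4) ∞ M) (a b c d : Fin 4) :
    SmoothOn (e.source ∩ {q | σ q ≠ 1}) (fun q ↦ sMat ε T σ e q a b c d) := by
  have h1 : e.source ∩ {q | σ q ≠ 1} ⊆ e.source := Set.inter_subset_left
  refine SmoothOn.add ((smoothOn_RR ε he a b c d).mono h1)
    (SmoothOn.mul ((smoothOn_msFactor ε hσ).mono Set.inter_subset_right) (SmoothOn.sub
      (SmoothOn.mul ((smoothOn_FF ε hT he a b).mono h1) ((smoothOn_FF ε hT he c d).mono h1))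
      (SmoothOn.mul (SmoothOn.mul (SmoothOn.const _) ((smoothOn_FFsq ε hT he).mono h1))
        ((smoothOn_II ε he a b c d).mono h1))))

/-- Differentiating `λ (1 - σ) = 6` gives `∂λ = λ² ∂σ / 6`, and `∂σ` is the Ernst one-form. -/
theorem pd_msFactor (hσ : g.IsErnstPotential T ε σ)
    (he : e ∈ IsManifold.maximalAtlas (𝓡 4) ∞ M) (hp : p ∈ e.source) (hp1 : σ p ≠ 1)
    (m : Fin 4) : pd e m (msFactor σ) p =
      msFactor σ p ^ 2 / 6 * (2 * ∑ a, (coframe e p a (T p) : ℂ) * fMat ε T e p a m) := by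
  have hW := isOpen_ne_one ε hσ
  have hd : DiffAt e p σ := SmoothOn.diffAt he hσ.1.contMDiffOn hW hp1 hp
  have hl : DiffAt e p (msFactor σ) := SmoothOn.diffAt he (smoothOn_msFactor ε hσ) hW hp1 hp
  have h0 : ∀ q, σ q ≠ 1 → msFactor σ q * (1 - σ q) = 6 := fun q hq ↦ by
    have : 1 - σ q ≠ 0 := sub_ne_zero.2 (Ne.symm hq)
    simp [msFactor, this]
  have h1 := pd_congr_of_eqOn (e := e) (f := fun q ↦ msFactor σ q * (1 - σ q)) hW hp1 hp h0 m
  rw [pd_const, pd_mul hp hl ((DiffAt.const _).sub hd), pd_sub (DiffAt.const _) hd, pd_const,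
    hσ.2 e he p hp m] at h1
  have h2 := h0 p hp1
  change _ = msFactor σ p ^ 2 / 6 * g.ernst T ε e p m
  linear_combination msFactor σ p / 6 * h1 - pd e m (msFactor σ) p / 6 * h2

theorem matDiffAt_fMat (hT : g.IsKilling T) (he : e ∈ IsManifold.maximalAtlas (𝓡 4) ∞ M)
    (hp : p ∈ e.source) : MatDiffAt e p (fMat ε T e) := fun a b ↦
  SmoothOn.diffAt he (smoothOn_FF ε hT he a b) e.open_source hp hp

theorem matDiffAt_rMat (he : e ∈ IsManifold.maximalAtlas (𝓡 4) ∞ M)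
    (hp : p ∈ e.source) (a b : Fin 4) : MatDiffAt e p (fun q ↦ rMat ε e q a b) := fun c d ↦
  SmoothOn.diffAt he (smoothOn_RR ε he a b c d) e.open_source hp hp

theorem matDiffAt_iMat (he : e ∈ IsManifold.maximalAtlas (𝓡 4) ∞ M)
    (hp : p ∈ e.source) (a b : Fin 4) : MatDiffAt e p (fun q ↦ iMat ε e q a b) := fun c d ↦
  SmoothOn.diffAt he (smoothOn_II ε he a b c d) e.open_source hp hp

theorem diffAt_FFsq (hT : g.IsKilling T) (he : e ∈ IsManifold.maximalAtlas (𝓡 4) ∞ M)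
    (hp : p ∈ e.source) : DiffAt e p (fun q ↦ g.FFsq T ε e q) :=
  SmoothOn.diffAt he (smoothOn_FFsq ε hT he) e.open_source hp hp

/-- With one index raised, the connection terms form a commutator, which the trace in `pd_FFsq`
annihilates. -/
theorem pdMat_mul_upMat (he : e ∈ IsManifold.maximalAtlas (𝓡 4) ∞ M) (hp : p ∈ e.source)
    {X : M → Matrix (Fin 4) (Fin 4) ℂ} (hX : MatDiffAt e p X) (m : Fin 4) :
    pdMat e m (fun q ↦ X q * cx (g.upMat e q)) p =
      g.nab2 e m X p * cx (g.upMat e p)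
      + ((cx (g.conn e m p)).transpose * (X p * cx (g.upMat e p))
        - X p * cx (g.upMat e p) * (cx (g.conn e m p)).transpose) := by
  have hH := (g.matDiffAt_upMat he hp).cx
  rw [pdMat_mul hp hX hH, pdMat_cx (g.matDiffAt_upMat he hp), g.pdMat_upMat he hp, map_neg,
    map_add, map_mul, map_mul, nab2]
  simp only [cx_transpose]
  noncomm_ring

theorem pd_FFsq (hT : g.IsKilling T) (he : e ∈ IsManifold.maximalAtlas (𝓡 4) ∞ M)
    (hp : p ∈ e.source) (m : Fin 4) : pd e m (fun q ↦ g.FFsq T ε e q) p =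
      2 * formInner (cx (g.upMat e p)) (g.nab2 e m (fMat ε T e) p) (fMat ε T e p) := by
  have hf := matDiffAt_fMat ε hT he hp
  have hH := (g.matDiffAt_upMat he hp).cx
  rw [pd_congr_of_eqOn e.open_source hp hp fun q hq ↦ FFsq_eq ε hT he hq]
  have h1 : ∀ q, formInner (cx (g.upMat e q)) (fMat ε T e q) (fMat ε T e q) =
      -∑ i, ((fMat ε T e q * cx (g.upMat e q)) * (fMat ε T e q * cx (g.upMat e q))) i i := by
    intro q
    rw [formInner, Matrix.mul_assoc _ (fMat ε T e q)]
    rfl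
  have h2 := pdMat_mul hp (hf.mul hH) (hf.mul hH) m
  rw [pdMat_mul_upMat he hp hf] at h2
  have h3 : ∑ i, pd e m (fun q ↦
      ((fMat ε T e q * cx (g.upMat e q)) * (fMat ε T e q * cx (g.upMat e q))) i i) p =
      (pdMat e m (fun q ↦ (fMat ε T e q * cx (g.upMat e q)) *
        (fMat ε T e q * cx (g.upMat e q))) p).trace := rfl
  simp only [h1]
  rw [pd_neg, pd_sum fun i _ ↦ ((hf.mul hH).mul (hf.mul hH)) i i, h3, h2, formInner,
    Matrix.mul_assoc _ (fMat ε T e p)]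
  generalize fMat ε T e p * cx (g.upMat e p) = Y
  generalize g.nab2 e m (fMat ε T e) p * cx (g.upMat e p) = N
  generalize (cx (g.conn e m p)).transpose = C
  have t1 : ((N + (C * Y - Y * C)) * Y + Y * (N + (C * Y - Y * C))).trace =
      (N * Y).trace + (Y * N).trace + ((C * (Y * Y)).trace - (Y * Y * C).trace) := by
    rw [← Matrix.trace_sub, ← Matrix.trace_add, ← Matrix.trace_add]
    congr 1
    noncomm_ring
  rw [t1, Matrix.trace_mul_comm Y N, Matrix.trace_mul_comm C]
  ring

theorem nab2_sub {X Y : M → Matrix (Fin 4) (Fin 4) ℂ} (hX : MatDiffAt e p X)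
    (hY : MatDiffAt e p Y) (m : Fin 4) :
    g.nab2 e m (fun q ↦ X q - Y q) p = g.nab2 e m X p - g.nab2 e m Y p := by
  unfold nab2
  rw [pdMat_sub hX hY]
  noncomm_ring

theorem nab4_qMat (hT : g.IsKilling T) (he : e ∈ IsManifold.maximalAtlas (𝓡 4) ∞ M)
    (hp : p ∈ e.source) (m a b : Fin 4) : g.nab4 e m (qMat ε T e) p a b =
      g.nab2 e m (fMat ε T e) p a b • fMat ε T e p + fMat ε T e p a b • g.nab2 e m (fMat ε T e) p
      - (1 / 3 * pd e m (fun q ↦ g.FFsq T ε e q) p) • iMat ε e p a b := by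
  have hf := matDiffAt_fMat ε hT he hp
  have hi := matDiffAt_iMat ε he hp
  have hφ := diffAt_FFsq ε hT he hp
  have hI := nab4_iMat ε he hp m a b
  have hab : g.nab2 e m (fMat ε T e) p a b = pd e m (fun q ↦ fMat ε T e q a b) p
      - ∑ n, (g.christoffel e p n m a : ℂ) * fMat ε T e p n b
      - ∑ n, (g.christoffel e p n m b : ℂ) * fMat ε T e p a n := by
    rw [Finset.sum_congr rfl fun n _ ↦ mul_comm (g.christoffel e p n m b : ℂ) _]
    simp only [nab2, Matrix.sub_apply, Matrix.mul_apply, Matrix.transpose_apply, cx_apply, conn,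
      Matrix.of_apply]
    rfl
  have h1 : g.nab2 e m (fun q ↦ qMat ε T e q a b) p =
      fMat ε T e p a b • g.nab2 e m (fMat ε T e) p
      + pd e m (fun q ↦ fMat ε T e q a b) p • fMat ε T e p
      - ((1 / 3 * g.FFsq T ε e p) • g.nab2 e m (fun q ↦ iMat ε e q a b) p
        + (1 / 3 * pd e m (fun q ↦ g.FFsq T ε e q) p) • iMat ε e p a b) := by
    unfold qMat
    rw [nab2_sub (MatDiffAt.smul (hf a b) hf) (MatDiffAt.smul ((DiffAt.const _).mul hφ) (hi a b)),
      nab2_smul hp (hf a b) hf, nab2_smul hp ((DiffAt.const _).mul hφ) (hi a b),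
      pd_const_mul _ hφ]
  unfold nab4 at hI ⊢
  rw [h1, hab]
  have e1 : ∀ X : Matrix (Fin 4) (Fin 4) ℂ, X = 0 → ∀ c : ℂ, c • X = 0 := by
    rintro _ rfl c; exact smul_zero c
  -- The equation `D𝓘 = 0`, scaled by `𝓕²/3`, absorbs the Christoffel terms of `𝓘` left in the goal.
  have h2 := e1 _ hI (1 / 3 * g.FFsq T ε e p)
  rw [← sub_eq_zero]
  rw [← neg_eq_zero] at h2
  refine Eq.trans ?_ h2
  simp only [qMat, smul_sub, Finset.sum_sub_distrib, smul_smul, sub_smul, Finset.sum_smul,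
    Finset.smul_sum]
  simp only [mul_comm (1 / 3 * g.FFsq T ε e p)]
  abel

theorem nab4_sMat (hT : g.IsKilling T) (hσ : g.IsErnstPotential T ε σ)
    (he : e ∈ IsManifold.maximalAtlas (𝓡 4) ∞ M) (hp : p ∈ e.source) (hp1 : σ p ≠ 1)
    (m a b : Fin 4) : g.nab4 e m (sMat ε T σ e) p a b =
      g.nab4 e m (rMat ε e) p a b + (pd e m (msFactor σ) p • qMat ε T e p a b
        + msFactor σ p • g.nab4 e m (qMat ε T e) p a b) := by
  have hl : DiffAt e p (msFactor σ) :=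
    SmoothOn.diffAt he (smoothOn_msFactor ε hσ) (isOpen_ne_one ε hσ) hp1 hp
  have hq : ∀ a b, MatDiffAt e p (fun q ↦ qMat ε T e q a b) := fun a b ↦
    (MatDiffAt.smul (matDiffAt_fMat ε hT he hp a b) (matDiffAt_fMat ε hT he hp)).sub
      (MatDiffAt.smul ((DiffAt.const _).mul (diffAt_FFsq ε hT he hp)) (matDiffAt_iMat ε he hp a b))
  unfold nab4
  have h1 : g.nab2 e m (fun q ↦ sMat ε T σ e q a b) p = g.nab2 e m (fun q ↦ rMat ε e q a b) p
      + (msFactor σ p • g.nab2 e m (fun q ↦ qMat ε T e q a b) p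
      + pd e m (msFactor σ) p • qMat ε T e p a b) := by
    unfold sMat
    rw [nab2_add (matDiffAt_rMat ε he hp a b) (MatDiffAt.smul hl (hq a b)),
      nab2_smul hp hl (hq a b)]
  rw [h1]
  simp only [sMat, smul_add, Finset.sum_add_distrib, smul_sub, Finset.smul_sum, smul_smul,
    mul_comm (msFactor σ p)]
  abel

/-- The divergence of the Mars–Simon tensor is linear in the tensor. -/
theorem sum_up_nab4_sMat (hvac : g.IsVacuum) (hT : g.IsKilling T) (hσ : g.IsErnstPotential T ε σ)
    (he : e ∈ IsManifold.maximalAtlas (𝓡 4) ∞ M) (hp : p ∈ e.source) (hp1 : σ p ≠ 1)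
    (b : Fin 4) :
    ∑ k, ∑ n, cx (g.upMat e p) k n • g.nab4 e k (sMat ε T σ e) p n b =
      msFactor σ p • ∑ k, ∑ n, ∑ a, (cx (g.upMat e p) k n * (coframe e p a (T p) : ℂ)) •
        (fMat ε T e p n b • sMat ε T σ e p a k
          - (2 / 3 * formInner (cx (g.upMat e p)) (sMat ε T σ e p a k) (fMat ε T e p)) •
            iMat ε e p n b) := by
  have hh := cx_upMat_transpose (g := g) (e := e) (p := p)
  have hg' := cx_upMat_mul_loMat (g := g) he hp
  have hfh := fMat_eq_hodge ε hT he hp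
  have hfa := isAlt_fMat ε hT he hp
  have hff := selfDual_mul_add_mul hh hg' hfa hfa hfh hfh
  -- Both product identities required here, for `𝓕` with itself and for `𝓕` with `𝓘`, are instances
  -- of `selfDual_mul_add_mul`.
  have key := marsSimon_algebra (h := cx (g.upMat e p)) (g := cx (g.loMat e p))
    (f := fMat ε T e p) (t := fun a ↦ (coframe e p a (T p) : ℂ)) (l := msFactor σ p)
    (φ := g.FFsq T ε e p) (r := rMat ε e p) (i := iMat ε e p) (S := sMat ε T σ e p)
    (fun a b ↦ rfl) (FFsq_eq ε hT he hp) (fun a b ↦ rMat_trace ε hvac he hp a b)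
    (fun a b ↦ formInner_iMat ε hT he hp a b)
    (by
      rw [← FFsq_eq ε hT he hp, ← two_smul ℂ] at hff
      rw [show (-(1 / 4) * g.FFsq T ε e p) = (1 / 2) * (-(1 / 2) * g.FFsq T ε e p) by ring,
        mul_smul, ← hff, smul_smul]
      norm_num)
    (fun m n ↦ by
      rw [selfDual_mul_add_mul hh hg' hfa (isAlt_iMat ε he hp m n) hfh (iMat_eq_hodge ε he hp m n),
        formInner_comm, formInner_iMat ε hT he hp])
    (fun a b m n ↦ iMat_pair_symm ε he hp a b m n) b
  rw [← key]
  -- As `𝓡` is divergence-free, only the derivative of the `𝓠` term remains, which is the left side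
  -- of `key`.
  have h0 := sum_up_nab4_rMat ε hvac he hp b
  have : ∀ k n, cx (g.upMat e p) k n • g.nab4 e k (sMat ε T σ e) p n b =
      cx (g.upMat e p) k n • g.nab4 e k (rMat ε e) p n b + cx (g.upMat e p) k n •
        ((msFactor σ p ^ 2 / 6 * (2 * ∑ a, (coframe e p a (T p) : ℂ) * fMat ε T e p a k)) •
          (fMat ε T e p n b • fMat ε T e p - (1 / 3 * g.FFsq T ε e p) • iMat ε e p n b)
        + msFactor σ p • ((∑ a, (coframe e p a (T p) : ℂ) • rMat ε e p a k) n b • fMat ε T e p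
          + fMat ε T e p n b • (∑ a, (coframe e p a (T p) : ℂ) • rMat ε e p a k)
          - (1 / 3 * (2 * formInner (cx (g.upMat e p))
            (∑ a, (coframe e p a (T p) : ℂ) • rMat ε e p a k) (fMat ε T e p))) •
              iMat ε e p n b)) := by
    intro k n
    rw [nab4_sMat ε hT hσ he hp hp1, pd_msFactor ε hσ he hp hp1, nab4_qMat ε hT he hp,
      pd_FFsq ε hT he hp, nab2_fMat ε hvac hT he hp, smul_add]
    rfl
  simp only [this, Finset.sum_add_distrib]
  rw [h0, zero_add]

end Fields

end LorentzMetric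

namespace Spacetime

/-! ### Combinations of generators with smooth coefficients. -/

section Span

variable {M : Type*} [TopologicalSpace M] [ChartedSpace E4 M]
  {ι κ : Type*} [Fintype ι] [Fintype κ] {W : Set M} {G : ι → M → ℂ} {f f' : M → ℂ}

/-- On `W`, the function `f` is a linear combination of the functions `G i`, with smooth
coefficients. -/
def InSpan (W : Set M) (G : ι → M → ℂ) (f : M → ℂ) : Prop :=
  ∃ c : ι → M → ℂ, (∀ i, SmoothOn W (c i)) ∧ ∀ q ∈ W, f q = ∑ i, c i q * G i q

theorem InSpan.congr (h : InSpan W G f) (hf : ∀ q ∈ W, f' q = f q) : InSpan W G f' := by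
  obtain ⟨c, h1, h2⟩ := h
  exact ⟨c, h1, fun q hq ↦ (hf q hq).trans (h2 q hq)⟩

theorem InSpan.gen (i : ι) : InSpan W G (G i) := by
  classical
  refine ⟨fun j _ ↦ if j = i then 1 else 0, fun j ↦ SmoothOn.const _, fun q _ ↦ by simp⟩

theorem InSpan.zero : InSpan W G (fun _ ↦ 0) := ⟨fun _ _ ↦ 0, fun _ ↦ SmoothOn.const _, by simp⟩

theorem InSpan.add (h : InSpan W G f) (h' : InSpan W G f') : InSpan W G (fun q ↦ f q + f' q) := by
  obtain ⟨c, h1, h2⟩ := h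
  obtain ⟨c', h1', h2'⟩ := h'
  refine ⟨fun i q ↦ c i q + c' i q, fun i ↦ SmoothOn.add (h1 i) (h1' i), fun q hq ↦ ?_⟩
  simp only [h2 q hq, h2' q hq, add_mul, Finset.sum_add_distrib]

theorem InSpan.mul {a : M → ℂ} (ha : SmoothOn W a) (h : InSpan W G f) :
    InSpan W G (fun q ↦ a q * f q) := by
  obtain ⟨c, h1, h2⟩ := h
  refine ⟨fun i q ↦ a q * c i q, fun i ↦ SmoothOn.mul ha (h1 i), fun q hq ↦ ?_⟩
  simp only [h2 q hq, mul_assoc, Finset.mul_sum]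

theorem InSpan.neg (h : InSpan W G f) : InSpan W G (fun q ↦ - f q) := by
  simpa using InSpan.mul (SmoothOn.const (-1)) h

theorem InSpan.sub (h : InSpan W G f) (h' : InSpan W G f') : InSpan W G (fun q ↦ f q - f' q) := by
  simpa only [sub_eq_add_neg] using h.add h'.neg

theorem InSpan.sum {τ : Type*} {s : Finset τ} {f : τ → M → ℂ} (h : ∀ i ∈ s, InSpan W G (f i)) :
    InSpan W G (fun q ↦ ∑ i ∈ s, f i q) := by
  classical
  induction s using Finset.induction_on with
  | empty => simpa using InSpan.zero
  | insert i s hi ih =>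
    simp only [Finset.sum_insert hi]
    exact InSpan.add (h i (by simp)) (ih fun j hj ↦ h j (by simp [hj]))

/-- By the product rule a derivative falls either on a coefficient, keeping the generator, or on a
generator; both results must lie in the larger span of `H`. -/
theorem InSpan.pd [IsManifold (𝓡 4) ∞ M] {e : OpenPartialHomeomorph M E4} {H : κ → M → ℂ}
    (he : e ∈ IsManifold.maximalAtlas (𝓡 4) ∞ M) (hW : IsOpen W) (hWe : W ⊆ e.source)
    (h : InSpan W G f) (hs : ∀ i, SmoothOn W (G i)) (hG : ∀ i, InSpan W H (G i))
    (m : Fin 4) (hpd : ∀ i, InSpan W H (Spacetime.pd e m (G i))) :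
    InSpan W H (Spacetime.pd e m f) := by
  obtain ⟨c, h1, h2⟩ := h
  refine (InSpan.sum (s := Finset.univ) fun i _ ↦ (InSpan.mul (h1 i) (hpd i)).add
    (InSpan.mul ((h1 i).pd he hW hWe m) (hG i))).congr fun q hq ↦ ?_
  rw [pd_congr_of_eqOn hW hq (hWe hq) h2, pd_sum fun i _ ↦
    ((h1 i).diffAt he hW hq (hWe hq)).mul ((hs i).diffAt he hW hq (hWe hq))]
  exact Finset.sum_congr rfl fun i _ ↦ pd_mul (hWe hq) ((h1 i).diffAt he hW hq (hWe hq))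
    ((hs i).diffAt he hW hq (hWe hq)) m

end Span

end Spacetime

namespace LorentzMetric

/-! ### From divergence to exterior derivative for self-dual forms. -/

section SelfDualSystem

variable {M : Type*} [TopologicalSpace M] [ChartedSpace E4 M] [IsManifold (𝓡 4) ∞ M]
  {g : LorentzMetric M} (ε : g.VolumeForm) {e : OpenPartialHomeomorph M E4} {W : Set M}
  {ι : Type*} [Fintype ι] {G : ι → M → ℂ} {X : M → Matrix (Fin 4) (Fin 4) ℂ}

/-- Up to lower order terms, a self-dual two-form with vanishing divergence is closed. -/
theorem inSpan_cyclic (he : e ∈ IsManifold.maximalAtlas (𝓡 4) ∞ M) (hW : IsOpen W)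
    (hWe : W ⊆ e.source) (hX : ∀ a b, SmoothOn W (fun q ↦ X q a b))
    (hA : ∀ q ∈ W, IsAlt (X q))
    (hsd : ∀ q ∈ W, X q = Complex.I • hodge (ε.vol e q : ℂ) (cx (g.upMat e q)) (X q))
    (h0 : ∀ a b, InSpan W G (fun q ↦ X q a b))
    (hdiv : ∀ b, InSpan W G (fun q ↦ ∑ k, ∑ n, (g.up e q k n : ℂ) * pd e k (fun x ↦ X x n b) q))
    (a b c : Fin 4) :
    InSpan W G (fun q ↦ pd e c (fun x ↦ X x a b) q + pd e b (fun x ↦ X x c a) q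
      + pd e a (fun x ↦ X x b c) q) := by
  have hup : ∀ i j, SmoothOn W (fun q ↦ (g.up e q i j : ℂ)) := fun i j ↦
    SmoothOn.ofReal ((g.smoothOn_up he i j).mono hWe)
  have hvol : SmoothOn W (fun q ↦ (ε.vol e q : ℂ)) :=
    SmoothOn.ofReal ((smoothOn_vol ε he).mono hWe)
  have htr : ∀ m, SmoothOn W (fun q ↦ ((g.conn e m q).trace : ℂ)) := fun m ↦
    SmoothOn.ofReal (SmoothOn.sum fun i _ ↦ (g.smoothOn_christoffel he i m i).mono hWe)
  -- The form with raised indices. Self-duality reads `X = i vol • flatDual Y`, so derivatives of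
  -- `X` are flat duals of derivatives of `Y`, up to multiples of `X`.
  set Y : M → Matrix (Fin 4) (Fin 4) ℂ := fun q ↦ cx (g.upMat e q) * X q * cx (g.upMat e q) with hY
  have hYe : ∀ q r s, Y q r s = ∑ n, ∑ m, g.up e q r m * X q m n * g.up e q n s := by
    intro q r s
    simp only [hY, Matrix.mul_apply, Finset.sum_mul]
    rfl
  -- The divergence of `Y` is minus the raised divergence of `X`, by antisymmetry, plus derivatives
  -- of the inverse metric times `X`.
  have hdivY : ∀ r, InSpan W G (fun q ↦ ∑ s, pd e s (fun x ↦ Y x r s) q) := by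
    intro r
    have h1 : InSpan W G (fun q ↦ ∑ s, ∑ n, ∑ m,
        pd e s (fun x ↦ (g.up e x r m : ℂ) * (g.up e x n s : ℂ)) q * X q m n
        + ∑ m, (g.up e q r m : ℂ) * -(∑ k, ∑ n, (g.up e q k n : ℂ)
          * pd e k (fun x ↦ X x n m) q)) :=
      InSpan.add (InSpan.sum fun s _ ↦ InSpan.sum fun n _ ↦ InSpan.sum fun m _ ↦
        InSpan.mul ((SmoothOn.mul (hup r m) (hup n s)).pd he hW hWe s) (h0 m n))
        (InSpan.sum fun m _ ↦ InSpan.mul (hup r m) (hdiv m).neg)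
    refine h1.congr fun q hq ↦ ?_
    have hp := hWe hq
    have dX : ∀ a b, DiffAt e q (fun x ↦ X x a b) := fun a b ↦ (hX a b).diffAt he hW hq hp
    have du : ∀ a b, DiffAt e q (fun x ↦ (g.up e x a b : ℂ)) := fun a b ↦
      (hup a b).diffAt he hW hq hp
    have h2 : ∀ s, pd e s (fun x ↦ Y x r s) q = ∑ n, ∑ m,
        (pd e s (fun x ↦ (g.up e x r m : ℂ) * (g.up e x n s : ℂ)) q * X q m n
          + (g.up e q r m : ℂ) * (g.up e q n s : ℂ) * pd e s (fun x ↦ X x m n) q) := by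
      intro s
      simp only [hYe, mul_right_comm _ (X _ _ _)]
      rw [pd_sum fun n _ ↦ DiffAt.sum fun m _ ↦ ((du r m).mul (du n s)).mul (dX m n)]
      refine Finset.sum_congr rfl fun n _ ↦ ?_
      rw [pd_sum fun m _ ↦ ((du r m).mul (du n s)).mul (dX m n)]
      refine Finset.sum_congr rfl fun m _ ↦ ?_
      rw [pd_mul hp ((du r m).mul (du n s)) (dX m n), add_comm]
    have h3 : ∀ s m n, pd e s (fun x ↦ X x m n) q = - pd e s (fun x ↦ X x n m) q := by
      intro s m n
      rw [← pd_neg]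
      exact pd_congr_of_eqOn hW hq hp (fun x hx ↦ (hA x hx).anti m n) s
    simp only [h2, Finset.sum_add_distrib]
    congr 1
    rw [Finset.sum_congr rfl fun s _ ↦ Finset.sum_comm, Finset.sum_comm]
    refine Finset.sum_congr rfl fun m _ ↦ ?_
    rw [← Finset.sum_neg_distrib, Finset.mul_sum]
    refine Finset.sum_congr rfl fun s _ ↦ ?_
    rw [← Finset.sum_neg_distrib, Finset.mul_sum]
    refine Finset.sum_congr rfl fun n _ ↦ ?_
    rw [h3, g.up_symm n s]
    ring
  -- The first part is `flatDual_cyclic` applied to the derivatives of `Y`; the traces come from the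
  -- derivative of the volume element.
  have h1 : InSpan W G (fun q ↦ (Complex.I * (ε.vol e q : ℂ)) *
      (-∑ r, (lc a b c r : ℂ) * ∑ s, pd e s (fun x ↦ Y x r s) q)
      + (((g.conn e c q).trace : ℂ) * X q a b + ((g.conn e b q).trace : ℂ) * X q c a
        + ((g.conn e a q).trace : ℂ) * X q b c)) :=
    (InSpan.mul (SmoothOn.mul (SmoothOn.const _) hvol)
      (InSpan.sum fun r _ ↦ InSpan.mul (SmoothOn.const _) (hdivY r)).neg).add
    (((InSpan.mul (htr c) (h0 a b)).add (InSpan.mul (htr b) (h0 c a))).add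
      (InSpan.mul (htr a) (h0 b c)))
  refine h1.congr fun q hq ↦ ?_
  have hp := hWe hq
  have dX : MatDiffAt e q X := fun a b ↦ (hX a b).diffAt he hW hq hp
  have dY : MatDiffAt e q Y :=
    ((g.matDiffAt_upMat he hp).cx.mul dX).mul (g.matDiffAt_upMat he hp).cx
  have dv : DiffAt e q (fun q ↦ ε.vol e q) :=
    SmoothOn.diffAt he (smoothOn_vol ε he) e.open_source hp hp
  have hpd : ∀ m, pdMat e m X q = (Complex.I * (ε.vol e q : ℂ)) • flatDual (pdMat e m Y q)
      + ((g.conn e m q).trace : ℂ) • X q := by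
    intro m
    rw [pdMat_congr_of_eqOn hW hq hp (Y := fun q ↦ (Complex.I * (ε.vol e q : ℂ)) • flatDual (Y q))
      (fun x hx ↦ (hsd x hx).trans (by rw [hodge, smul_smul])),
      pdMat_smul hp ((DiffAt.const _).mul dv.ofReal) dY.flatDual, pdMat_flatDual,
      pd_const_mul _ dv.ofReal, pd_ofReal dv, pd_vol ε he hp]
    congr 1
    conv_rhs => rw [hsd q hq, hodge, smul_smul, smul_smul]
    congr 1
    push_cast
    ring
  have hPA : ∀ s, IsAlt (pdMat e s Y q) := by
    intro s
    have hYA : ∀ x ∈ W, IsAlt (Y x) := fun x hx ↦ isAlt_conj cx_upMat_transpose (hA x hx)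
    refine ⟨fun i ↦ ?_, fun i j ↦ ?_⟩
    · exact (pd_congr_of_eqOn hW hq hp (fun x hx ↦ (hYA x hx).diag i) s).trans (pd_const _ _)
    · exact (pd_congr_of_eqOn hW hq hp (fun x hx ↦ (hYA x hx).anti i j) s).trans (pd_neg _ _)
  have hc := flatDual_cyclic hPA a b c
  have e1 : ∀ m a b, pd e m (fun x ↦ X x a b) q = (Complex.I * (ε.vol e q : ℂ)) *
      flatDual (pdMat e m Y q) a b + ((g.conn e m q).trace : ℂ) * X q a b := by
    intro m a b
    exact congrFun (congrFun (hpd m) a) b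
  rw [e1, e1, e1]
  have e2 : ∑ r, (lc a b c r : ℂ) * ∑ s, pdMat e s Y q r s =
    ∑ r, (lc a b c r : ℂ) * ∑ s, pd e s (fun x ↦ Y x r s) q := rfl
  rw [← e2]
  linear_combination (Complex.I * (ε.vol e q : ℂ)) * hc

end SelfDualSystem

end LorentzMetric

namespace LorentzMetric

/-! ### The wave equation for a two-form. -/

section Wave

variable {M : Type*} [TopologicalSpace M] [ChartedSpace E4 M] [IsManifold (𝓡 4) ∞ M]
  {g : LorentzMetric M} (ε : g.VolumeForm) {e : OpenPartialHomeomorph M E4} {W : Set M}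
  {ι κ : Type*} [Fintype ι] [Fintype κ] {G : ι → M → ℂ} {H : κ → M → ℂ}
  {X : M → Matrix (Fin 4) (Fin 4) ℂ}

/-- Up to lower order terms, a closed two-form with vanishing divergence solves the wave
equation. -/
theorem inSpan_wave (he : e ∈ IsManifold.maximalAtlas (𝓡 4) ∞ M) (hW : IsOpen W)
    (hWe : W ⊆ e.source) (hX : ∀ a b, SmoothOn W (fun q ↦ X q a b))
    (hA : ∀ q ∈ W, IsAlt (X q)) (hG : ∀ i, SmoothOn W (G i))
    (h0 : ∀ a b, InSpan W G (fun q ↦ X q a b))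
    (hdiv : ∀ b, InSpan W G (fun q ↦ ∑ k, ∑ n, (g.up e q k n : ℂ) * pd e k (fun x ↦ X x n b) q))
    (hcyc : ∀ a b c, InSpan W G (fun q ↦ pd e c (fun x ↦ X x a b) q + pd e b (fun x ↦ X x c a) q
      + pd e a (fun x ↦ X x b c) q))
    (hGH : ∀ i, InSpan W H (G i)) (hpdH : ∀ i m, InSpan W H (pd e m (G i))) (a b : Fin 4) :
    InSpan W H (fun q ↦ ∑ k, ∑ n, (g.up e q k n : ℂ) *
      pd e k (pd e n (fun x ↦ X x a b)) q) := by
  have hup : ∀ i j, SmoothOn W (fun q ↦ (g.up e q i j : ℂ)) := fun i j ↦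
    SmoothOn.ofReal ((g.smoothOn_up he i j).mono hWe)
  have key : ∀ {f : M → ℂ}, InSpan W G f → ∀ m, InSpan W H (pd e m f) := fun hf m ↦
    hf.pd he hW hWe hG hGH m fun i ↦ hpdH i m
  -- The contracted derivative of the cyclic sum: the wave operator on `X a b` plus two terms with
  -- mixed second derivatives.
  have h1 := InSpan.sum (s := Finset.univ) fun k _ ↦ InSpan.sum (s := Finset.univ) fun n _ ↦
    InSpan.mul (hup k n) (key (hcyc a b n) k)
  -- The derivative of the divergence, minus the terms where it falls on the inverse metric. As
  -- partial derivatives commute, these are the mixed terms to be removed from `h1`.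
  have h2 := fun a b ↦ (key (hdiv a) b).sub (InSpan.sum (s := Finset.univ) fun k _ ↦
    InSpan.sum (s := Finset.univ) fun n _ ↦ InSpan.mul ((hup k n).pd he hW hWe b) (key (h0 n a) k))
  refine ((h1.sub (h2 a b)).add (h2 b a)).congr fun q hq ↦ ?_
  have hp := hWe hq
  have dX : ∀ m a b, DiffAt e q (pd e m (fun x ↦ X x a b)) := fun m a b ↦
    ((hX a b).pd he hW hWe m).diffAt he hW hq hp
  have du : ∀ a b, DiffAt e q (fun x ↦ (g.up e x a b : ℂ)) := fun a b ↦
    (hup a b).diffAt he hW hq hp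
  have e1 : ∀ a b, pd e b (fun q ↦ ∑ k, ∑ n, (g.up e q k n : ℂ) * pd e k (fun x ↦ X x n a) q) q
      = ∑ k, ∑ n, ((g.up e q k n : ℂ) * pd e k (pd e b (fun x ↦ X x n a)) q
        + pd e b (fun x ↦ (g.up e x k n : ℂ)) q * pd e k (fun x ↦ X x n a) q) := by
    intro a b
    rw [pd_sum fun k _ ↦ DiffAt.sum fun n _ ↦ (du k n).mul (dX k n a)]
    refine Finset.sum_congr rfl fun k _ ↦ ?_
    rw [pd_sum fun n _ ↦ (du k n).mul (dX k n a)]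
    refine Finset.sum_congr rfl fun n _ ↦ ?_
    rw [pd_mul hp (du k n) (dX k n a), pd_comm he (hX n a) hW hq hp]
  have e2 : ∀ k n, pd e k (fun q ↦ pd e n (fun x ↦ X x a b) q + pd e b (fun x ↦ X x n a) q
      + pd e a (fun x ↦ X x b n) q) q = pd e k (pd e n (fun x ↦ X x a b)) q
      + pd e k (pd e b (fun x ↦ X x n a)) q - pd e k (pd e a (fun x ↦ X x n b)) q := by
    intro k n
    rw [pd_add ((dX n a b).add (dX b n a)) (dX a b n), pd_add (dX n a b) (dX b n a),
      sub_eq_add_neg, ← pd_neg (pd e a (fun x ↦ X x n b))]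
    congr 1
    refine pd_congr_of_eqOn hW hq hp (fun y hy ↦ ?_) k
    rw [← pd_neg (fun x ↦ X x n b)]
    exact pd_congr_of_eqOn hW hy (hWe hy) (fun x hx ↦ (hA x hx).anti b n) a
  simp only [e1, e2, mul_add, mul_sub, Finset.sum_add_distrib, Finset.sum_sub_distrib]
  ring

end Wave

/-! ### The wave equation for `𝓢` in a chart. -/

section MarsSimon

variable {M : Type*} [TopologicalSpace M] [ChartedSpace E4 M] [IsManifold (𝓡 4) ∞ M]
  {g : LorentzMetric M} (ε : g.VolumeForm) {T : ∀ p : M, TangentSpace (𝓡 4) p}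
  {e : OpenPartialHomeomorph M E4} {p : M} {σ : M → ℂ}

theorem isAlt_sMat (hvac : g.IsVacuum) (hT : g.IsKilling T)
    (he : e ∈ IsManifold.maximalAtlas (𝓡 4) ∞ M) (hp : p ∈ e.source) (a b : Fin 4) :
    IsAlt (sMat ε T σ e p a b) := by
  unfold sMat qMat
  rw [sub_eq_add_neg, ← neg_smul]
  exact (isAlt_rMat ε hvac he hp a b).add
    ((((isAlt_fMat ε hT he hp).smul _).add ((isAlt_iMat ε he hp a b).smul _)).smul _)

theorem sMat_eq_hodge (hvac : g.IsVacuum) (hT : g.IsKilling T)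
    (he : e ∈ IsManifold.maximalAtlas (𝓡 4) ∞ M) (hp : p ∈ e.source) (a b : Fin 4) :
    sMat ε T σ e p a b =
      Complex.I • hodge (ε.vol e p : ℂ) (cx (g.upMat e p)) (sMat ε T σ e p a b) := by
  unfold sMat qMat
  rw [hodge_add, hodge_smul, hodge_sub, hodge_smul, hodge_smul]
  conv_lhs => rw [rMat_eq_hodge ε hvac he hp, iMat_eq_hodge ε he hp,
    show fMat ε T e p a b • fMat ε T e p = fMat ε T e p a b • (Complex.I • hodge (ε.vol e p : ℂ)
      (cx (g.upMat e p)) (fMat ε T e p)) by rw [← fMat_eq_hodge ε hT he hp]]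
  module

theorem rMat_pair_symm (hvac : g.IsVacuum) (he : e ∈ IsManifold.maximalAtlas (𝓡 4) ∞ M)
    (hp : p ∈ e.source) (a b c d : Fin 4) : rMat ε e p a b c d = rMat ε e p c d a b := by
  have e1 : ∀ a b c d, rMat ε e p a b c d = (g.riemann e p a b c d : ℂ)
      + Complex.I * (dualCurv ε e p a b c d : ℂ) := by
    intro a b c d
    rw [rMat_eq ε hvac he hp, sd, selfDual, ← cx_hodge]
    rfl
  rw [e1, e1, g.riemann_pair_symm he hp, dualCurv_pair_symm ε hvac he hp]

/-- The divergence is computed on the first index pair, whereas the self-dual calculus acts on the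
last; this symmetry connects them. -/
theorem sMat_pair_symm (hvac : g.IsVacuum) (he : e ∈ IsManifold.maximalAtlas (𝓡 4) ∞ M)
    (hp : p ∈ e.source) (a b c d : Fin 4) :
    sMat ε T σ e p a b c d = sMat ε T σ e p c d a b := by
  simp only [sMat, qMat, Matrix.add_apply, Matrix.sub_apply, Matrix.smul_apply, smul_eq_mul,
    rMat_pair_symm ε hvac he hp a b, iMat_pair_symm ε he hp a b, mul_comm (fMat ε T e p a b)]

theorem nab4_apply (X : M → Fin 4 → Fin 4 → Matrix (Fin 4) (Fin 4) ℂ) (m a b c d : Fin 4) :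
    g.nab4 e m X p a b c d = pd e m (fun q ↦ X q a b c d) p
      - ∑ n, (g.christoffel e p n m c : ℂ) * X p a b n d
      - ∑ n, (g.christoffel e p n m d : ℂ) * X p a b c n
      - ∑ n, (g.christoffel e p n m a : ℂ) * X p n b c d
      - ∑ n, (g.christoffel e p n m b : ℂ) * X p a n c d := by
  rw [Finset.sum_congr rfl fun n _ ↦ mul_comm (g.christoffel e p n m d : ℂ) _]
  simp only [nab4, nab2, Matrix.sub_apply, Matrix.mul_apply, Matrix.transpose_apply, cx_apply, conn,
    Matrix.of_apply, Matrix.sum_apply, Matrix.smul_apply, smul_eq_mul]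
  rfl

theorem formInner_eq_sum_mul (h A B : Matrix (Fin 4) (Fin 4) ℂ) :
    formInner h A B = ∑ r, ∑ s, -(∑ m, ∑ n, h s m * B m n * h n r) * A r s := by
  rw [formInner, Matrix.mul_assoc, Matrix.mul_assoc, Matrix.trace]
  simp only [Matrix.diag_apply, Matrix.mul_apply, Finset.mul_sum, ← Finset.sum_neg_distrib,
    Finset.sum_mul]
  refine Finset.sum_congr rfl fun r _ ↦ Finset.sum_congr rfl fun s _ ↦
    Finset.sum_congr rfl fun m _ ↦ Finset.sum_congr rfl fun n _ ↦ by ring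

/-- In a chart, the divergence of the Mars–Simon tensor is a combination of its components. -/
theorem inSpan_div_sMat (hvac : g.IsVacuum) (hT : g.IsKilling T) (hσ : g.IsErnstPotential T ε σ)
    (he : e ∈ IsManifold.maximalAtlas (𝓡 4) ∞ M) (c d b : Fin 4) :
    InSpan (e.source ∩ {q | σ q ≠ 1}) (fun (I : Fin 4 → Fin 4) q ↦ g.marsSimon T ε σ e q I)
      (fun q ↦ ∑ k, ∑ n, (g.up e q k n : ℂ) * pd e k (fun x ↦ sMat ε T σ e x c d n b) q) := by
  set W := e.source ∩ {q | σ q ≠ 1} with hWdef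
  have hW : IsOpen W := e.open_source.inter (isOpen_ne_one ε hσ)
  have hWe : W ⊆ e.source := Set.inter_subset_left
  have h0 : ∀ a b c d, InSpan W (fun (I : Fin 4 → Fin 4) q ↦ g.marsSimon T ε σ e q I)
      (fun q ↦ sMat ε T σ e q a b c d) := fun a b c d ↦
    InSpan.gen (G := fun (I : Fin 4 → Fin 4) q ↦ g.marsSimon T ε σ e q I) ![a, b, c, d]
  have hup : ∀ i j, SmoothOn W (fun q ↦ (g.up e q i j : ℂ)) := fun i j ↦
    SmoothOn.ofReal ((g.smoothOn_up he i j).mono hWe)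
  have hchr : ∀ i j k, SmoothOn W (fun q ↦ (g.christoffel e q i j k : ℂ)) := fun i j k ↦
    SmoothOn.ofReal ((g.smoothOn_christoffel he i j k).mono hWe)
  have ht : ∀ a, SmoothOn W (fun q ↦ (coframe e q a (T q) : ℂ)) := fun a ↦
    SmoothOn.ofReal ((smoothOn_coframe hT.1 he a).mono hWe)
  have hf : ∀ a b, SmoothOn W (fun q ↦ fMat ε T e q a b) := fun a b ↦
    (smoothOn_FF ε hT he a b).mono hWe
  have hi : ∀ a b c d, SmoothOn W (fun q ↦ iMat ε e q a b c d) := fun a b c d ↦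
    (smoothOn_II ε he a b c d).mono hWe
  have hl : SmoothOn W (msFactor σ) := (smoothOn_msFactor ε hσ).mono Set.inter_subset_right
  have hform : ∀ a k, InSpan W (fun (I : Fin 4 → Fin 4) q ↦ g.marsSimon T ε σ e q I)
      (fun q ↦ formInner (cx (g.upMat e q)) (sMat ε T σ e q a k) (fMat ε T e q)) := by
    intro a k
    simp only [formInner_eq_sum_mul]
    exact InSpan.sum fun r _ ↦ InSpan.sum fun s _ ↦ InSpan.mul (SmoothOn.neg (SmoothOn.sum fun m _ ↦
      SmoothOn.sum fun n _ ↦ SmoothOn.mul (SmoothOn.mul (hup _ _) (hf _ _)) (hup _ _))) (h0 a k r s)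
  -- The first term is the covariant divergence from `sum_up_nab4_sMat`; the Christoffel terms
  -- convert covariant into partial derivatives.
  have h1 : InSpan W (fun (I : Fin 4 → Fin 4) q ↦ g.marsSimon T ε σ e q I) (fun q ↦
      msFactor σ q * ∑ k, ∑ n, ∑ a, ((g.up e q k n : ℂ) * (coframe e q a (T q) : ℂ)) *
        (fMat ε T e q n b * sMat ε T σ e q a k c d
          - iMat ε e q n b c d * (2 / 3 * formInner (cx (g.upMat e q)) (sMat ε T σ e q a k)
            (fMat ε T e q)))
      + ∑ k, ∑ n, (g.up e q k n : ℂ) * (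
        ∑ m, (g.christoffel e q m k c : ℂ) * sMat ε T σ e q n b m d
        + ∑ m, (g.christoffel e q m k d : ℂ) * sMat ε T σ e q n b c m
        + ∑ m, (g.christoffel e q m k n : ℂ) * sMat ε T σ e q m b c d
        + ∑ m, (g.christoffel e q m k b : ℂ) * sMat ε T σ e q n m c d)) := by
    refine InSpan.add (InSpan.mul hl (InSpan.sum fun k _ ↦ InSpan.sum fun n _ ↦ InSpan.sum fun a _ ↦
      InSpan.mul (SmoothOn.mul (hup k n) (ht a)) ((InSpan.mul (hf n b) (h0 a k c d)).sub
        (InSpan.mul (hi n b c d) (InSpan.mul (SmoothOn.const _) (hform a k)))))) ?_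
    exact InSpan.sum fun k _ ↦ InSpan.sum fun n _ ↦ InSpan.mul (hup k n)
      ((((InSpan.sum fun m _ ↦ InSpan.mul (hchr _ _ _) (h0 _ _ _ _)).add
        (InSpan.sum fun m _ ↦ InSpan.mul (hchr _ _ _) (h0 _ _ _ _))).add
        (InSpan.sum fun m _ ↦ InSpan.mul (hchr _ _ _) (h0 _ _ _ _))).add
        (InSpan.sum fun m _ ↦ InSpan.mul (hchr _ _ _) (h0 _ _ _ _)))
  refine h1.congr fun q hq ↦ ?_
  have key := congrFun (congrFun (sum_up_nab4_sMat ε hvac hT hσ he (hWe hq) hq.2 b) c) d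
  simp only [Matrix.sum_apply, Matrix.smul_apply, smul_eq_mul, nab4_apply, cx_apply,
    Matrix.sub_apply] at key
  have e1 : ∀ k n, pd e k (fun x ↦ sMat ε T σ e x c d n b) q =
      pd e k (fun x ↦ sMat ε T σ e x n b c d) q := fun k n ↦
    pd_congr_of_eqOn e.open_source (hWe hq) (hWe hq)
      (fun x hx ↦ sMat_pair_symm ε hvac he hx c d n b) k
  simp only [e1]
  rw [← sub_eq_iff_eq_add]
  refine Eq.trans ?_ (key.trans ?_)
  · rw [← Finset.sum_sub_distrib]
    refine Finset.sum_congr rfl fun k _ ↦ ?_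
    rw [← Finset.sum_sub_distrib]
    refine Finset.sum_congr rfl fun n _ ↦ ?_
    simp only [upMat, Matrix.of_apply]
    ring
  · congr 1
    refine Finset.sum_congr rfl fun k _ ↦ Finset.sum_congr rfl fun n _ ↦
      Finset.sum_congr rfl fun a _ ↦ ?_
    simp only [upMat, Matrix.of_apply]
    ring

/-- In a chart, the Mars–Simon tensor solves a linear wave equation. -/
theorem inSpan_box_marsSimon (hvac : g.IsVacuum) (hT : g.IsKilling T)
    (hσ : g.IsErnstPotential T ε σ) (he : e ∈ IsManifold.maximalAtlas (𝓡 4) ∞ M)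
    (I : Fin 4 → Fin 4) :
    InSpan (e.source ∩ {q | σ q ≠ 1})
      (Sum.elim (fun (J : Fin 5 → Fin 4) q ↦ g.covD e (g.marsSimon T ε σ e) q J)
        (fun (J : Fin 4 → Fin 4) q ↦ g.marsSimon T ε σ e q J))
      (fun q ↦ g.box e (g.marsSimon T ε σ e) q I) := by
  set W := e.source ∩ {q | σ q ≠ 1} with hWdef
  set S := g.marsSimon T ε σ e with hS
  set H : (Fin 5 → Fin 4) ⊕ (Fin 4 → Fin 4) → M → ℂ :=
    Sum.elim (fun (J : Fin 5 → Fin 4) q ↦ g.covD e S q J) (fun (J : Fin 4 → Fin 4) q ↦ S q J)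
    with hH
  have hW : IsOpen W := e.open_source.inter (isOpen_ne_one ε hσ)
  have hWe : W ⊆ e.source := Set.inter_subset_left
  have hup : ∀ i j, SmoothOn W (fun q ↦ (g.up e q i j : ℂ)) := fun i j ↦
    SmoothOn.ofReal ((g.smoothOn_up he i j).mono hWe)
  have hchr : ∀ i j k, SmoothOn W (fun q ↦ (g.christoffel e q i j k : ℂ)) := fun i j k ↦
    SmoothOn.ofReal ((g.smoothOn_christoffel he i j k).mono hWe)
  have hSs : ∀ J, SmoothOn W (fun q ↦ S q J) := fun J ↦ smoothOn_sMat ε hT hσ he _ _ _ _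
  have hSH : ∀ J, InSpan W H (fun q ↦ S q J) := fun J ↦ InSpan.gen (G := H) (Sum.inr J)
  have hDH : ∀ J, InSpan W H (fun q ↦ g.covD e S q J) := fun J ↦ InSpan.gen (G := H) (Sum.inl J)
  -- A partial derivative is the covariant one plus Christoffel symbols times components of `𝓢`.
  have hpdH : ∀ J m, InSpan W H (pd e m (fun q ↦ S q J)) := by
    intro J m
    refine ((hDH (Fin.cons m J)).add (InSpan.sum (s := Finset.univ) fun a _ ↦
      InSpan.sum (s := Finset.univ) fun n _ ↦ InSpan.mul (hchr n m (J a))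
        (hSH (Function.update J a n)))).congr fun q _ ↦ ?_
    simp [covD]
  -- The principal part: with `J 0` and `J 1` frozen, `𝓢` is a self-dual two-form whose divergence
  -- lies in the span of `𝓢`.
  have hpd2 : ∀ J, InSpan W H (fun q ↦ ∑ k, ∑ n, (g.up e q k n : ℂ) *
      pd e k (pd e n (fun x ↦ S x J)) q) := by
    intro J
    have hX := fun a b ↦ smoothOn_sMat ε (e := e) hT hσ he (J 0) (J 1) a b
    have hA := fun q (hq : q ∈ W) ↦ isAlt_sMat ε (σ := σ) hvac hT he (hWe hq) (J 0) (J 1)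
    have h0 : ∀ a b, InSpan W (fun (I : Fin 4 → Fin 4) q ↦ g.marsSimon T ε σ e q I)
      (fun q ↦ sMat ε T σ e q (J 0) (J 1) a b) := fun a b ↦
        InSpan.gen (G := fun (I : Fin 4 → Fin 4) q ↦ g.marsSimon T ε σ e q I) ![J 0, J 1, a, b]
    have hdiv := inSpan_div_sMat ε hvac hT hσ he (J 0) (J 1)
    have hcyc := inSpan_cyclic ε he hW hWe hX hA
      (fun q hq ↦ sMat_eq_hodge ε hvac hT he (hWe hq) _ _) h0 hdiv
    exact inSpan_wave he hW hWe hX hA hSs h0 hdiv hcyc hSH hpdH (J 2) (J 3)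
  -- The other terms of the two expanded covariant derivatives contain at most one derivative of
  -- `𝓢`.
  have h1 := ((hpd2 I).sub (InSpan.sum (s := Finset.univ) fun k _ ↦ InSpan.sum (s := Finset.univ)
    fun n _ ↦ InSpan.mul (hup k n) (InSpan.sum (s := Finset.univ) fun a _ ↦
      InSpan.sum (s := Finset.univ) fun m _ ↦ (InSpan.mul (hchr m n (I a))
        (hpdH (Function.update I a m) k)).add (InSpan.mul ((hchr m n (I a)).pd he hW hWe k)
          (hSH (Function.update I a m)))))).sub
    (InSpan.sum (s := Finset.univ) fun k _ ↦ InSpan.sum (s := Finset.univ)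
    fun n _ ↦ InSpan.mul (hup k n) (InSpan.sum (s := Finset.univ) fun a _ ↦
      InSpan.sum (s := Finset.univ) fun m _ ↦ InSpan.mul
        (hchr m k ((Fin.cons n I : Fin 5 → Fin 4) a))
        (hDH (Function.update (Fin.cons n I) a m))))
  refine h1.congr fun q hq ↦ ?_
  have hp := hWe hq
  have dS : ∀ J, DiffAt e q (fun x ↦ S x J) := fun J ↦ (hSs J).diffAt he hW hq hp
  have dc : ∀ i j k, DiffAt e q (fun x ↦ (g.christoffel e x i j k : ℂ)) := fun i j k ↦
    (hchr i j k).diffAt he hW hq hp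
  have dpS : ∀ m J, DiffAt e q (pd e m (fun x ↦ S x J)) := fun m J ↦
    ((hSs J).pd he hW hWe m).diffAt he hW hq hp
  have e1 : ∀ k n, pd e k (fun x ↦ g.covD e S x (Fin.cons n I)) q =
      pd e k (pd e n (fun x ↦ S x I)) q - ∑ a, ∑ m,
        ((g.christoffel e q m n (I a) : ℂ) * pd e k (fun x ↦ S x (Function.update I a m)) q
        + pd e k (fun x ↦ (g.christoffel e x m n (I a) : ℂ)) q * S q (Function.update I a m)) := by
    intro k n
    have : (fun x ↦ g.covD e S x (Fin.cons n I)) = fun x ↦ pd e n (fun x ↦ S x I) x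
        - ∑ a, ∑ m, (g.christoffel e x m n (I a) : ℂ) * S x (Function.update I a m) := by
      funext x
      simp [covD]
    rw [this, pd_sub (dpS n I) (DiffAt.sum fun a _ ↦ DiffAt.sum fun m _ ↦ (dc _ _ _).mul (dS _)),
      pd_sum fun a _ ↦ DiffAt.sum fun m _ ↦ (dc _ _ _).mul (dS _)]
    congr 1
    refine Finset.sum_congr rfl fun a _ ↦ ?_
    rw [pd_sum fun m _ ↦ (dc _ _ _).mul (dS _)]
    exact Finset.sum_congr rfl fun m _ ↦ pd_mul hp (dc _ _ _) (dS _) k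
  have e2 : ∀ k n, g.covD e (g.covD e S) q (Fin.cons k (Fin.cons n I)) =
      pd e k (fun x ↦ g.covD e S x (Fin.cons n I)) q - ∑ a, ∑ m,
        (g.christoffel e q m k ((Fin.cons n I : Fin 5 → Fin 4) a) : ℂ) *
          g.covD e S q (Function.update (Fin.cons n I) a m) := by
    intro k n
    conv_lhs => rw [covD]
    simp
  unfold box
  simp only [e2, e1, Complex.real_smul, mul_sub, Finset.sum_sub_distrib]

end MarsSimon

end LorentzMetric

namespace Spacetime

/-! ### Jacobian matrices of chart changes. -/

section Jacobian

variable {M : Type*} [TopologicalSpace M] [ChartedSpace E4 M] [IsManifold (𝓡 4) ∞ M]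
  {e e' : OpenPartialHomeomorph M E4} {p : M}

/-- The Jacobian matrix of the change of charts from `e'` to `e`. -/
noncomputable def jacMat (e e' : OpenPartialHomeomorph M E4) (p : M) :
    Matrix (Fin 4) (Fin 4) ℝ := Matrix.of (jac e e' p)

theorem jacMat_mul_jacMat (he : e ∈ IsManifold.maximalAtlas (𝓡 4) ∞ M)
    (he' : e' ∈ IsManifold.maximalAtlas (𝓡 4) ∞ M) (hp : p ∈ e.source) (hp' : p ∈ e'.source) :
    jacMat e e' p * jacMat e' e p = 1 := by
  ext i k
  rw [Matrix.mul_apply, Matrix.one_apply]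
  exact sum_jac_mul_jac he he' hp hp' i k

theorem matDiffAt_jacMat (he : e ∈ IsManifold.maximalAtlas (𝓡 4) ∞ M)
    (he' : e' ∈ IsManifold.maximalAtlas (𝓡 4) ∞ M) (hp : p ∈ e.source) (hp' : p ∈ e'.source) :
    MatDiffAt e' p (jacMat e e') := fun i j ↦
  (smoothOn_jac he he' i j).diffAt he' (e.open_source.inter e'.open_source) ⟨hp, hp'⟩ hp'

theorem pdMat_chain (he : e ∈ IsManifold.maximalAtlas (𝓡 4) ∞ M)
    (he' : e' ∈ IsManifold.maximalAtlas (𝓡 4) ∞ M) (hp : p ∈ e.source) (hp' : p ∈ e'.source)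
    {X : M → Matrix (Fin 4) (Fin 4) ℝ} (hX : MatDiffAt e p X) (j : Fin 4) :
    pdMat e' j X p = ∑ i, jac e e' p i j • pdMat e i X p := by
  ext a b
  simp only [pdMat, Matrix.of_apply, Matrix.sum_apply, Matrix.smul_apply]
  exact pd_chain he he' hp hp' (hX a b) j

theorem DiffAt.of_chart (he : e ∈ IsManifold.maximalAtlas (𝓡 4) ∞ M)
    (he' : e' ∈ IsManifold.maximalAtlas (𝓡 4) ∞ M) (hp : p ∈ e.source) (hp' : p ∈ e'.source)
    {V : Type*} [NormedAddCommGroup V] [NormedSpace ℝ V] {f : M → V} (hf : DiffAt e p f) :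
    DiffAt e' p f := by
  have h1 : MDifferentiableAt (𝓡 4) 𝓘(ℝ, V) (f ∘ e.symm) (e p) :=
    DifferentiableAt.mdifferentiableAt hf
  have h2 : MDifferentiableAt (𝓡 4) 𝓘(ℝ, V) f p := by
    refine (h1.comp p ((mdifferentiable_of_mem_maximalAtlas he).mdifferentiableAt hp)
      ).congr_of_eventuallyEq ?_
    filter_upwards [e.open_source.mem_nhds hp] with q hq
    simp [e.left_inv hq]
  have h3 := (mdifferentiable_of_mem_maximalAtlas he').mdifferentiableAt_symm
    (e'.map_source hp')
  refine (MDifferentiableAt.comp (e' p) (I' := 𝓡 4) ?_ h3).differentiableAt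
  rw [e'.left_inv hp']
  exact h2

end Jacobian

/-- A three-index array that is symmetric in one pair of indices and antisymmetric in another
vanishes. -/
theorem eq_zero_of_symm_of_anti {E : Fin 4 → Fin 4 → Fin 4 → ℝ}
    (h1 : ∀ m a b, E m a b = E b a m) (h2 : ∀ m a b, E m a b = - E m b a) (m a b : Fin 4) :
    E m a b = 0 := by
  have e1 := h1 m a b
  have e2 := h2 b a m
  have e3 := h1 b m a
  have e4 := h2 a m b
  have e5 := h1 a b m
  have e6 := h2 m b a
  linarith

end Spacetime

namespace LorentzMetric

/-! ### Transformation of the metric, the connection and the curvature. -/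

section Transformation

variable {M : Type*} [TopologicalSpace M] [ChartedSpace E4 M] [IsManifold (𝓡 4) ∞ M]
  (g : LorentzMetric M) {e e' : OpenPartialHomeomorph M E4} {p : M}

theorem loMat_change (he : e ∈ IsManifold.maximalAtlas (𝓡 4) ∞ M) (hp : p ∈ e.source) :
    g.loMat e' p = (jacMat e e' p).transpose * g.loMat e p * jacMat e e' p := by
  ext a b
  simp only [loMat, Matrix.of_apply, lo, Matrix.mul_apply, Matrix.transpose_apply, jacMat]
  rw [frame_eq_sum_jac (e := e) (e' := e') he hp a, frame_eq_sum_jac (e := e) (e' := e') he hp b]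
  simp only [map_sum, sum_apply, map_smul, smul_apply,
    smul_eq_mul, Finset.mul_sum, Finset.sum_mul]
  exact Finset.sum_congr rfl fun i _ ↦ Finset.sum_congr rfl fun j _ ↦ by ring

theorem upMat_change (he : e ∈ IsManifold.maximalAtlas (𝓡 4) ∞ M)
    (he' : e' ∈ IsManifold.maximalAtlas (𝓡 4) ∞ M) (hp : p ∈ e.source) (hp' : p ∈ e'.source) :
    g.upMat e' p = jacMat e' e p * g.upMat e p * (jacMat e' e p).transpose := by
  have h1 := jacMat_mul_jacMat he he' hp hp'
  have h2 := jacMat_mul_jacMat he' he hp' hp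
  have h3 := g.upMat_mul_loMat he hp
  have h4 := g.upMat_mul_loMat he' hp'
  have h5 : (jacMat e' e p).transpose * (jacMat e e' p).transpose = 1 := by
    rw [← Matrix.transpose_mul, h1, Matrix.transpose_one]
  have h6 : jacMat e' e p * g.upMat e p * (jacMat e' e p).transpose * g.loMat e' p = 1 := by
    rw [g.loMat_change (e' := e') he hp]
    calc _ = jacMat e' e p * (g.upMat e p * ((jacMat e' e p).transpose *
          (jacMat e e' p).transpose) * g.loMat e p) * jacMat e e' p := by noncomm_ring
      _ = 1 := by rw [h5, mul_one, h3, mul_one, h2]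
  have h7 : g.loMat e' p * g.upMat e' p = 1 := g.loMat_mul_upMat he' hp'
  calc g.upMat e' p = (jacMat e' e p * g.upMat e p * (jacMat e' e p).transpose * g.loMat e' p) *
        g.upMat e' p := by rw [h6, one_mul]
    _ = _ := by rw [Matrix.mul_assoc _ (g.loMat e' p), h7, mul_one]

/-- The connection matrices in the chart `e`, along the coordinate fields of the chart `e'`. -/
noncomputable def connAlong (e e' : OpenPartialHomeomorph M E4) (m : Fin 4) (p : M) :
    Matrix (Fin 4) (Fin 4) ℝ := ∑ n, jac e e' p n m • g.conn e n p

/-- The transformation law of the Levi-Civita connection. -/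
theorem jacMat_mul_conn (he : e ∈ IsManifold.maximalAtlas (𝓡 4) ∞ M)
    (he' : e' ∈ IsManifold.maximalAtlas (𝓡 4) ∞ M) (hp : p ∈ e.source) (hp' : p ∈ e'.source)
    (m : Fin 4) : jacMat e e' p * g.conn e' m p =
      pdMat e' m (jacMat e e') p + g.connAlong e e' m p * jacMat e e' p := by
  have hW := e.open_source.inter e'.open_source
  have dJ := matDiffAt_jacMat he he' hp hp'
  have dg : MatDiffAt e' p (g.loMat e) := fun i j ↦
    DiffAt.of_chart he he' hp hp' (g.matDiffAt_loMat he hp i j)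
  -- The defect of the claimed law. It vanishes by the argument for uniqueness of the Levi-Civita
  -- connection: no torsion (`hDs`) and compatibility with the metric (`hcompat`).
  set D : Fin 4 → Matrix (Fin 4) (Fin 4) ℝ := fun m ↦ jacMat e e' p * g.conn e' m p -
    (pdMat e' m (jacMat e e') p + g.connAlong e e' m p * jacMat e e' p) with hD
  have hDs : ∀ m n a, D m n a = D a n m := by
    intro m n a
    have e1 : ∀ m n a, (jacMat e e' p * g.conn e' m p) n a =
        ∑ k, jac e e' p n k * g.christoffel e' p k m a := fun m n a ↦ Matrix.mul_apply
    have e2 : ∀ m n a, (g.connAlong e e' m p * jacMat e e' p) n a =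
        ∑ k, ∑ l, jac e e' p l m * g.christoffel e p n l k * jac e e' p k a := by
      intro m n a
      simp only [connAlong, Matrix.mul_apply, Matrix.sum_apply, Matrix.smul_apply, smul_eq_mul,
        Finset.sum_mul]
      rfl
    have e3 : pdMat e' m (jacMat e e') p n a = pdMat e' a (jacMat e e') p n m :=
      pd_jac_symm he he' hp hp' n a m
    simp only [hD, Matrix.sub_apply, Matrix.add_apply, e1, e2, e3]
    congr 1
    · exact Finset.sum_congr rfl fun k _ ↦ by rw [g.christoffel_symm]
    · congr 1
      rw [Finset.sum_comm]
      exact Finset.sum_congr rfl fun k _ ↦ Finset.sum_congr rfl fun l _ ↦ by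
        rw [g.christoffel_symm n k l]; ring
  -- Differentiate `g' = Jᵀ g J` and use metric compatibility in both charts.
  have hcompat : ∀ m, (D m).transpose * g.loMat e p * jacMat e e' p +
      (jacMat e e' p).transpose * g.loMat e p * D m = 0 := by
    intro m
    have h1 := g.pdMat_loMat he' hp' m
    have h2 : pdMat e' m (g.loMat e) p = (g.connAlong e e' m p).transpose * g.loMat e p
        + g.loMat e p * g.connAlong e e' m p := by
      rw [pdMat_chain he he' hp hp' (g.matDiffAt_loMat he hp)]
      simp only [g.pdMat_loMat he hp, connAlong, Matrix.transpose_sum, Matrix.transpose_smul,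
        Finset.sum_mul, Finset.mul_sum, smul_add, Finset.sum_add_distrib, Matrix.smul_mul,
        Matrix.mul_smul]
    have h3 : pdMat e' m (fun q ↦ (jacMat e e' q).transpose) p =
        (pdMat e' m (jacMat e e') p).transpose := rfl
    rw [pdMat_congr_of_eqOn hW ⟨hp, hp'⟩ hp' (fun q hq ↦ g.loMat_change (e' := e') he hq.1),
      pdMat_mul hp' (dJ.transpose.mul dg) dJ, pdMat_mul hp' dJ.transpose dg, h2, h3,
      g.loMat_change (e' := e') he hp] at h1
    simp only [hD, Matrix.transpose_sub, Matrix.transpose_add, Matrix.transpose_mul]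
    rw [← sub_eq_zero] at h1
    rw [← neg_eq_zero, ← h1]
    noncomm_ring
  -- Lowering the upper index of `D` with `Jᵀ g` gives an array symmetric in one pair of indices and
  -- antisymmetric in another.
  have hE : ∀ m a b, ((jacMat e e' p).transpose * g.loMat e p * D m) a b = 0 := by
    refine eq_zero_of_symm_of_anti (fun m a b ↦ ?_) (fun m a b ↦ ?_)
    · have : ∀ m a b, ((jacMat e e' p).transpose * g.loMat e p * D m) a b =
          ∑ k, ((jacMat e e' p).transpose * g.loMat e p) a k * D m k b := fun _ _ _ ↦
        Matrix.mul_apply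
      rw [this, this]
      exact Finset.sum_congr rfl fun k _ ↦ by rw [hDs m k b]
    · have h1 := congrFun (congrFun (hcompat m) a) b
      have h2 : ((D m).transpose * g.loMat e p * jacMat e e' p) a b =
          ((jacMat e e' p).transpose * g.loMat e p * D m) b a := by
        rw [← Matrix.transpose_apply (_ * D m)]
        simp only [Matrix.transpose_mul, Matrix.transpose_transpose, g.loMat_transpose,
          Matrix.mul_assoc]
      rw [Matrix.add_apply, h2, Matrix.zero_apply] at h1
      linarith
  have h5 : (jacMat e' e p).transpose * (jacMat e e' p).transpose = 1 := by
    rw [← Matrix.transpose_mul, jacMat_mul_jacMat he he' hp hp', Matrix.transpose_one]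
  have h6 : (jacMat e e' p).transpose * g.loMat e p * D m = 0 := by
    ext a b; exact hE m a b
  have h7 : D m = 0 := by
    calc D m = g.upMat e p * (((jacMat e' e p).transpose * (jacMat e e' p).transpose) *
          g.loMat e p) * D m := by rw [h5, one_mul, g.upMat_mul_loMat he hp, one_mul]
      _ = g.upMat e p * (jacMat e' e p).transpose *
          ((jacMat e e' p).transpose * g.loMat e p * D m) := by noncomm_ring
      _ = 0 := by rw [h6, mul_zero]
  exact sub_eq_zero.1 h7

/-- The transformation law of the curvature. -/
theorem jacMat_mul_curv (he : e ∈ IsManifold.maximalAtlas (𝓡 4) ∞ M)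
    (he' : e' ∈ IsManifold.maximalAtlas (𝓡 4) ∞ M) (hp : p ∈ e.source) (hp' : p ∈ e'.source)
    (c d : Fin 4) : jacMat e e' p * g.curv e' c d p =
      (∑ n, ∑ m, (jac e e' p n c * jac e e' p m d) • g.curv e n m p) * jacMat e e' p := by
  have hW := e.open_source.inter e'.open_source
  have dJ := matDiffAt_jacMat he he' hp hp'
  have dj : ∀ i j, DiffAt e' p (fun q ↦ jac e e' q i j) := dJ
  have dC := g.matDiffAt_conn he' hp'
  have dC' : ∀ m, MatDiffAt e' p (g.conn e m) := fun m i j ↦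
    DiffAt.of_chart he he' hp hp' (g.matDiffAt_conn he hp m i j)
  have dpJ : ∀ m, MatDiffAt e' p (pdMat e' m (jacMat e e')) := fun m i j ↦
    ((smoothOn_jac he he' i j).pd he' hW Set.inter_subset_right m).diffAt he' hW ⟨hp, hp'⟩ hp'
  have dA : ∀ m, MatDiffAt e' p (g.connAlong e e' m) := by
    intro m i j
    simp only [connAlong, Matrix.sum_apply, Matrix.smul_apply]
    exact DiffAt.sum fun n _ ↦ (dj n m).smul (dC' n i j)
  -- The derivative of the connection law. Antisymmetrising in `c` and `d` will remove the second
  -- derivatives of the Jacobian.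
  have key : ∀ c d, pdMat e' c (jacMat e e') p * g.conn e' d p
      + jacMat e e' p * pdMat e' c (g.conn e' d) p =
      pdMat e' c (pdMat e' d (jacMat e e')) p + pdMat e' c (g.connAlong e e' d) p * jacMat e e' p
      + g.connAlong e e' d p * pdMat e' c (jacMat e e') p := by
    intro c d
    rw [← pdMat_mul hp' dJ (dC d), add_assoc, ← pdMat_mul hp' (dA d) dJ,
      ← pdMat_add (dpJ d) ((dA d).mul dJ)]
    exact pdMat_congr_of_eqOn hW ⟨hp, hp'⟩ hp'
      (fun q hq ↦ g.jacMat_mul_conn he he' hq.1 hq.2 d) c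
  have hcomm : pdMat e' c (pdMat e' d (jacMat e e')) p = pdMat e' d (pdMat e' c (jacMat e e')) p :=
    pdMat_comm he' (smoothOn_jac he he') hW ⟨hp, hp'⟩ hp' c d
  have hpA : ∀ c d, pdMat e' c (g.connAlong e e' d) p = (∑ m, pd e' c
      (fun q ↦ jac e e' q m d) p • g.conn e m p) + ∑ n, ∑ m, (jac e e' p n c * jac e e' p m d) •
        pdMat e n (g.conn e m) p := by
    intro c d
    have h1 : pdMat e' c (g.connAlong e e' d) p = ∑ m, (jac e e' p m d • pdMat e' c (g.conn e m) p
        + pd e' c (fun q ↦ jac e e' q m d) p • g.conn e m p) := by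
      ext i j
      simp only [pdMat, connAlong, Matrix.of_apply, Matrix.sum_apply, Matrix.smul_apply,
        Matrix.add_apply]
      rw [pd_sum fun n _ ↦ (dj n d).smul (dC' n i j)]
      exact Finset.sum_congr rfl fun n _ ↦ pd_smul hp' (dj n d) (dC' n i j) c
    rw [h1, Finset.sum_add_distrib, add_comm]
    congr 1
    rw [Finset.sum_comm]
    refine Finset.sum_congr rfl fun m _ ↦ ?_
    rw [pdMat_chain he he' hp hp' (g.matDiffAt_conn he hp m), Finset.smul_sum]
    exact Finset.sum_congr rfl fun n _ ↦ by rw [smul_smul, mul_comm]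
  have hsym : ∑ m, pd e' c (fun q ↦ jac e e' q m d) p • g.conn e m p =
      ∑ m, pd e' d (fun q ↦ jac e e' q m c) p • g.conn e m p :=
    Finset.sum_congr rfl fun m _ ↦ by rw [pd_jac_symm he he' hp hp']
  have hprod : ∀ c d, g.connAlong e e' c p * g.connAlong e e' d p =
      ∑ n, ∑ m, (jac e e' p n c * jac e e' p m d) • (g.conn e n p * g.conn e m p) := by
    intro c d
    simp only [connAlong, Finset.sum_mul, Finset.mul_sum, Matrix.smul_mul, Matrix.mul_smul,
      smul_smul]
    rw [Finset.sum_comm]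
    exact Finset.sum_congr rfl fun n _ ↦ Finset.sum_congr rfl fun m _ ↦ by rw [mul_comm]
  have hswap : ∀ (Z : Fin 4 → Fin 4 → Matrix (Fin 4) (Fin 4) ℝ),
      ∑ n, ∑ m, (jac e e' p n d * jac e e' p m c) • Z n m =
        ∑ n, ∑ m, (jac e e' p n c * jac e e' p m d) • Z m n := by
    intro Z
    rw [Finset.sum_comm]
    exact Finset.sum_congr rfl fun n _ ↦ Finset.sum_congr rfl fun m _ ↦ by rw [mul_comm]
  -- The pulled-back connection has the pulled-back curvature: first derivatives of the Jacobian
  -- drop out by `pd_jac_symm`.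
  have hR : ∑ n, ∑ m, (jac e e' p n c * jac e e' p m d) • g.curv e n m p =
      pdMat e' c (g.connAlong e e' d) p - pdMat e' d (g.connAlong e e' c) p
        + (g.connAlong e e' c p * g.connAlong e e' d p
          - g.connAlong e e' d p * g.connAlong e e' c p) := by
    rw [hpA, hpA, hsym, hprod, hprod, hswap, hswap]
    simp only [curv_eq, smul_add, smul_sub, Finset.sum_add_distrib, Finset.sum_sub_distrib]
    abel
  rw [hR, curv_eq]
  have k1 := key c d
  have k2 := key d c
  have c1 := g.jacMat_mul_conn he he' hp hp' c
  have c2 := g.jacMat_mul_conn he he' hp hp' d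
  rw [hcomm] at k1
  generalize pdMat e' c (g.conn e' d) p = dCd at *
  generalize pdMat e' d (g.conn e' c) p = dCc at *
  generalize g.conn e' c p = Cc at *
  generalize g.conn e' d p = Cd at *
  generalize pdMat e' c (g.connAlong e e' d) p = dAd at *
  generalize pdMat e' d (g.connAlong e e' c) p = dAc at *
  generalize g.connAlong e e' c p = Ac at *
  generalize g.connAlong e e' d p = Ad at *
  generalize pdMat e' d (pdMat e' c (jacMat e e')) p = ddJ at *
  generalize pdMat e' c (jacMat e e') p = Jc at *
  generalize pdMat e' d (jacMat e e') p = Jd at *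
  generalize jacMat e e' p = J at *
  have k1' : J * dCd = ddJ + dAd * J + Ad * Jc - Jc * Cd := by rw [← k1]; abel
  have k2' : J * dCc = ddJ + dAc * J + Ac * Jd - Jd * Cc := by rw [← k2]; abel
  have c1' : J * (Cc * Cd) = Jc * Cd + Ac * Jd + Ac * Ad * J := by
    rw [← mul_assoc, c1, add_mul, mul_assoc, c2]; noncomm_ring
  have c2' : J * (Cd * Cc) = Jd * Cc + Ad * Jc + Ad * Ac * J := by
    rw [← mul_assoc, c2, add_mul, mul_assoc, c1]; noncomm_ring
  rw [mul_add, mul_sub, mul_sub, k1', k2', c1', c2']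
  noncomm_ring

end Transformation

end LorentzMetric

/-! ### Components of one tensor in two charts. -/

namespace Spacetime

theorem sum_fin_succ_arrow {k : ℕ} {V : Type*} [AddCommMonoid V] (f : (Fin (k + 1) → Fin 4) → V) :
    ∑ I, f I = ∑ m, ∑ I : Fin k → Fin 4, f (Fin.cons m I) := by
  rw [← (Fin.consEquiv fun _ : Fin (k + 1) ↦ Fin 4).sum_comp f, Fintype.sum_prod_type]
  rfl

/-- Reindexing by the involution that exchanges `I a` with `c`. -/
theorem sum_sum_update {k : ℕ} {V : Type*} [AddCommMonoid V] (a : Fin k)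
    (f : (Fin k → Fin 4) → Fin 4 → V) :
    ∑ I, ∑ c, f I c = ∑ I, ∑ c, f (Function.update I a c) (I a) := by
  rw [← Fintype.sum_prod_type', ← Fintype.sum_prod_type']
  refine Finset.sum_nbij' (fun x ↦ (Function.update x.1 a x.2, x.1 a))
    (fun x ↦ (Function.update x.1 a x.2, x.1 a)) ?_ ?_ ?_ ?_ ?_ <;> simp

section Transforms

variable {M : Type*} [TopologicalSpace M] [ChartedSpace E4 M]
  {V : Type*} [NormedAddCommGroup V] [NormedSpace ℝ V]
  {e e' : OpenPartialHomeomorph M E4} {p : M} {k : ℕ}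

/-- The arrays `x` and `x'` are the components of one covariant tensor at the point `p`, in the
charts `e` and `e'`. -/
def Transforms (e e' : OpenPartialHomeomorph M E4) (p : M) (x x' : (Fin k → Fin 4) → V) : Prop :=
  ∀ I', x' I' = ∑ I, (∏ a, jac e e' p (I a) (I' a)) • x I

theorem Transforms.toTensor_eq [IsManifold (𝓡 4) ∞ M]
    (he' : e' ∈ IsManifold.maximalAtlas (𝓡 4) ∞ M) (hp' : p ∈ e'.source)
    {x x' : (Fin k → Fin 4) → ℂ} (h : Transforms e e' p x x') :
    toTensor e p x = toTensor e' p x' := by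
  ext v
  rw [toTensor_apply, toTensor_apply]
  simp only [h _, Finset.sum_mul]
  rw [Finset.sum_comm]
  refine Finset.sum_congr rfl fun I _ ↦ ?_
  have h1 : ∏ j, (coframe e p (I j) (v j) : ℂ) = ∑ I' : Fin k → Fin 4,
      ∏ j, ((jac e e' p (I j) (I' j) : ℂ) * (coframe e' p (I' j) (v j) : ℂ)) := by
    simp only [coframe_eq_sum_jac (e := e) he' hp']
    push_cast
    rw [Finset.prod_univ_sum]
    simp
  rw [h1, Finset.mul_sum]
  refine Finset.sum_congr rfl fun I' _ ↦ ?_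
  rw [Finset.prod_mul_distrib, Complex.real_smul]
  push_cast
  ring

/-- Differentiability is part of the statement because the induction step needs it for the partial
product. -/
theorem pd_prod {ι : Type*} [DecidableEq ι] {s : Finset ι} {u : ι → M → ℝ} (hp : p ∈ e.source)
    (hu : ∀ a, DiffAt e p (u a)) (m : Fin 4) :
    DiffAt e p (fun q ↦ ∏ a ∈ s, u a q) ∧ pd e m (fun q ↦ ∏ a ∈ s, u a q) p =
      ∑ a ∈ s, (∏ b ∈ s.erase a, u b p) * pd e m (u a) p := by
  induction s using Finset.induction_on with
  | empty => simpa using DiffAt.const 1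
  | insert i s hi ih =>
    simp only [Finset.prod_insert hi, Finset.sum_insert hi, Finset.erase_insert hi]
    refine ⟨(hu i).mul ih.1, ?_⟩
    rw [pd_mul hp (hu i) ih.1, ih.2, Finset.mul_sum, add_comm, mul_comm (pd e m (u i) p)]
    congr 1
    refine Finset.sum_congr rfl fun a ha ↦ ?_
    have hne : i ≠ a := fun h ↦ hi (h ▸ ha)
    rw [Finset.erase_insert_of_ne hne, Finset.prod_insert (by simp [hi]), mul_assoc]

end Transforms

end Spacetime

namespace LorentzMetric

/-! ### Chart independence of `D` and `□`. -/

section Transformation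

variable {M : Type*} [TopologicalSpace M] [ChartedSpace E4 M] [IsManifold (𝓡 4) ∞ M]
  (g : LorentzMetric M) {V : Type*} [NormedAddCommGroup V] [NormedSpace ℝ V]
  {e e' : OpenPartialHomeomorph M E4} {p : M} {k : ℕ} {W : Set M}

theorem smoothOn_covD (he : e ∈ IsManifold.maximalAtlas (𝓡 4) ∞ M) (hW : IsOpen W)
    (hWe : W ⊆ e.source) {X : CompField M k V} (hX : ∀ I, SmoothOn W (fun q ↦ X q I))
    (I : Fin (k + 1) → Fin 4) : SmoothOn W (fun q ↦ g.covD e X q I) :=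
  SmoothOn.sub ((hX _).pd he hW hWe _) (SmoothOn.sum fun _ _ ↦ SmoothOn.sum fun n _ ↦
    SmoothOn.smul ((g.smoothOn_christoffel he n _ _).mono hWe) (hX _))

/-- The transformation law of the Christoffel symbols. -/
theorem sum_jac_mul_christoffel (he : e ∈ IsManifold.maximalAtlas (𝓡 4) ∞ M)
    (he' : e' ∈ IsManifold.maximalAtlas (𝓡 4) ∞ M) (hp : p ∈ e.source) (hp' : p ∈ e'.source)
    (n m a : Fin 4) : ∑ l, jac e e' p n l * g.christoffel e' p l m a =
      pd e' m (fun q ↦ jac e e' q n a) p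
        + ∑ r, ∑ c, jac e e' p r m * g.christoffel e p n r c * jac e e' p c a := by
  have h := congrFun (congrFun (g.jacMat_mul_conn he he' hp hp' m) n) a
  rw [Matrix.mul_apply, Matrix.add_apply, Matrix.mul_apply] at h
  refine h.trans ?_
  congr 1
  rw [Finset.sum_comm]
  simp only [connAlong, Matrix.sum_apply, Matrix.smul_apply, smul_eq_mul, Finset.sum_mul]
  rfl

/-- The covariant derivative does not depend on the chart. -/
theorem transforms_covD (he : e ∈ IsManifold.maximalAtlas (𝓡 4) ∞ M)
    (he' : e' ∈ IsManifold.maximalAtlas (𝓡 4) ∞ M) (hW : IsOpen W)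
    (hWe : W ⊆ e.source ∩ e'.source) {X X' : CompField M k V}
    (hX : ∀ I, SmoothOn W (fun q ↦ X q I)) (h : ∀ q ∈ W, Transforms e e' q (X q) (X' q))
    (hpW : p ∈ W) : Transforms e e' p (g.covD e X p) (g.covD e' X' p) := by
  have hp := (hWe hpW).1
  have hp' := (hWe hpW).2
  intro I'
  have dj : ∀ i j, DiffAt e' p (fun q ↦ jac e e' q i j) := matDiffAt_jacMat he he' hp hp'
  have dX : ∀ I, DiffAt e p (fun q ↦ X q I) := fun I ↦ (hX I).diffAt he hW hpW hp
  have dX' : ∀ I, DiffAt e' p (fun q ↦ X q I) := fun I ↦ (hX I).diffAt he' hW hpW hp'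
  set m' := I' 0
  set L := Fin.tail I' with hL
  set P : (Fin k → Fin 4) → ℝ := fun I ↦ ∏ a, jac e e' p (I a) (L a) with hP
  set Pa : Fin k → (Fin k → Fin 4) → ℝ := fun a I ↦
    ∏ b ∈ Finset.univ.erase a, jac e e' p (I b) (L b) with hPa
  have hPPa : ∀ a I, P I = jac e e' p (I a) (L a) * Pa a I := fun a I ↦
    (Finset.mul_prod_erase Finset.univ (fun a ↦ jac e e' p (I a) (L a)) (Finset.mem_univ a)).symm
  have hPau : ∀ a I c, Pa a (Function.update I a c) = Pa a I := fun a I c ↦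
    Finset.prod_congr rfl fun b hb ↦ by rw [Function.update_of_ne (Finset.ne_of_mem_erase hb)]
  have hupd : ∀ a n, X' p (Function.update L a n) = ∑ I, (Pa a I * jac e e' p (I a) n) • X p I := by
    intro a n
    rw [h p hpW]
    refine Finset.sum_congr rfl fun I _ ↦ ?_
    congr 1
    rw [← Finset.mul_prod_erase Finset.univ _ (Finset.mem_univ a), Function.update_self, mul_comm]
    congr 1
    exact Finset.prod_congr rfl fun b hb ↦ by
      rw [Function.update_of_ne (Finset.ne_of_mem_erase hb)]
  have hpd : pd e' m' (fun q ↦ X' q L) p = (∑ I, P I • ∑ m, jac e e' p m m' •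
      pd e m (fun q ↦ X q I) p) + ∑ a, ∑ I, (Pa a I * pd e' m' (fun q ↦ jac e e' q (I a) (L a)) p) •
        X p I := by
    rw [pd_congr_of_eqOn hW hpW hp' fun q hq ↦ h q hq L]
    have hpr := fun I : Fin k → Fin 4 ↦ pd_prod (s := Finset.univ) hp'
      (fun a ↦ dj (I a) (L a)) m'
    rw [pd_sum fun I _ ↦ (hpr I).1.smul (dX' I), Finset.sum_comm, ← Finset.sum_add_distrib]
    refine Finset.sum_congr rfl fun I _ ↦ ?_
    rw [pd_smul hp' (hpr I).1 (dX' I), (hpr I).2, pd_chain he he' hp hp' (dX I), Finset.sum_smul]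
  -- The inhomogeneous part of the Christoffel law reproduces, slot by slot, the derivatives of the
  -- Jacobian in `hpd`; the two cancel in `hlhs`.
  have hcor : ∀ a, ∑ n, g.christoffel e' p n m' (L a) • X' p (Function.update L a n) =
      ∑ I, (Pa a I * pd e' m' (fun q ↦ jac e e' q (I a) (L a)) p) • X p I
      + ∑ m, ∑ I, (jac e e' p m m' * P I) •
        ∑ n, g.christoffel e p n m (I a) • X p (Function.update I a n) := by
    intro a
    have e1 : ∑ m, ∑ I, (jac e e' p m m' * P I) •
        ∑ n, g.christoffel e p n m (I a) • X p (Function.update I a n) =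
        ∑ m, ∑ I, ∑ c, (Pa a I * (jac e e' p m m' * g.christoffel e p (I a) m c *
          jac e e' p c (L a))) • X p I := by
      refine Finset.sum_congr rfl fun m _ ↦ ?_
      -- This moves the replaced index from `X` into the coefficient, so that both sides become sums
      -- over the same components of `X`.
      rw [sum_sum_update a]
      refine Finset.sum_congr rfl fun I _ ↦ ?_
      rw [Finset.smul_sum]
      refine Finset.sum_congr rfl fun n _ ↦ ?_
      rw [hPau, Function.update_self, smul_smul, hPPa a I]
      congr 1
      ring
    rw [e1]
    simp only [hupd, Finset.smul_sum, smul_smul]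
    rw [Finset.sum_comm, Finset.sum_comm (s := Finset.univ) (t := Finset.univ)
      (f := fun m I ↦ ∑ c, (Pa a I * (jac e e' p m m' * g.christoffel e p (I a) m c *
          jac e e' p c (L a))) • X p I), ← Finset.sum_add_distrib]
    refine Finset.sum_congr rfl fun I _ ↦ ?_
    simp only [← Finset.sum_smul]
    rw [← add_smul]
    congr 1
    have := g.sum_jac_mul_christoffel he he' hp hp' (I a) m' (L a)
    simp only [← Finset.mul_sum]
    rw [← mul_add, ← this, Finset.mul_sum]
    exact Finset.sum_congr rfl fun n _ ↦ by ring
  have hlhs : g.covD e' X' p I' = (∑ I, P I • ∑ m, jac e e' p m m' •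
      pd e m (fun q ↦ X q I) p) - ∑ a, ∑ m, ∑ I, (jac e e' p m m' * P I) •
        ∑ n, g.christoffel e p n m (I a) • X p (Function.update I a n) := by
    change pd e' m' (fun q ↦ X' q L) p - ∑ a, ∑ n, g.christoffel e' p n m' (L a) •
      X' p (Function.update L a n) = _
    simp only [hcor, Finset.sum_add_distrib, hpd]
    abel
  rw [hlhs, sum_fin_succ_arrow]
  have hrhs : ∀ m (I : Fin k → Fin 4), (∏ a, jac e e' p ((Fin.cons m I : Fin (k + 1) → Fin 4) a)
      (I' a)) • g.covD e X p (Fin.cons m I) = (jac e e' p m m' * P I) •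
        pd e m (fun q ↦ X q I) p - ∑ a, (jac e e' p m m' * P I) •
          ∑ n, g.christoffel e p n m (I a) • X p (Function.update I a n) := by
    intro m I
    rw [Fin.prod_univ_succ, ← Finset.smul_sum, ← smul_sub]
    rfl
  simp only [hrhs, Finset.sum_sub_distrib]
  congr 1
  · rw [Finset.sum_comm]
    refine Finset.sum_congr rfl fun I _ ↦ ?_
    rw [Finset.smul_sum]
    exact Finset.sum_congr rfl fun m _ ↦ by rw [smul_smul, mul_comm]
  · rw [Finset.sum_comm]
    exact Finset.sum_congr rfl fun m _ ↦ Finset.sum_comm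

/-- The wave operator does not depend on the chart. -/
theorem transforms_box (he : e ∈ IsManifold.maximalAtlas (𝓡 4) ∞ M)
    (he' : e' ∈ IsManifold.maximalAtlas (𝓡 4) ∞ M) (hW : IsOpen W)
    (hWe : W ⊆ e.source ∩ e'.source) {X X' : CompField M k V}
    (hX : ∀ I, SmoothOn W (fun q ↦ X q I)) (h : ∀ q ∈ W, Transforms e e' q (X q) (X' q))
    (hpW : p ∈ W) : Transforms e e' p (g.box e X p) (g.box e' X' p) := by
  have hp := (hWe hpW).1
  have hp' := (hWe hpW).2
  have h1 := g.transforms_covD he he' hW hWe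
    (fun I ↦ g.smoothOn_covD he hW (fun q hq ↦ (hWe hq).1) hX I)
    (fun q hq ↦ g.transforms_covD he he' hW hWe hX h hq) hpW
  -- Contraction with the inverse metric undoes the two Jacobians of the derivative indices.
  have hup : ∀ m n, ∑ m', ∑ n', g.up e' p m' n' * (jac e e' p m m' * jac e e' p n n') =
      g.up e p m n := by
    intro m n
    have h2 : jacMat e e' p * g.upMat e' p * (jacMat e e' p).transpose = g.upMat e p := by
      rw [g.upMat_change he he' hp hp']
      have h3 := jacMat_mul_jacMat he he' hp hp'
      have h5 : (jacMat e' e p).transpose * (jacMat e e' p).transpose = 1 := by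
        rw [← Matrix.transpose_mul, h3, Matrix.transpose_one]
      calc _ = jacMat e e' p * jacMat e' e p * g.upMat e p * ((jacMat e' e p).transpose *
            (jacMat e e' p).transpose) := by noncomm_ring
        _ = _ := by rw [h3, h5, one_mul, mul_one]
    have h4 := congrFun (congrFun h2 m) n
    refine Eq.trans ?_ h4
    simp only [Matrix.mul_apply, Matrix.transpose_apply, Finset.sum_mul]
    rw [Finset.sum_comm]
    exact Finset.sum_congr rfl fun _ _ ↦ Finset.sum_congr rfl fun _ _ ↦ by
      simp only [jacMat, upMat, Matrix.of_apply]; ring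
  intro I'
  unfold box
  have h2 : ∀ m' n', g.covD e' (g.covD e' X') p (Fin.cons m' (Fin.cons n' I')) =
      ∑ m, ∑ n, ∑ I : Fin k → Fin 4, (jac e e' p m m' * jac e e' p n n') •
        (∏ a, jac e e' p (I a) (I' a)) • g.covD e (g.covD e X) p (Fin.cons m (Fin.cons n I)) := by
    intro m' n'
    rw [h1, sum_fin_succ_arrow]
    refine Finset.sum_congr rfl fun m _ ↦ ?_
    rw [sum_fin_succ_arrow]
    refine Finset.sum_congr rfl fun n _ ↦ Finset.sum_congr rfl fun I _ ↦ ?_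
    rw [Fin.prod_univ_succ, Fin.prod_univ_succ, smul_smul]
    simp [mul_assoc]
  simp only [h2, Finset.smul_sum]
  rw [sum_sum_comm, Finset.sum_comm (γ := Fin k → Fin 4)]
  refine Finset.sum_congr rfl fun m _ ↦ ?_
  rw [Finset.sum_comm (γ := Fin k → Fin 4)]
  refine Finset.sum_congr rfl fun n _ ↦ ?_
  rw [Finset.sum_congr rfl fun m' _ ↦ Finset.sum_comm, Finset.sum_comm]
  refine Finset.sum_congr rfl fun I _ ↦ ?_
  rw [smul_comm _ (g.up e p m n), ← hup m n]
  simp only [smul_smul, Finset.sum_mul, Finset.sum_smul, mul_assoc]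

end Transformation

end LorentzMetric

namespace Spacetime

/-! ### Change of basis for duals and scalar products. -/

section ChangeOfBasis

variable {J K h g : Matrix (Fin 4) (Fin 4) ℂ} {w : ℂ}

/-- The Hodge dual does not depend on the basis. -/
theorem hodge_change (hJK : J * K = 1) (hh : h.transpose = h) {A : Matrix (Fin 4) (Fin 4) ℂ}
    (hA : IsAlt A) : hodge (J.det * w) (K * h * K.transpose) (J.transpose * A * J) =
      J.transpose * hodge w h A * J := by
  have hKJ : K * J = 1 := mul_eq_one_comm.1 hJK
  have h1 : K.transpose * J.transpose = 1 := by
    rw [← Matrix.transpose_mul, hJK, Matrix.transpose_one]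
  have h1' : J.transpose * K.transpose = 1 := by
    rw [← Matrix.transpose_mul, hKJ, Matrix.transpose_one]
  have h2 : K * h * K.transpose * (J.transpose * A * J) * (K * h * K.transpose) =
      K * (h * A * h) * K.transpose := by
    calc _ = K * h * (K.transpose * J.transpose) * A * (J * K) * h * K.transpose := by noncomm_ring
      _ = _ := by rw [h1, hJK, mul_one, mul_one]; noncomm_ring
  have h3 := flatDual_conj K (isAlt_conj hh hA)
  have h4 : J.det * K.det = 1 := by rw [← Matrix.det_mul, hJK, Matrix.det_one]
  have h5 : flatDual (K * (h * A * h) * K.transpose) =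
      K.det • (J.transpose * flatDual (h * A * h) * J) := by
    calc _ = (J.transpose * K.transpose) * flatDual (K * (h * A * h) * K.transpose) * (K * J) := by
          rw [h1', hKJ, one_mul, mul_one]
      _ = J.transpose * (K.transpose * flatDual (K * (h * A * h) * K.transpose) * K) * J := by
          noncomm_ring
      _ = _ := by rw [h3, Matrix.mul_smul, Matrix.smul_mul]
  rw [hodge, hodge, h2, h5, smul_smul, Matrix.mul_smul, Matrix.smul_mul]
  congr 1
  linear_combination w * h4

theorem selfDual_change (hJK : J * K = 1) (hh : h.transpose = h) {A : Matrix (Fin 4) (Fin 4) ℂ}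
    (hA : IsAlt A) : selfDual (J.det * w) (K * h * K.transpose) (J.transpose * A * J) =
      J.transpose * selfDual w h A * J := by
  rw [selfDual, selfDual, hodge_change hJK hh hA]
  simp only [mul_add, add_mul, Matrix.mul_smul, Matrix.smul_mul]

theorem formInner_change (hJK : J * K = 1) (A B : Matrix (Fin 4) (Fin 4) ℂ) :
    formInner (K * h * K.transpose) (J.transpose * A * J) (J.transpose * B * J) =
      formInner h A B := by
  have h1 : K.transpose * J.transpose = 1 := by
    rw [← Matrix.transpose_mul, hJK, Matrix.transpose_one]
  rw [formInner, formInner]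
  congr 1
  calc _ = (J.transpose * (A * (J * K) * h * (K.transpose * J.transpose) * B * (J * K) * h *
        K.transpose)).trace := by congr 1; noncomm_ring
    _ = _ := by
      rw [Matrix.trace_mul_comm, Matrix.mul_assoc _ K.transpose, h1, hJK]
      simp only [mul_one]

theorem rowWedge_change (a b : Fin 4) : rowWedge (J.transpose * g * J) a b =
    ∑ n, ∑ m, (J n a * J m b) • (J.transpose * rowWedge g n m * J) := by
  have h1 : ∀ a c, (J.transpose * g * J) a c = ∑ n, J n a * (g * J) n c := fun a c ↦ by
    rw [Matrix.mul_assoc, Matrix.mul_apply]; rfl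
  have h2 : ∀ n m c d, (J.transpose * rowWedge g n m * J) c d =
      (g * J) n c * (g * J) m d - (g * J) n d * (g * J) m c := by
    intro n m c d
    have e1 : (g * J) n d * (g * J) m c = (g * J) m c * (g * J) n d := mul_comm _ _
    rw [e1]
    simp only [Matrix.mul_apply, Matrix.transpose_apply, rowWedge, Matrix.of_apply,
      Finset.sum_mul_sum, ← Finset.sum_sub_distrib]
    simp only [Finset.sum_mul]
    rw [Finset.sum_comm]
    exact Finset.sum_congr rfl fun r _ ↦ Finset.sum_congr rfl fun s _ ↦ by ring
  ext c d
  simp only [Matrix.sum_apply, Matrix.smul_apply, h2, smul_eq_mul]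
  simp only [rowWedge, Matrix.of_apply, h1, Finset.sum_mul_sum, ← Finset.sum_sub_distrib]
  exact Finset.sum_congr rfl fun n _ ↦ Finset.sum_congr rfl fun m _ ↦ by ring

end ChangeOfBasis

end Spacetime

namespace LorentzMetric

/-! ### Chart independence of the Mars–Simon tensor. -/

section Transformation

variable {M : Type*} [TopologicalSpace M] [ChartedSpace E4 M] [IsManifold (𝓡 4) ∞ M]
  {g : LorentzMetric M} (ε : g.VolumeForm) {T : ∀ p : M, TangentSpace (𝓡 4) p}
  {e e' : OpenPartialHomeomorph M E4} {p : M} {σ : M → ℂ}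

/-- A genuine four-form acquires the determinant without absolute value, so charts of opposite
orientation need no separate treatment. -/
theorem vol_change (he : e ∈ IsManifold.maximalAtlas (𝓡 4) ∞ M) (hp : p ∈ e.source) :
    ε.vol e' p = (jacMat e e' p).det * ε.vol e p := by
  have h := (ε.form p).eq_smul_basis_det (frameBasis he hp)
  have hf : ⇑(frameBasis he hp) = frame e p := funext (frameBasis_apply he hp)
  unfold VolumeForm.vol
  conv_lhs => rw [h]
  rw [AlternatingMap.smul_apply, hf, smul_eq_mul, mul_comm, Module.Basis.det_apply]
  congr 2

theorem isAlt_rowWedge_loMat (a b : Fin 4) :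
    IsAlt ((1 / 4 : ℂ) • rowWedge (cx (g.loMat e p)) a b) := (isAlt_rowWedge _ a b).smul _

theorem cx_jacMat_mul (he : e ∈ IsManifold.maximalAtlas (𝓡 4) ∞ M)
    (he' : e' ∈ IsManifold.maximalAtlas (𝓡 4) ∞ M) (hp : p ∈ e.source) (hp' : p ∈ e'.source) :
    cx (jacMat e e' p) * cx (jacMat e' e p) = 1 := by
  rw [← map_mul, jacMat_mul_jacMat he he' hp hp', map_one]

theorem cx_upMat_change (he : e ∈ IsManifold.maximalAtlas (𝓡 4) ∞ M)
    (he' : e' ∈ IsManifold.maximalAtlas (𝓡 4) ∞ M) (hp : p ∈ e.source) (hp' : p ∈ e'.source) :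
    cx (g.upMat e' p) = cx (jacMat e' e p) * cx (g.upMat e p) * (cx (jacMat e' e p)).transpose := by
  rw [g.upMat_change he he' hp hp', map_mul, map_mul, cx_transpose]

theorem sd_change (he : e ∈ IsManifold.maximalAtlas (𝓡 4) ∞ M)
    (he' : e' ∈ IsManifold.maximalAtlas (𝓡 4) ∞ M) (hp : p ∈ e.source) (hp' : p ∈ e'.source)
    {A : Matrix (Fin 4) (Fin 4) ℂ} (hA : IsAlt A) :
    sd ε e' p ((cx (jacMat e e' p)).transpose * A * cx (jacMat e e' p)) =
      (cx (jacMat e e' p)).transpose * sd ε e p A * cx (jacMat e e' p) := by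
  have h := selfDual_change (w := (ε.vol e p : ℂ)) (cx_jacMat_mul he he' hp hp')
    (cx_upMat_transpose (g := g) (e := e) (p := p)) hA
  rw [← h, sd, vol_change ε (e' := e') he hp, cx_upMat_change he he' hp hp', cx_det]
  push_cast
  rfl

/-- As `F` is the covariant derivative of the one-form dual to `T`, this is an instance of
`transforms_covD`. -/
theorem FMat_change (hT : g.IsKilling T) (he : e ∈ IsManifold.maximalAtlas (𝓡 4) ∞ M)
    (he' : e' ∈ IsManifold.maximalAtlas (𝓡 4) ∞ M) (hp : p ∈ e.source) (hp' : p ∈ e'.source) :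
    FMat g T e' p = (jacMat e e' p).transpose * FMat g T e p * jacMat e e' p := by
  have h := g.transforms_covD he he' (e.open_source.inter e'.open_source) le_rfl
    (X := g.flat T e) (X' := g.flat T e')
    (fun I ↦ (g.smoothOn_lower hT he (I 0)).mono Set.inter_subset_left)
    (fun q hq I' ↦ by
      rw [sum_fin_succ_arrow]
      simp only [flat, Fin.prod_univ_one]
      rw [frame_eq_sum_jac (e := e) (e' := e') he hq.1]
      simp) ⟨hp, hp'⟩
  ext a b
  have h1 := h ![a, b]
  rw [sum_fin_succ_arrow] at h1
  simp only [sum_fin_succ_arrow (k := 0)] at h1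
  refine h1.trans ?_
  simp only [Matrix.mul_apply, Matrix.transpose_apply, Finset.sum_mul]
  rw [Finset.sum_comm]
  refine Finset.sum_congr rfl fun n _ ↦ Finset.sum_congr rfl fun m _ ↦ ?_
  refine (Fintype.sum_subsingleton _ Matrix.vecEmpty).trans ?_
  rw [Fin.prod_univ_two]
  change (jac e e' p m a * jac e e' p n b) • FMat g T e p m n = _
  simp only [jacMat, Matrix.of_apply, smul_eq_mul]
  ring

theorem fMat_change (hT : g.IsKilling T) (he : e ∈ IsManifold.maximalAtlas (𝓡 4) ∞ M)
    (he' : e' ∈ IsManifold.maximalAtlas (𝓡 4) ∞ M) (hp : p ∈ e.source) (hp' : p ∈ e'.source) :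
    fMat ε T e' p = (cx (jacMat e e' p)).transpose * fMat ε T e p * cx (jacMat e e' p) := by
  rw [fMat_eq ε hT he' hp', FMat_change hT he he' hp hp', map_mul, map_mul, ← cx_transpose,
    sd_change ε he he' hp hp' (isAlt_FMat hT he hp).cx, ← fMat_eq ε hT he hp]

theorem FFsq_change (hT : g.IsKilling T) (he : e ∈ IsManifold.maximalAtlas (𝓡 4) ∞ M)
    (he' : e' ∈ IsManifold.maximalAtlas (𝓡 4) ∞ M) (hp : p ∈ e.source) (hp' : p ∈ e'.source) :
    g.FFsq T ε e' p = g.FFsq T ε e p := by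
  rw [FFsq_eq ε hT he' hp', FFsq_eq ε hT he hp, fMat_change ε hT he he' hp hp',
    cx_upMat_change he he' hp hp', formInner_change (cx_jacMat_mul he he' hp hp')]

/-- Pair symmetry identifies the matrix in the last two indices with the lowered curvature matrix,
to which `jacMat_mul_curv` applies. -/
theorem riemMat_change (he : e ∈ IsManifold.maximalAtlas (𝓡 4) ∞ M)
    (he' : e' ∈ IsManifold.maximalAtlas (𝓡 4) ∞ M) (hp : p ∈ e.source) (hp' : p ∈ e'.source)
    (a b : Fin 4) : riemMat g e' p a b = ∑ n, ∑ m, (jac e e' p n a * jac e e' p m b) •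
      ((jacMat e e' p).transpose * riemMat g e p n m * jacMat e e' p) := by
  have h1 : ∀ {e : OpenPartialHomeomorph M E4}, e ∈ IsManifold.maximalAtlas (𝓡 4) ∞ M →
      p ∈ e.source → ∀ a b, riemMat g e p a b = g.loMat e p * g.curv e a b p := by
    intro e he hp a b
    ext c d
    rw [loMat_mul_curv_apply, g.riemann_pair_symm he hp]
    rfl
  simp only [h1 he hp]
  rw [h1 he' hp', g.loMat_change (e' := e') he hp, Matrix.mul_assoc,
    g.jacMat_mul_curv he he' hp hp']
  simp only [Finset.sum_mul, Finset.mul_sum, Matrix.smul_mul, Matrix.mul_smul, Matrix.mul_assoc]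

theorem rMat_change (hvac : g.IsVacuum) (he : e ∈ IsManifold.maximalAtlas (𝓡 4) ∞ M)
    (he' : e' ∈ IsManifold.maximalAtlas (𝓡 4) ∞ M) (hp : p ∈ e.source) (hp' : p ∈ e'.source)
    (a b : Fin 4) : rMat ε e' p a b = ∑ n, ∑ m, ((jac e e' p n a : ℂ) * (jac e e' p m b : ℂ)) •
      ((cx (jacMat e e' p)).transpose * rMat ε e p n m * cx (jacMat e e' p)) := by
  rw [rMat_eq ε hvac he' hp', riemMat_change he he' hp hp']
  simp only [map_sum, cx_smul, map_mul, ← cx_transpose, selfDual_sum, selfDual_smul, sd]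
  refine Finset.sum_congr rfl fun n _ ↦ Finset.sum_congr rfl fun m _ ↦ ?_
  rw [rMat_eq ε hvac he hp, ← sd_change ε he he' hp hp' (isAlt_riemMat n m).cx]
  push_cast
  rfl

theorem iMat_change (he : e ∈ IsManifold.maximalAtlas (𝓡 4) ∞ M)
    (he' : e' ∈ IsManifold.maximalAtlas (𝓡 4) ∞ M) (hp : p ∈ e.source) (hp' : p ∈ e'.source)
    (a b : Fin 4) : iMat ε e' p a b = ∑ n, ∑ m, ((jac e e' p n a : ℂ) * (jac e e' p m b : ℂ)) •
      ((cx (jacMat e e' p)).transpose * iMat ε e p n m * cx (jacMat e e' p)) := by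
  rw [iMat_eq ε he' hp', g.loMat_change (e' := e') he hp, map_mul, map_mul, ← cx_transpose,
    rowWedge_change]
  simp only [Finset.smul_sum, selfDual_sum, selfDual_smul, sd]
  refine Finset.sum_congr rfl fun n _ ↦ Finset.sum_congr rfl fun m _ ↦ ?_
  rw [iMat_eq ε he hp, ← sd_change ε he he' hp hp' (isAlt_rowWedge_loMat n m), Matrix.mul_smul,
    Matrix.smul_mul, sd, selfDual_smul, smul_comm]
  rfl

/-- The Mars–Simon tensor does not depend on the chart. -/
theorem transforms_marsSimon (hvac : g.IsVacuum) (hT : g.IsKilling T)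
    (he : e ∈ IsManifold.maximalAtlas (𝓡 4) ∞ M) (he' : e' ∈ IsManifold.maximalAtlas (𝓡 4) ∞ M)
    (hp : p ∈ e.source) (hp' : p ∈ e'.source) :
    Transforms e e' p (g.marsSimon T ε σ e p) (g.marsSimon T ε σ e' p) := by
  have hS : ∀ a b, sMat ε T σ e' p a b = ∑ n, ∑ m,
      ((jac e e' p n a : ℂ) * (jac e e' p m b : ℂ)) •
      ((cx (jacMat e e' p)).transpose * sMat ε T σ e p n m * cx (jacMat e e' p)) := by
    intro a b
    have hf : fMat ε T e' p a b = ∑ n, ∑ m,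
        ((jac e e' p n a : ℂ) * (jac e e' p m b : ℂ)) * fMat ε T e p n m := by
      rw [fMat_change ε hT he he' hp hp']
      simp only [Matrix.mul_apply, Matrix.transpose_apply, Finset.sum_mul]
      rw [Finset.sum_comm]
      refine Finset.sum_congr rfl fun n _ ↦ Finset.sum_congr rfl fun m _ ↦ ?_
      simp only [cx_apply, jacMat, Matrix.of_apply]
      ring
    unfold sMat qMat
    rw [rMat_change ε hvac he he' hp hp', iMat_change ε he he' hp hp', FFsq_change ε hT he he' hp hp',
      hf]
    conv_lhs => rw [fMat_change ε hT he he' hp hp']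
    simp only [Finset.sum_smul, Finset.smul_sum, ← Finset.sum_sub_distrib, ← Finset.sum_add_distrib]
    refine Finset.sum_congr rfl fun n _ ↦ Finset.sum_congr rfl fun m _ ↦ ?_
    simp only [mul_add, add_mul, mul_sub, sub_mul, Matrix.mul_smul, Matrix.smul_mul]
    module
  intro I'
  simp only [sum_fin_succ_arrow, Fin.prod_univ_four, marsSimon_apply]
  rw [hS]
  simp only [Matrix.sum_apply, Matrix.smul_apply, Matrix.mul_apply, Matrix.transpose_apply,
    Finset.sum_mul, Finset.smul_sum]
  refine Finset.sum_congr rfl fun n _ ↦ Finset.sum_congr rfl fun m _ ↦ ?_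
  rw [Finset.sum_comm]
  refine Finset.sum_congr rfl fun r _ ↦ Finset.sum_congr rfl fun s _ ↦ ?_
  rw [Fintype.sum_unique]
  change _ = (jac e e' p n (I' 0) * jac e e' p m (I' 1) * jac e e' p r (I' 2) *
    jac e e' p s (I' 3)) • sMat ε T σ e p n m r s
  rw [Complex.real_smul]
  simp only [jacMat, Matrix.of_apply, smul_eq_mul, cx_apply]
  push_cast
  ring

end Transformation

end LorentzMetric

namespace Spacetime

/-! ### Patching chart coefficients with a partition of unity. -/

section Glue

variable {M : Type*} [TopologicalSpace M] [ChartedSpace E4 M] {k l : ℕ}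

/-- The linear map between tensors at a point which has the given matrix in a chart. -/
noncomputable def chartMap (e : OpenPartialHomeomorph M E4) (p : M)
    (c : (Fin l → Fin 4) → (Fin k → Fin 4) → ℂ) : CTensor k p →ₗ[ℂ] CTensor l p where
  toFun τ := toTensor e p fun I ↦ ∑ J, c I J * τ fun j ↦ frame e p (J j)
  map_add' τ τ' := by
    ext v
    simp only [add_apply, toTensor_apply, mul_add, Finset.sum_add_distrib, add_mul]
  map_smul' a τ := by
    ext v
    simp only [smul_apply, toTensor_apply, RingHom.id_apply, smul_eq_mul,
      Finset.mul_sum, Finset.sum_mul]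
    exact Finset.sum_congr rfl fun _ _ ↦ Finset.sum_congr rfl fun _ _ ↦ by ring

theorem chartMap_apply (e : OpenPartialHomeomorph M E4) (p : M)
    (c : (Fin l → Fin 4) → (Fin k → Fin 4) → ℂ) (τ : CTensor k p) :
    chartMap e p c τ = toTensor e p fun I ↦ ∑ J, c I J * τ fun j ↦ frame e p (J j) := rfl

variable [IsManifold (𝓡 4) ∞ M] {e e' : OpenPartialHomeomorph M E4} {p : M}

theorem toTensor_frame (he : e ∈ IsManifold.maximalAtlas (𝓡 4) ∞ M) (hp : p ∈ e.source)
    (x : (Fin k → Fin 4) → ℂ) (J : Fin k → Fin 4) :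
    toTensor e p x (fun j ↦ frame e p (J j)) = x J := by
  rw [toTensor_apply, Finset.sum_eq_single J]
  · simp [coframe_frame he hp]
  · intro I _ hI
    obtain ⟨j, hj⟩ := Function.ne_iff.1 hI
    rw [Finset.prod_eq_zero (Finset.mem_univ j) (by simp [coframe_frame he hp, hj]), mul_zero]
  · simp

theorem chartMap_toTensor (he : e ∈ IsManifold.maximalAtlas (𝓡 4) ∞ M) (hp : p ∈ e.source)
    (c : (Fin l → Fin 4) → (Fin k → Fin 4) → ℂ) (x : (Fin k → Fin 4) → ℂ) :
    chartMap e p c (toTensor e p x) = toTensor e p fun I ↦ ∑ J, c I J * x J := by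
  rw [chartMap_apply]
  simp only [toTensor_frame he hp]

theorem smoothOn_chartMap (he : e ∈ IsManifold.maximalAtlas (𝓡 4) ∞ M)
    (he' : e' ∈ IsManifold.maximalAtlas (𝓡 4) ∞ M) {U : Set M}
    {c : (Fin l → Fin 4) → (Fin k → Fin 4) → M → ℂ} (hc : ∀ I J, SmoothOn (e'.source ∩ U) (c I J))
    (I : Fin l → Fin 4) (J : Fin k → Fin 4) :
    SmoothOn (e.source ∩ e'.source ∩ U) (fun p ↦ chartMap e' p (fun I J ↦ c I J p)
      (toTensor e p (Pi.single J 1)) (fun a ↦ frame e p (I a))) := by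
  have h1 : e.source ∩ e'.source ∩ U ⊆ e.source ∩ e'.source := Set.inter_subset_left
  have h2 : e.source ∩ e'.source ∩ U ⊆ e'.source ∩ e.source := fun q hq ↦ ⟨hq.1.2, hq.1.1⟩
  have h3 : e.source ∩ e'.source ∩ U ⊆ e'.source ∩ U := fun q hq ↦ ⟨hq.1.2, hq.2⟩
  -- In the chart `e` the coefficients are those of the chart `e'` multiplied by Jacobians on both
  -- sides.
  have h4 : ∀ p, chartMap e' p (fun I J ↦ c I J p)
      (toTensor e p (Pi.single J 1)) (fun a ↦ frame e p (I a)) =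
      ∑ I' : Fin l → Fin 4, (∑ J' : Fin k → Fin 4, c I' J' p *
        ∏ j, (jac e e' p (J j) (J' j) : ℂ)) * ∏ a, (jac e' e p (I' a) (I a) : ℂ) := by
    intro p
    rw [chartMap_apply, toTensor_apply]
    refine Finset.sum_congr rfl fun I' _ ↦ ?_
    congr 1
    refine Finset.sum_congr rfl fun J' _ ↦ ?_
    rw [toTensor_apply, Finset.sum_eq_single J (fun K _ hK ↦ by simp [hK]) (by simp)]
    simp [jac]
  simp only [h4]
  exact SmoothOn.sum fun I' _ ↦ SmoothOn.mul (SmoothOn.sum fun J' _ ↦ SmoothOn.mul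
    ((hc I' J').mono h3) (SmoothOn.prod fun j _ ↦
      SmoothOn.ofReal ((smoothOn_jac he he' (J j) (J' j)).mono h1)))
    (SmoothOn.prod fun a _ ↦ SmoothOn.ofReal ((smoothOn_jac he' he (I' a) (I a)).mono h2))

/-- The linear map between tensors which is patched together from matrices in the charts. -/
noncomputable def glueMap (ρ : SmoothPartitionOfUnity M (𝓡 4) M Set.univ)
    (c : M → (Fin l → Fin 4) → (Fin k → Fin 4) → M → ℂ) (p : M) : CTensor k p →ₗ[ℂ] CTensor l p :=
  ∑ i ∈ ρ.finsupport p, ((ρ i p : ℝ) : ℂ) • chartMap (chartAt E4 i) p (fun I J ↦ c i I J p)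

/-- By subordination, a point in the support of `ρ i` lies in the chart at `i`, so smoothness of `c
i` on that chart domain suffices; local finiteness handles the sum. -/
theorem isSmoothTensorMap_glueMap {ρ : SmoothPartitionOfUnity M (𝓡 4) M Set.univ}
    (hρ : ρ.IsSubordinate fun i ↦ (chartAt E4 i).source) {U : Set M} (hU : IsOpen U)
    {c : M → (Fin l → Fin 4) → (Fin k → Fin 4) → M → ℂ}
    (hc : ∀ i I J, SmoothOn ((chartAt E4 i).source ∩ U) (c i I J)) :
    IsSmoothTensorMap U (glueMap ρ c) := by
  intro e he I J
  have h1 : ∀ p, glueMap ρ c p (toTensor e p (Pi.single J 1)) (fun a ↦ frame e p (I a)) =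
      ∑ᶠ i, ρ i p • chartMap (chartAt E4 i) p (fun I J ↦ c i I J p)
        (toTensor e p (Pi.single J 1)) (fun a ↦ frame e p (I a)) := by
    intro p
    rw [← ρ.sum_finsupport_smul_eq_finsum p (fun i p ↦ chartMap (chartAt E4 i) p
      (fun I J ↦ c i I J p) (toTensor e p (Pi.single J 1)) (fun a ↦ frame e p (I a))), glueMap]
    simp only [LinearMap.sum_apply, LinearMap.smul_apply, sum_apply,
      smul_apply, smul_eq_mul, Complex.real_smul]
  simp only [h1]
  intro q hq
  refine ContMDiffAt.contMDiffWithinAt (ρ.contMDiffAt_finsum fun i hi ↦ ?_)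
  have hqi := hρ i hi
  exact (smoothOn_chartMap he (IsManifold.chart_mem_maximalAtlas i) (hc i) I J).contMDiffAt
    (((e.open_source.inter (chartAt E4 i).open_source).inter hU).mem_nhds ⟨⟨hq.1, hqi⟩, hq.2⟩)

end Glue

end Spacetime

namespace LorentzMetric

/-! ### From charts to the manifold. -/

section MarsSimon

variable {M : Type*} [TopologicalSpace M] [ChartedSpace E4 M] [IsManifold (𝓡 4) ∞ M]
  {g : LorentzMetric M} (ε : g.VolumeForm) {T : ∀ p : M, TangentSpace (𝓡 4) p} {σ : M → ℂ}

/-- The wave equation of the Mars–Simon tensor in a chart, with smooth coefficients. -/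
theorem exists_box_marsSimon_eq (hvac : g.IsVacuum) (hT : g.IsKilling T)
    (hσ : g.IsErnstPotential T ε σ) {e : OpenPartialHomeomorph M E4}
    (he : e ∈ IsManifold.maximalAtlas (𝓡 4) ∞ M) :
    ∃ (a : (Fin 4 → Fin 4) → (Fin 5 → Fin 4) → M → ℂ) (b : (Fin 4 → Fin 4) → (Fin 4 → Fin 4) → M → ℂ),
      (∀ I J, SmoothOn (e.source ∩ {p | σ p ≠ 1}) (a I J)) ∧
      (∀ I J, SmoothOn (e.source ∩ {p | σ p ≠ 1}) (b I J)) ∧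
      ∀ p ∈ e.source, σ p ≠ 1 → toTensor e p (g.box e (g.marsSimon T ε σ e) p) =
        chartMap e p (fun I J ↦ a I J p) (toTensor e p (g.covD e (g.marsSimon T ε σ e) p)) +
        chartMap e p (fun I J ↦ b I J p) (toTensor e p (g.marsSimon T ε σ e p)) := by
  choose c hc hc' using inSpan_box_marsSimon ε hvac hT hσ he
  refine ⟨fun I J ↦ c I (Sum.inl J), fun I J ↦ c I (Sum.inr J), fun I J ↦ hc I _,
    fun I J ↦ hc I _, fun p hp hp1 ↦ ?_⟩
  rw [chartMap_toTensor he hp, chartMap_toTensor he hp]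
  ext v
  rw [add_apply, toTensor_apply, toTensor_apply, toTensor_apply,
    ← Finset.sum_add_distrib]
  refine Finset.sum_congr rfl fun I _ ↦ ?_
  refine (congrArg (· * _) (hc' I p ⟨hp, hp1⟩)).trans ?_
  rw [Fintype.sum_sum_type]
  exact add_mul _ _ _

/-- The wave equation of the Mars–Simon tensor passes from one chart to another. -/
theorem box_marsSimon_eq_of_chart (hvac : g.IsVacuum) (hT : g.IsKilling T)
    (hσ : g.IsErnstPotential T ε σ) {e e' : OpenPartialHomeomorph M E4}
    (he : e ∈ IsManifold.maximalAtlas (𝓡 4) ∞ M) (he' : e' ∈ IsManifold.maximalAtlas (𝓡 4) ∞ M)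
    {p : M} (hp : p ∈ e.source) (hp' : p ∈ e'.source) (hp1 : σ p ≠ 1)
    {A : CTensor 5 p →ₗ[ℂ] CTensor 4 p} {B : CTensor 4 p →ₗ[ℂ] CTensor 4 p}
    (h : toTensor e' p (g.box e' (g.marsSimon T ε σ e') p) =
      A (toTensor e' p (g.covD e' (g.marsSimon T ε σ e') p)) +
        B (toTensor e' p (g.marsSimon T ε σ e' p))) :
    toTensor e p (g.box e (g.marsSimon T ε σ e) p) =
      A (toTensor e p (g.covD e (g.marsSimon T ε σ e) p)) +
        B (toTensor e p (g.marsSimon T ε σ e p)) := by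
  have hW := (e.open_source.inter e'.open_source).inter (isOpen_ne_one ε hσ)
  have hWe : e.source ∩ e'.source ∩ {p | σ p ≠ 1} ⊆ e.source ∩ e'.source := Set.inter_subset_left
  have hX : ∀ I, SmoothOn (e.source ∩ e'.source ∩ {p | σ p ≠ 1})
      (fun q ↦ g.marsSimon T ε σ e q I) := fun I ↦
    (smoothOn_sMat ε hT hσ he _ _ _ _).mono fun q hq ↦ ⟨hq.1.1, hq.2⟩
  have hS : ∀ q ∈ e.source ∩ e'.source ∩ {p | σ p ≠ 1}, Transforms e e' q
      (g.marsSimon T ε σ e q) (g.marsSimon T ε σ e' q) := fun q hq ↦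
    transforms_marsSimon ε hvac hT he he' hq.1.1 hq.1.2
  have h2 : (toTensor e p (g.covD e (g.marsSimon T ε σ e) p) : CTensor 5 p) =
      toTensor e' p (g.covD e' (g.marsSimon T ε σ e') p) :=
    (g.transforms_covD he he' hW hWe hX hS ⟨⟨hp, hp'⟩, hp1⟩).toTensor_eq he' hp'
  rw [(g.transforms_box he he' hW hWe hX hS ⟨⟨hp, hp'⟩, hp1⟩).toTensor_eq he' hp', h2,
    (hS p ⟨⟨hp, hp'⟩, hp1⟩).toTensor_eq he' hp', h]

end MarsSimon

end LorentzMetric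

theorem mainTheorem4 {M : Type*} [TopologicalSpace M] [T2Space M] [SecondCountableTopology M]
    [ChartedSpace E4 M] [IsManifold (𝓡 4) ∞ M]
    (g : LorentzMetric M) (hvac : g.IsVacuum) (ε : g.VolumeForm)
    (T : ∀ p : M, TangentSpace (𝓡 4) p) (hT : g.IsKilling T)
    (σ : M → ℂ) (hσ : g.IsErnstPotential T ε σ) :
    ∃ (A : ∀ p : M, CTensor 5 p →ₗ[ℂ] CTensor 4 p) (B : ∀ p : M, CTensor 4 p →ₗ[ℂ] CTensor 4 p),
      IsSmoothTensorMap {p | σ p ≠ 1} A ∧ IsSmoothTensorMap {p | σ p ≠ 1} B ∧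
      ∀ e ∈ IsManifold.maximalAtlas (𝓡 4) ∞ M, ∀ p ∈ e.source, σ p ≠ 1 →
        toTensor e p (g.box e (g.marsSimon T ε σ e) p) =
          A p (toTensor e p (g.covD e (g.marsSimon T ε σ e) p)) +
            B p (toTensor e p (g.marsSimon T ε σ e p)) := by
  have hU := LorentzMetric.isOpen_ne_one ε hσ
  -- Together with the Hausdorff and second countability assumptions, this provides the partition of
  -- unity.
  have : LocallyCompactSpace M := ChartedSpace.locallyCompactSpace E4 M
  obtain ⟨ρ, hρ⟩ := SmoothPartitionOfUnity.exists_isSubordinate_chartAt_source (𝓡 4) M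
  choose a b ha hb hab using fun i : M ↦ LorentzMetric.exists_box_marsSimon_eq ε hvac hT hσ
    (e := chartAt E4 i) (IsManifold.chart_mem_maximalAtlas i)
  refine ⟨glueMap ρ a, glueMap ρ b, isSmoothTensorMap_glueMap hρ hU ha,
    isSmoothTensorMap_glueMap hρ hU hb, fun e he p hp hp1 ↦ ?_⟩
  -- Each local equation, found in the chart at `i`, is transported to the given chart `e`, with the
  -- same linear maps at `p`.
  have key : ∀ i ∈ ρ.finsupport p, toTensor e p (g.box e (g.marsSimon T ε σ e) p) =
      chartMap (chartAt E4 i) p (fun I J ↦ a i I J p)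
        (toTensor e p (g.covD e (g.marsSimon T ε σ e) p)) +
      chartMap (chartAt E4 i) p (fun I J ↦ b i I J p)
        (toTensor e p (g.marsSimon T ε σ e p)) := by
    intro i hi
    have hpi : p ∈ (chartAt E4 i).source :=
      hρ i (subset_tsupport _ ((ρ.mem_finsupport p).1 hi))
    exact LorentzMetric.box_marsSimon_eq_of_chart (e' := chartAt E4 i) ε hvac hT hσ he
      (IsManifold.chart_mem_maximalAtlas i) hp hpi hp1 (hab i p hpi hp1)
  -- The weights sum to one, so averaging the equations of `key` leaves the left side unchanged and
  -- glues the coefficients.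
  have hsum : ∑ i ∈ ρ.finsupport p, ((ρ i p : ℝ) : ℂ) = 1 := by
    rw [← Complex.ofReal_sum, ρ.sum_finsupport p (Set.mem_univ p), Complex.ofReal_one]
  rw [glueMap, glueMap, LinearMap.sum_apply, LinearMap.sum_apply, ← Finset.sum_add_distrib]
  calc toTensor e p (g.box e (g.marsSimon T ε σ e) p)
      = ∑ i ∈ ρ.finsupport p, ((ρ i p : ℝ) : ℂ) •
          toTensor e p (g.box e (g.marsSimon T ε σ e) p) := by
        rw [← Finset.sum_smul, hsum, one_smul]
    _ = _ := Finset.sum_congr rfl fun i hi ↦ by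
        rw [LinearMap.smul_apply, LinearMap.smul_apply, ← smul_add, ← key i hi]
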